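/- **Setting.** An instance consists of a set $J=\{1,\dots,n\}$ of $n\ge 1$ unit-time jobs, a number $m$ of identical parallel machines, and for each job $j\in J$ a precedence constraint $\psi_j$, which is either a conjunction $\bigwedge_{i\in P_j}x_i$ or a disjunction $\bigvee_{i\in P_j}x_i$ over a set $P_j\subseteq J$ of *predecessors* of $j$ (*and+or-constraints*; the empty conjunction is the trivial constraint $\mathbb 1$). A job with $\psi_j\neq\mathbb 1$ is a *successor*; $J_s$ is the set of successors, $k_s=|J_s|$, and $J_s=J_s^{and}\,\dot\cup\,J_s^{or}$ according to the type of the constraint. A schedule assigns to each job a completion time $C_j\in\{1,2,\dots\}$ such that at most $m$ jobs have the same completion time. It is *feasible* if every $\psi_j$ is true when exactly the variables $x_i$ with $C_i<C_j$ are set to true. The objective $\gamma$ is the makespan $C_{\max}=\max_jC_j$ or the sum $\sum_jC_j$; a feasible schedule is *optimal* if it minimizes $\gamma$. An instance is feasible if it has a feasible schedule. **Algorithm and+or-alg-succ.** Run through all tuples $(\tau_j)_{j\in J_s}\in\{1,\dots,k_s\}^{J_s}$, all shifts $t\in\{0,\dots,n-k_s\}$ and all families $(S_j)_{j\in J_s^{or}}$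 with $j\in S_j\subseteq J_s$. For each such choice: 1. Set $C_j=\tau_j+t$ for $j\in J_s$; discard the choice if more than $m$ successors receive the same time. Order the successors by non-decreasing completion time. 2. For each $j\in J_s^{or}$ that has a predecessor $p\in J_s$ with $C_p<C_j$, let $i_j$ be such a $p$. 3. Go through the or-jobs $j$ in the above order. If $i_j$ is not yet defined, search for a job $i\in J\setminus J_s$ that is a predecessor of all jobs in $S_j$ and of no job outside $S_j$ that is an and-job or an or-job not earlier than $j$ in the order. If there is none, discard the choice; otherwise set $i_k=i$ for $k=j$ and for all later or-jobs $k$ for which $i_k$ is not yet defined and of which $i$ is a predecessor. 4. Replace the constraint of each or-job $j$ by $x_{i_j}$. Go through the successors $j$ in the above order and give each predecessor of $j$ that has no completion time yet the earliest time slot with an idle machine; discard the choice if some predecessor of $j$ does not precede $j$. Finally give each remaining job the earliest time slot with an idle machine. Return a schedule with the smallest value of $\gamma$ among the choices that are not discarded. The computational model is a random access machine with registers and arrays of natural numbers, whose arithmetic operations are addition and truncated subtraction, at unit cost per elementary operation. The input is given by $n$, $m$, the types of the constraints and the $n\times n$ zero-one matrix of the relation "$i$ is a predecessor of $j$". **Theorem.**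 Let $\gamma\in\{C_{\max},\sum_jC_j\}$. On every feasible instance with and+or-constraints with $k_s$ successors, and+or-alg-succ (implemented as an explicit program for this machine) halts and returns an optimal schedule in $O\bigl(k_s^{k_s}\cdot 2^{k_s^2}\cdot m\cdot n^3\bigr)$ steps, with an absolute constant and with $0^0=1$. Hence the problem of finding an optimal schedule of a feasible instance is fixed-parameter tractable in the number $k_s$ of successors: there are a program, a computable function $f$ and a constant $d$ such that the program solves every feasible instance of input length $L$ in bits (with $n,m$ encoded in binary) within $f(k_s)\cdot L^d$ steps. -/

import Mathlib

namespace AndOrSched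

/-! ### The scheduling problem -/

/-- A precedence constraint that is a conjunction or a disjunction of distinct unnegated variables
`x_i`, `i` a job. The trivial constraint (the logical one) is the empty conjunction. -/
inductive Constraint (n : ℕ) where
  | conj (P : Finset (Fin n))
  | disj (P : Finset (Fin n))
  deriving DecidableEq

namespace Constraint

/-- The jobs whose variables occur in the constraint (the predecessors). -/
def preds {n : ℕ} : Constraint n → Finset (Fin n)
  | conj P => P
  | disj P => P

/-- Whether the constraint is a disjunction. -/
def isDisj {n : ℕ} : Constraint n → Bool
  | conj _ => false
  | disj _ => true

/-- The constraint is satisfied by the assignment `x`. -/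
def Holds {n : ℕ} : Constraint n → (Fin n → Prop) → Prop
  | conj P, x => ∀ i ∈ P, x i
  | disj P, x => ∃ i ∈ P, x i

end Constraint

/-- An instance: unit-time jobs `Fin n`, `m` identical machines, and for every job a constraint that
is a conjunction or a disjunction. -/
structure Instance where
  n : ℕ
  m : ℕ
  ψ : Fin n → Constraint n

/-- The two objectives: makespan and sum of completion times. -/
inductive Objective where
  | makespan
  | sumCompletion

/-- The objective value of a schedule, given by its completion times. -/
def Objective.value {n : ℕ} : Objective → (Fin n → ℕ) → ℕ
  | makespan, C => Finset.univ.sup C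
  | sumCompletion, C => ∑ j, C j

namespace Instance

/-- Jobs with a non-trivial constraint. -/
def successors (I : Instance) : Finset (Fin I.n) :=
  Finset.univ.filter fun j => I.ψ j ≠ Constraint.conj ∅

/-- The number `k_s` of successors. -/
def ks (I : Instance) : ℕ := I.successors.card

/-- `C` is a feasible schedule: a job with completion time `t` occupies the time slot `t ≥ 1`, every
slot holds at most `m` jobs, and every constraint `ψ j` is satisfied when exactly the variables of
the jobs that precede `j` are set to true. -/
def FeasibleSchedule (I : Instance) (C : Fin I.n → ℕ) : Prop :=
  (∀ j, 1 ≤ C j) ∧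
  (∀ t, (Finset.univ.filter fun j => C j = t).card ≤ I.m) ∧
  ∀ j, (I.ψ j).Holds fun i => C i < C j

/-- The instance has a feasible schedule. -/
def Feasible (I : Instance) : Prop := ∃ C, I.FeasibleSchedule C

/-- `C` is a feasible schedule of minimum objective value. -/
def OptimalSchedule (I : Instance) (γ : Objective) (C : Fin I.n → ℕ) : Prop :=
  I.FeasibleSchedule C ∧ ∀ C', I.FeasibleSchedule C' → γ.value C ≤ γ.value C'

end Instance

/-! ### The machine model

A random access machine, programmed in a structured language. The memory consists of registers and
of arrays, all holding natural numbers. The only arithmetic operations are addition and truncated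
subtraction (no multiplication). Every literal, register access, array access, arithmetic operation,
comparison, Boolean connective, assignment and branch costs one step. -/

/-- Memory contents: registers and (one-dimensional) arrays. -/
structure State where
  reg : ℕ → ℕ
  arr : ℕ → ℕ → ℕ

namespace State

def setReg (s : State) (x v : ℕ) : State :=
  { s with reg := Function.update s.reg x v }

def setArr (s : State) (a i v : ℕ) : State :=
  { s with arr := Function.update s.arr a (Function.update (s.arr a) i v) }

end State

/-- Arithmetic expressions. -/
inductive Exp where
  | lit (c : ℕ)
  | reg (x : ℕ)
  | get (a : ℕ) (e : Exp)
  | add (e₁ e₂ : Exp)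
  | sub (e₁ e₂ : Exp)

namespace Exp

def eval (s : State) : Exp → ℕ
  | lit c => c
  | reg x => s.reg x
  | get a e => s.arr a (e.eval s)
  | add e₁ e₂ => e₁.eval s + e₂.eval s
  | sub e₁ e₂ => e₁.eval s - e₂.eval s

def cost : Exp → ℕ
  | lit _ => 1
  | reg _ => 1
  | get _ e => e.cost + 1
  | add e₁ e₂ => e₁.cost + e₂.cost + 1
  | sub e₁ e₂ => e₁.cost + e₂.cost + 1

end Exp

/-- Boolean tests. -/
inductive Test where
  | eq (e₁ e₂ : Exp)
  | lt (e₁ e₂ : Exp)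
  | not (b : Test)
  | and (b₁ b₂ : Test)
  | or (b₁ b₂ : Test)

namespace Test

def Holds (s : State) : Test → Prop
  | eq e₁ e₂ => e₁.eval s = e₂.eval s
  | lt e₁ e₂ => e₁.eval s < e₂.eval s
  | not b => ¬ b.Holds s
  | and b₁ b₂ => b₁.Holds s ∧ b₂.Holds s
  | or b₁ b₂ => b₁.Holds s ∨ b₂.Holds s

def cost : Test → ℕ
  | eq e₁ e₂ => e₁.cost + e₂.cost + 1
  | lt e₁ e₂ => e₁.cost + e₂.cost + 1
  | not b => b.cost + 1
  | and b₁ b₂ => b₁.cost + b₂.cost + 1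
  | or b₁ b₂ => b₁.cost + b₂.cost + 1

end Test

/-- Programs. -/
inductive Cmd where
  | skip
  | set (x : ℕ) (e : Exp)
  | store (a : ℕ) (i e : Exp)
  | seq (c₁ c₂ : Cmd)
  | ite (b : Test) (c₁ c₂ : Cmd)
  | loop (b : Test) (c : Cmd)

/-- `Exec c s t s'`: started in `s`, the program `c` halts after exactly `t` steps in `s'`. -/
inductive Exec : Cmd → State → ℕ → State → Prop where
  | skip (s : State) : Exec .skip s 1 s
  | set (x : ℕ) (e : Exp) (s : State) :
      Exec (.set x e) s (e.cost + 1) (s.setReg x (e.eval s))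
  | store (a : ℕ) (i e : Exp) (s : State) :
      Exec (.store a i e) s (i.cost + e.cost + 1) (s.setArr a (i.eval s) (e.eval s))
  | seq {c₁ c₂ : Cmd} {s s₁ s₂ : State} {t₁ t₂ : ℕ} :
      Exec c₁ s t₁ s₁ → Exec c₂ s₁ t₂ s₂ → Exec (.seq c₁ c₂) s (t₁ + t₂) s₂
  | iteTrue {b : Test} {c₁ c₂ : Cmd} {s s₁ : State} {t : ℕ} :
      b.Holds s → Exec c₁ s t s₁ → Exec (.ite b c₁ c₂) s (b.cost + 1 + t) s₁
  | iteFalse {b : Test} {c₁ c₂ : Cmd} {s s₁ : State} {t : ℕ} :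
      ¬ b.Holds s → Exec c₂ s t s₁ → Exec (.ite b c₁ c₂) s (b.cost + 1 + t) s₁
  | loopTrue {b : Test} {c : Cmd} {s s₁ s₂ : State} {t₁ t₂ : ℕ} :
      b.Holds s → Exec c s t₁ s₁ → Exec (.loop b c) s₁ t₂ s₂ →
      Exec (.loop b c) s (b.cost + 1 + t₁ + t₂) s₂
  | loopFalse {b : Test} {c : Cmd} {s : State} :
      ¬ b.Holds s → Exec (.loop b c) s (b.cost + 1) s

namespace Cmd

/-- Execute the commands of a list one after the other. -/
def block : List Cmd → Cmd
  | [] => skip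
  | c :: cs => seq c (block cs)

/-- `if b then c`. -/
def when (b : Test) (c : Cmd) : Cmd := ite b c skip

/-- `for x = 0, ..., e - 1 do c`. -/
def forLt (x : ℕ) (e : Exp) (c : Cmd) : Cmd :=
  seq (set x (.lit 0)) (loop (.lt (.reg x) e) (seq c (set x (.add (.reg x) (.lit 1)))))

/-- Increase the entry `i` of the array `a` by one. -/
def incArr (a : ℕ) (i : Exp) : Cmd := store a i (.add (.get a i) (.lit 1))

end Cmd

/-! ### Registers and arrays of the algorithm -/

/-- Number of jobs (input). -/
abbrev rN : ℕ := 0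
/-- Number of machines (input). -/
abbrev rM : ℕ := 1
/-- Number of successors. -/
abbrev rK : ℕ := 2
/-- Loop variables over jobs. -/
abbrev rI : ℕ := 3
abbrev rJ : ℕ := 4
/-- Loop variables over indices of successors. -/
abbrev rL : ℕ := 5
abbrev rL' : ℕ := 6
/-- Positions in the order of the successors by completion time. -/
abbrev rP : ℕ := 7
abbrev rP' : ℕ := 8
/-- The shift `t` of a tuple of successor completion times. -/
abbrev rShift : ℕ := 9
/-- A time slot. -/
abbrev rT : ℕ := 10
/-- 1 as long as the current choice has not been discarded. -/
abbrev rOk : ℕ := 11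
/-- A representative for an or-job. -/
abbrev rRep : ℕ := 12
/-- 1 if a job is a suitable representative. -/
abbrev rMatch : ℕ := 13
/-- Carry of the counters below. -/
abbrev rCarry : ℕ := 14
/-- 1 when all tuples have been enumerated. -/
abbrev rDoneTau : ℕ := 15
/-- 1 when all families of sets have been enumerated. -/
abbrev rDoneSel : ℕ := 16
/-- 1 if some schedule has been found (otherwise `OPT = ∞`). -/
abbrev rFound : ℕ := 17
/-- `OPT`, the best objective value found so far. -/
abbrev rBest : ℕ := 18
/-- The objective value of the current schedule. -/
abbrev rVal : ℕ := 19
/-- Auxiliary sum. -/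
abbrev rAux : ℕ := 20

/-- Input: entry `j * n + i` is 1 if `i` is a predecessor of `j`, and 0 otherwise. -/
abbrev aPred : ℕ := 0
/-- Input: entry `j` is 1 if the constraint of `j` is a disjunction, 0 if it is a conjunction. -/
abbrev aKind : ℕ := 1
/-- Entry `j` is `j * n`. -/
abbrev aOff : ℕ := 2
/-- Entry `j` is 1 if `j` is a successor. -/
abbrev aIsSucc : ℕ := 3
/-- Entry `ℓ` is the `ℓ`-th successor. -/
abbrev aSucc : ℕ := 4
/-- The tuple of unshifted completion times of the successors. -/
abbrev aTau : ℕ := 5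
/-- Entry `ℓ * n + ℓ'` is 1 if the `ℓ'`-th successor lies in the set of the `ℓ`-th successor. -/
abbrev aSel : ℕ := 6
/-- The completion times of the current schedule; 0 if not yet chosen. -/
abbrev aC : ℕ := 7
/-- Entry `t` is the number of jobs in time slot `t`. -/
abbrev aCnt : ℕ := 8
/-- The indices of the successors in order of non-decreasing completion time. -/
abbrev aOrd : ℕ := 9
/-- Entry `ℓ` is the representative of the `ℓ`-th successor; `n` if not yet chosen. -/
abbrev aRep : ℕ := 10
/-- Output: the completion times of the best schedule found. -/
abbrev aOut : ℕ := 11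

/-! ### The algorithm -/

section Program

open Cmd

/-- `i` is a predecessor of `j`. -/
def isPred (i j : Exp) : Test := .eq (.get aPred (.add (.get aOff j) i)) (.lit 1)

/-- The constraint of `j` is a disjunction. -/
def isOrJob (j : Exp) : Test := .eq (.get aKind j) (.lit 1)

/-- The job that is the successor with the index in register `x`. -/
def succOf (x : ℕ) : Exp := .get aSucc (.reg x)

/-- Compute the row offsets and list the successors. -/
def preprocess : Cmd := block [
  set rAux (.lit 0),
  forLt rJ (.reg rN) (block [
    store aOff (.reg rJ) (.reg rAux),
    set rAux (.add (.reg rAux) (.reg rN))]),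
  set rK (.lit 0),
  forLt rJ (.reg rN) (block [
    store aIsSucc (.reg rJ) (.get aKind (.reg rJ)),
    forLt rI (.reg rN) (when (isPred (.reg rI) (.reg rJ)) (store aIsSucc (.reg rJ) (.lit 1))),
    when (.eq (.get aIsSucc (.reg rJ)) (.lit 1)) (block [
      store aSucc (.reg rK) (.reg rJ),
      set rK (.add (.reg rK) (.lit 1))])])]

/-- Give the successors the completion times of the shifted tuple; discard the choice if a time slot
receives more than `m` successors. -/
def placeSuccessors : Cmd := block [
  set rOk (.lit 1),
  forLt rI (.reg rN) (store aC (.reg rI) (.lit 0)),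
  forLt rT (.add (.reg rN) (.lit 1)) (store aCnt (.reg rT) (.lit 0)),
  forLt rL (.reg rK) (block [
    set rT (.add (.get aTau (.reg rL)) (.reg rShift)),
    store aC (succOf rL) (.reg rT),
    incArr aCnt (.reg rT),
    when (.lt (.reg rM) (.get aCnt (.reg rT))) (set rOk (.lit 0))])]

/-- Sort the successors by completion time. -/
def sortSuccessors : Cmd := block [
  set rP (.lit 0),
  forLt rT (.reg rK) (forLt rL (.reg rK) (
    when (.eq (.get aTau (.reg rL)) (.add (.reg rT) (.lit 1))) (block [
      store aOrd (.reg rP) (.reg rL),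
      set rP (.add (.reg rP) (.lit 1))])))]

/-- An or-job that has a predecessor among the successors with a smaller completion time gets such
a predecessor as its representative. -/
def successorRepresentatives : Cmd :=
  forLt rL (.reg rK) (block [
    store aRep (.reg rL) (.reg rN),
    when (isOrJob (succOf rL)) (
      forLt rI (.reg rN) (
        when (.and (.eq (.get aIsSucc (.reg rI)) (.lit 1))
            (.and (isPred (.reg rI) (succOf rL))
              (.lt (.get aC (.reg rI)) (.get aC (succOf rL)))))
          (store aRep (.reg rL) (.reg rI))))])

/-- Let `j` be the successor at position `rP`, and `S` its set. Search for a job `i` that is not a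
successor, is a predecessor of all jobs in `S`, and is a predecessor of no job outside `S` that is
an and-job or an or-job at position at least `rP`. Register `rRep` becomes `n` if there is none. -/
def searchRepresentative : Cmd := block [
  set rRep (.reg rN),
  forLt rI (.reg rN) (when (.eq (.get aIsSucc (.reg rI)) (.lit 0)) (block [
    set rMatch (.lit 1),
    forLt rP' (.reg rK) (block [
      set rL' (.get aOrd (.reg rP')),
      ite (.eq (.get aSel (.add (.get aOff (.reg rL)) (.reg rL'))) (.lit 1))
        (when (.not (isPred (.reg rI) (succOf rL'))) (set rMatch (.lit 0)))
        (when (.and (isPred (.reg rI) (succOf rL'))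
            (.or (.not (isOrJob (succOf rL'))) (.not (.lt (.reg rP') (.reg rP)))))
          (set rMatch (.lit 0)))]),
    when (.eq (.reg rMatch) (.lit 1)) (set rRep (.reg rI))]))]

/-- Choose the representatives of the remaining or-jobs, in order of non-decreasing completion
time and according to the current family of sets. A representative serves all later or-jobs without
representative of which it is a predecessor. Discard the choice if a representative is missing. -/
def chooseRepresentatives : Cmd :=
  forLt rP (.reg rK) (block [
    set rL (.get aOrd (.reg rP)),
    when (.and (isOrJob (succOf rL)) (.eq (.get aRep (.reg rL)) (.reg rN))) (block [
      searchRepresentative,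
      ite (.eq (.reg rRep) (.reg rN))
        (set rOk (.lit 0))
        (forLt rP' (.reg rK) (block [
          set rL' (.get aOrd (.reg rP')),
          when (.and (.not (.lt (.reg rP') (.reg rP)))
              (.and (isOrJob (succOf rL'))
                (.and (.eq (.get aRep (.reg rL')) (.reg rN)) (isPred (.reg rRep) (succOf rL')))))
            (store aRep (.reg rL') (.reg rRep))]))])])

/-- If job `rI` has no completion time yet, give it the earliest time slot with an idle machine. -/
def placeJob : Cmd :=
  when (.eq (.get aC (.reg rI)) (.lit 0)) (block [
    set rT (.lit 1),
    loop (.not (.lt (.get aCnt (.reg rT)) (.reg rM))) (set rT (.add (.reg rT) (.lit 1))),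
    store aC (.reg rI) (.reg rT),
    incArr aCnt (.reg rT)])

/-- The insertion phase for the and-variation, in which every or-job has its representative as only
predecessor: in order of non-decreasing completion time of the successors, place their predecessors
as early as possible, and discard the choice if one of them does not precede the successor. Then
place all remaining jobs as early as possible. -/
def insertJobs : Cmd := block [
  forLt rP (.reg rK) (block [
    set rL (.get aOrd (.reg rP)),
    forLt rI (.reg rN) (
      when (.or (.and (isOrJob (succOf rL)) (.eq (.get aRep (.reg rL)) (.reg rI)))
          (.and (.not (isOrJob (succOf rL))) (isPred (.reg rI) (succOf rL)))) (block [
        placeJob,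
        when (.not (.lt (.get aC (.reg rI)) (.get aC (succOf rL)))) (set rOk (.lit 0))]))]),
  forLt rI (.reg rN) placeJob]

/-- Compute the objective value of the current schedule. -/
def evaluate : Objective → Cmd
  | .makespan => block [
      set rVal (.lit 0),
      forLt rI (.reg rN) (
        when (.lt (.reg rVal) (.get aC (.reg rI))) (set rVal (.get aC (.reg rI))))]
  | .sumCompletion => block [
      set rVal (.lit 0),
      forLt rI (.reg rN) (set rVal (.add (.reg rVal) (.get aC (.reg rI))))]

/-- Keep the current schedule if it was not discarded and improves on the best one so far. -/
def updateBest : Cmd :=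
  when (.and (.eq (.reg rOk) (.lit 1))
      (.or (.eq (.reg rFound) (.lit 0)) (.lt (.reg rVal) (.reg rBest)))) (block [
    set rFound (.lit 1),
    set rBest (.reg rVal),
    forLt rI (.reg rN) (store aOut (.reg rI) (.get aC (.reg rI)))])

/-- The first family of sets: each set contains just its own job. -/
def firstSel : Cmd := block [
  forLt rL (.reg rK) (forLt rL' (.reg rK) (
    ite (.eq (.reg rL) (.reg rL'))
      (store aSel (.add (.get aOff (.reg rL)) (.reg rL')) (.lit 1))
      (store aSel (.add (.get aOff (.reg rL)) (.reg rL')) (.lit 0)))),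
  set rDoneSel (.lit 0)]

/-- The next family `(S_j)`, `j` an or-job, with `j ∈ S_j` (a binary counter). -/
def nextSel : Cmd := block [
  set rCarry (.lit 1),
  forLt rL (.reg rK) (forLt rL' (.reg rK) (
    when (.and (.eq (.reg rCarry) (.lit 1))
        (.and (isOrJob (succOf rL)) (.not (.eq (.reg rL) (.reg rL')))))
      (ite (.eq (.get aSel (.add (.get aOff (.reg rL)) (.reg rL'))) (.lit 0))
        (block [
          store aSel (.add (.get aOff (.reg rL)) (.reg rL')) (.lit 1),
          set rCarry (.lit 0)])
        (store aSel (.add (.get aOff (.reg rL)) (.reg rL')) (.lit 0))))),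
  set rDoneSel (.reg rCarry)]

/-- The first tuple of unshifted completion times. -/
def firstTau : Cmd := block [
  forLt rL (.reg rK) (store aTau (.reg rL) (.lit 1)),
  set rDoneTau (.lit 0)]

/-- The next tuple in `{1, ..., k}^k` (a counter with digits `1, ..., k`). -/
def nextTau : Cmd := block [
  set rCarry (.lit 1),
  forLt rL (.reg rK) (when (.eq (.reg rCarry) (.lit 1)) (
    ite (.lt (.get aTau (.reg rL)) (.reg rK))
      (block [incArr aTau (.reg rL), set rCarry (.lit 0)])
      (store aTau (.reg rL) (.lit 1)))),
  set rDoneTau (.reg rCarry)]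

/-- Treat one choice of completion times of the successors and of a family of sets. -/
def tryChoice (γ : Objective) : Cmd := block [
  placeSuccessors,
  sortSuccessors,
  successorRepresentatives,
  chooseRepresentatives,
  insertJobs,
  evaluate γ,
  updateBest]

/-- The algorithm and+or-alg-succ: run through all tuples in `{1, ..., k}^k`, all shifts
`0, ..., n - k`, and all families `(S_j)` of sets of successors, `j` an or-job, with `j ∈ S_j`. -/
def andOrAlgSucc (γ : Objective) : Cmd := block [
  preprocess,
  set rFound (.lit 0),
  firstTau,
  loop (.eq (.reg rDoneTau) (.lit 0)) (block [
    forLt rShift (.sub (.add (.reg rN) (.lit 1)) (.reg rK)) (block [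
      firstSel,
      loop (.eq (.reg rDoneSel) (.lit 0)) (block [
        tryChoice γ,
        nextSel])]),
    nextTau])]

end Program

/-! ### Input, output, and fixed-parameter tractability -/

namespace Instance

/-- The initial memory: the numbers `n` and `m`, the predecessor matrix (row by row), and the kinds
of the constraints. All other registers and array entries are 0. -/
def input (I : Instance) : State where
  reg x := if x = rN then I.n else if x = rM then I.m else 0
  arr a p :=
    if a = aPred then
      if ∃ i j : Fin I.n, p = j.val * I.n + i.val ∧ i ∈ (I.ψ j).preds then 1 else 0
    else if a = aKind then
      if ∃ j : Fin I.n, p = j.val ∧ (I.ψ j).isDisj = true then 1 else 0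
    else 0

/-- The length of the input in bits: `n` and `m` in binary, the matrix, and the kinds. -/
def inputLength (I : Instance) : ℕ := Nat.size I.n + Nat.size I.m + I.n * I.n + I.n

/-- The completion times in the output array. -/
def output (I : Instance) (s : State) : Fin I.n → ℕ := fun j => s.arr aOut j.val

end Instance

/-- A parameterized search (or optimization) problem with inputs presented to the machine. -/
structure ParamProblem where
  Inst : Type
  input : Inst → State
  inputLength : Inst → ℕ
  param : Inst → ℕ
  IsSolution : Inst → State → Prop

/-- Fixed-parameter tractability: one program solves every instance `x` within
`f (param x) * |x| ^ d` steps, for a computable `f` and a constant `d`. -/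
def ParamProblem.FPT (P : ParamProblem) : Prop :=
  ∃ (c : Cmd) (f : ℕ → ℕ) (d : ℕ), Computable f ∧
    ∀ x : P.Inst, ∃ (t : ℕ) (s : State),
      Exec c (P.input x) t s ∧ P.IsSolution x s ∧ t ≤ f (P.param x) * P.inputLength x ^ d

/-- Finding an optimal schedule of a feasible instance with at least one job, parameterized by the
number of successors. -/
def schedulingBySuccessors (γ : Objective) : ParamProblem where
  Inst := { I : Instance // 0 < I.n ∧ I.Feasible }
  input I := I.1.input
  inputLength I := I.1.inputLength
  param I := I.1.ks
  IsSolution I s := I.1.OptimalSchedule γ (I.1.output s)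

end AndOrSched

set_option linter.unusedSimpArgs false

namespace AndOrSched

/-! ### Weakest preconditions with running times -/

namespace State

/-! Call a job with trivial constraint free, and let k be the number of successors.

Times of the successors. Among the optimal schedules take one of least total completion time and,
among these, one of least total completion time of the free jobs. No slot before a job is idle,
since deleting the slot would reduce the total. A free job in a slot without successors does not
directly follow a slot that contains a successor, since exchanging the two jobs would move the free
job forward without changing any slot load. Hence the successors fill a contiguous run of at most k
slots, and every earlier slot contains a free job (`Ctx.exists_optimal_window`). So the successor
times of this schedule E occur among the enumerated shifted tuples.

Representatives. For an or-job l without an earlier predecessor among the successors, let f(l) be a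
free predecessor that precedes it in E. The matching family of sets tells the algorithm only which
and-jobs, and which or-jobs not before l, have f(l) as predecessor. A job r found by the search has
exactly the same incidences. Transposing r with the predecessor currently used for l therefore
preserves everything still to be satisfied and moves no successor (`Witness.step`). When all
representatives are chosen, some feasible schedule of the and-variation still has the successor
times of E.

Insertion. With the successors fixed, placing their predecessors in order of the successors is
earliest-deadline-first scheduling of unit jobs; counting jobs in full slots shows that no deadline
is missed (`Ctx.lt_deadline`). The result leaves no machine idle before a free job, so for every t
at most as many jobs finish after t as in E (`Ctx.val_le_of_full`), and both objectives are monotone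
in these counts. Conversely, for every choice whatsoever, a flag that is still 1 at the end
certifies feasibility, so the recorded schedule is feasible and at least as good as E
(`tryChoice_spec`).

Exhaustion and time. Tuples and families are the digits of mixed radix counters. The invariant of
each enumeration is that the value of E has been reached or the counter has not passed the number of
the target choice. There are k^k tuples, at most n+1 shifts and at most 2^(k(k-1)) families, because
membership of a job in its own set is not counted; a choice costs O((k+1)(n+1)^2) steps. Since k+1 ≤
2^k, the product is O(k^k 2^(k^2) n^3), even without the factor m.

The programs are verified in a total-correctness calculus `wp` that carries running times, with a
frame rule derived from the syntactically written registers and arrays. -/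

@[simp] theorem reg_setReg_self (s : State) (x v : ℕ) : (s.setReg x v).reg x = v := by
  simp [setReg]

@[simp] theorem reg_setReg_of_ne (s : State) {x y : ℕ} (v : ℕ) (h : y ≠ x) :
    (s.setReg x v).reg y = s.reg y := by
  simp [setReg, h]

@[simp] theorem arr_setReg (s : State) (x v : ℕ) : (s.setReg x v).arr = s.arr := rfl

@[simp] theorem reg_setArr (s : State) (a i v : ℕ) : (s.setArr a i v).reg = s.reg := rfl

@[simp] theorem arr_setArr_self (s : State) (a i v : ℕ) :
    (s.setArr a i v).arr a = Function.update (s.arr a) i v := by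
  simp [setArr]

@[simp] theorem arr_setArr_of_ne (s : State) {a b : ℕ} (i v : ℕ) (h : b ≠ a) :
    (s.setArr a i v).arr b = s.arr b := by
  simp [setArr, h]

end State

namespace Cmd

/-- Whether the register `r` occurs as the target of an assignment. -/
def writesReg : Cmd → ℕ → Bool
  | skip, _ => false
  | set x _, r => x == r
  | store _ _ _, _ => false
  | seq c₁ c₂, r => c₁.writesReg r || c₂.writesReg r
  | ite _ c₁ c₂, r => c₁.writesReg r || c₂.writesReg r
  | loop _ c, r => c.writesReg r

/-- Whether the array `a` occurs as the target of an assignment. -/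
def writesArr : Cmd → ℕ → Bool
  | skip, _ => false
  | set _ _, _ => false
  | store b _ _, a => b == a
  | seq c₁ c₂, a => c₁.writesArr a || c₂.writesArr a
  | ite _ c₁ c₂, a => c₁.writesArr a || c₂.writesArr a
  | loop _ c, a => c.writesArr a

end Cmd

/-- The states agree on everything that the program does not write to. -/
def Frame (c : Cmd) (s s' : State) : Prop :=
  (∀ r, c.writesReg r = false → s'.reg r = s.reg r) ∧
  ∀ a, c.writesArr a = false → s'.arr a = s.arr a

namespace Frame

theorem reg {c : Cmd} {s s' : State} (h : Frame c s s') (r : ℕ) (hr : c.writesReg r = false) :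
    s'.reg r = s.reg r := h.1 r hr

theorem arr {c : Cmd} {s s' : State} (h : Frame c s s') (a : ℕ) (ha : c.writesArr a = false) :
    s'.arr a = s.arr a := h.2 a ha

theorem refl (c : Cmd) (s : State) : Frame c s s := ⟨fun _ _ => rfl, fun _ _ => rfl⟩

theorem trans {c : Cmd} {s s₁ s₂ : State} (h : Frame c s s₁) (h' : Frame c s₁ s₂) :
    Frame c s s₂ :=
  ⟨fun r hr => (h'.1 r hr).trans (h.1 r hr), fun a ha => (h'.2 a ha).trans (h.2 a ha)⟩

theorem mono {c c' : Cmd} {s s' : State} (h : Frame c s s')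
    (hr : ∀ r, c'.writesReg r = false → c.writesReg r = false)
    (ha : ∀ r, c'.writesArr r = false → c.writesArr r = false) : Frame c' s s' :=
  ⟨fun r hr' => h.1 r (hr r hr'), fun a ha' => h.2 a (ha a ha')⟩

end Frame

/-- The frame is read off the program text by Boolean functions, so in the specifications below the
preservation of a concrete register or array is proved by `rfl`. -/
theorem Exec.frame {c : Cmd} {s s' : State} {t : ℕ} (h : Exec c s t s') : Frame c s s' := by
  induction h with
  | skip s => exact Frame.refl _ _
  | set x e s =>
    refine ⟨fun r hr => ?_, fun a _ => rfl⟩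
    have : r ≠ x := by rintro rfl; simp [Cmd.writesReg] at hr
    simp [this]
  | store a i e s =>
    refine ⟨fun r hr => rfl, fun b hb => ?_⟩
    have : b ≠ a := by rintro rfl; simp [Cmd.writesArr] at hb
    simp [this]
  | seq _ _ h₁ h₂ =>
    refine (h₁.mono ?_ ?_).trans (h₂.mono ?_ ?_) <;> simp +contextual [Cmd.writesReg, Cmd.writesArr]
  | iteTrue _ _ h₁ => refine h₁.mono ?_ ?_ <;> simp +contextual [Cmd.writesReg, Cmd.writesArr]
  | iteFalse _ _ h₁ => refine h₁.mono ?_ ?_ <;> simp +contextual [Cmd.writesReg, Cmd.writesArr]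
  | loopTrue _ _ _ h₁ h₂ =>
    refine (h₁.mono ?_ ?_).trans h₂ <;> simp +contextual [Cmd.writesReg, Cmd.writesArr]
  | loopFalse _ => exact Frame.refl _ _

/-- Started in `s`, the program halts, and its running time and final state satisfy `Q`. -/
def wp (c : Cmd) (s : State) (Q : ℕ → State → Prop) : Prop :=
  ∃ t s', Exec c s t s' ∧ Q t s'

/-- The rule of consequence, together with the frame rule. -/
theorem wp.conseq {c : Cmd} {s : State} {Q Q' : ℕ → State → Prop} (h : wp c s Q)
    (hQ : ∀ t s', Frame c s s' → Q t s' → Q' t s') : wp c s Q' := by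
  obtain ⟨t, s', he, hq⟩ := h
  exact ⟨t, s', he, hQ t s' he.frame hq⟩

-- Every construct other than the loop has a determined effect and cost, so its rule is an
-- equivalence; `simp` can thus execute straight-line code symbolically.
@[simp] theorem wp_skip (s : State) (Q : ℕ → State → Prop) : wp .skip s Q ↔ Q 1 s := by
  constructor
  · rintro ⟨t, s', he, hq⟩
    cases he
    exact hq
  · exact fun h => ⟨1, s, .skip s, h⟩

@[simp] theorem wp_set (x : ℕ) (e : Exp) (s : State) (Q : ℕ → State → Prop) :
    wp (.set x e) s Q ↔ Q (e.cost + 1) (s.setReg x (e.eval s)) := by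
  constructor
  · rintro ⟨t, s', he, hq⟩
    cases he
    exact hq
  · exact fun h => ⟨_, _, .set x e s, h⟩

@[simp] theorem wp_store (a : ℕ) (i e : Exp) (s : State) (Q : ℕ → State → Prop) :
    wp (.store a i e) s Q ↔ Q (i.cost + e.cost + 1) (s.setArr a (i.eval s) (e.eval s)) := by
  constructor
  · rintro ⟨t, s', he, hq⟩
    cases he
    exact hq
  · exact fun h => ⟨_, _, .store a i e s, h⟩

@[simp] theorem wp_seq (c₁ c₂ : Cmd) (s : State) (Q : ℕ → State → Prop) :
    wp (.seq c₁ c₂) s Q ↔ wp c₁ s fun t₁ s₁ => wp c₂ s₁ fun t₂ s₂ => Q (t₁ + t₂) s₂ := by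
  constructor
  · rintro ⟨t, s', he, hq⟩
    cases he with
    | seq h₁ h₂ => exact ⟨_, _, h₁, _, _, h₂, hq⟩
  · rintro ⟨t₁, s₁, h₁, t₂, s₂, h₂, hq⟩
    exact ⟨_, _, .seq h₁ h₂, hq⟩

@[simp] theorem wp_ite (b : Test) (c₁ c₂ : Cmd) (s : State) (Q : ℕ → State → Prop) :
    wp (.ite b c₁ c₂) s Q ↔
      (b.Holds s → wp c₁ s fun t s' => Q (b.cost + 1 + t) s') ∧
      (¬ b.Holds s → wp c₂ s fun t s' => Q (b.cost + 1 + t) s') := by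
  constructor
  · rintro ⟨t, s', he, hq⟩
    cases he with
    | iteTrue hb h => exact ⟨fun _ => ⟨_, _, h, hq⟩, fun h' => absurd hb h'⟩
    | iteFalse hb h => exact ⟨fun h' => absurd h' hb, fun _ => ⟨_, _, h, hq⟩⟩
  · rintro ⟨h₁, h₂⟩
    by_cases hb : b.Holds s
    · obtain ⟨t, s', he, hq⟩ := h₁ hb
      exact ⟨_, _, .iteTrue hb he, hq⟩
    · obtain ⟨t, s', he, hq⟩ := h₂ hb
      exact ⟨_, _, .iteFalse hb he, hq⟩

@[simp] theorem wp_when (b : Test) (c : Cmd) (s : State) (Q : ℕ → State → Prop) :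
    wp (.when b c) s Q ↔
      (b.Holds s → wp c s fun t s' => Q (b.cost + 1 + t) s') ∧
      (¬ b.Holds s → Q (b.cost + 1 + 1) s) := by
  simp [Cmd.when]

@[simp] theorem wp_block_nil (s : State) (Q : ℕ → State → Prop) :
    wp (.block []) s Q ↔ Q 1 s := by
  simp [Cmd.block]

@[simp] theorem wp_block_cons (c : Cmd) (cs : List Cmd) (s : State) (Q : ℕ → State → Prop) :
    wp (.block (c :: cs)) s Q ↔
      wp c s fun t₁ s₁ => wp (.block cs) s₁ fun t₂ s₂ => Q (t₁ + t₂) s₂ := by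
  simp [Cmd.block]

@[simp] theorem wp_incArr (a : ℕ) (i : Exp) (s : State) (Q : ℕ → State → Prop) :
    wp (.incArr a i) s Q ↔
      Q (2 * i.cost + 4) (s.setArr a (i.eval s) (s.arr a (i.eval s) + 1)) := by
  have : i.cost + (i.cost + 1 + 1 + 1) + 1 = 2 * i.cost + 4 := by ring
  simp [Cmd.incArr, Exp.cost, Exp.eval, this]

/-- Total correctness of a loop with a variant `μ`. -/
theorem wp_loop {b : Test} {c : Cmd} {s : State} {Q : ℕ → State → Prop}
    (μ : State → ℕ) (B : ℕ) (Inv : State → Prop) (h0 : Inv s)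
    (hstep : ∀ s', Frame c s s' → Inv s' → b.Holds s' →
      wp c s' fun t s'' => t ≤ B ∧ Inv s'' ∧ μ s'' < μ s')
    (hQ : ∀ t s', t ≤ μ s * (B + b.cost + 1) + b.cost + 1 → Frame c s s' → Inv s' →
      ¬ b.Holds s' → Q t s') :
    wp (.loop b c) s Q := by
  -- The variant bounds the number of iterations; strong induction on it pays for one body, one test
  -- and one branch per unit of decrease.
  suffices H : ∀ N s₁, μ s₁ = N → Frame c s s₁ → Inv s₁ →
      wp (.loop b c) s₁ fun t s' =>
        t ≤ μ s₁ * (B + b.cost + 1) + b.cost + 1 ∧ Frame c s s' ∧ Inv s' ∧ ¬ b.Holds s' by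
    exact (H _ s rfl (Frame.refl _ _) h0).conseq
      fun t s' _ h => hQ t s' h.1 h.2.1 h.2.2.1 h.2.2.2
  intro N
  induction N using Nat.strong_induction_on with
  | _ N ih =>
    intro s₁ hN hF hI
    by_cases hb : b.Holds s₁
    · obtain ⟨t₁, s₂, he₁, ht₁, hI₂, hμ⟩ := hstep s₁ hF hI hb
      obtain ⟨t₂, s₃, he₂, ht₂, h₃⟩ := ih (μ s₂) (hN ▸ hμ) s₂ rfl (hF.trans he₁.frame) hI₂
      refine ⟨_, _, .loopTrue hb he₁ he₂, ?_, h₃⟩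
      have : (μ s₂ + 1) * (B + b.cost + 1) ≤ μ s₁ * (B + b.cost + 1) := Nat.mul_le_mul_right _ hμ
      rw [Nat.add_mul] at this
      omega
    · exact ⟨_, _, .loopFalse hb, by omega, hF, hI, hb⟩

/-- Total correctness of a counting loop. -/
theorem wp_forLt {x : ℕ} {e : Exp} {c : Cmd} {s : State} {Q : ℕ → State → Prop}
    (N B : ℕ) (Inv : ℕ → State → Prop) (hx : c.writesReg x = false)
    (he : ∀ s', Frame (.forLt x e c) s s' → e.eval s' = N)
    (h0 : Inv 0 (s.setReg x 0))
    (hstep : ∀ i s', i < N → Frame (.forLt x e c) s s' → s'.reg x = i → Inv i s' →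
      wp c s' fun t s'' => t ≤ B ∧ Inv (i + 1) (s''.setReg x (i + 1)))
    (hQ : ∀ t s', t ≤ N * (B + e.cost + 7) + e.cost + 5 → Frame (.forLt x e c) s s' →
      s'.reg x = N → Inv N s' → Q t s') :
    wp (.forLt x e c) s Q := by
  -- Frames are measured from the state before the initialization of the counter, so that the
  -- caller's facts about `s` apply directly inside the loop.
  have hF : ∀ s', Frame (.seq c (.set x (.add (.reg x) (.lit 1)))) (s.setReg x 0) s' →
      Frame (.forLt x e c) s s' := by
    intro s' h
    have h1 : Frame (.forLt x e c) s (s.setReg x 0) :=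
      (Exec.set x (.lit 0) s).frame.mono (by simp +contextual [Cmd.forLt, Cmd.writesReg])
        (by simp +contextual [Cmd.writesArr])
    exact h1.trans (h.mono (by simp +contextual [Cmd.forLt, Cmd.writesReg])
        (by simp +contextual [Cmd.forLt, Cmd.writesArr]))
  rw [Cmd.forLt, wp_seq, wp_set]
  -- The increment of the counter costs 4 steps.
  refine wp_loop (fun s' => N - s'.reg x) (B + 4)
    (fun s' => s'.reg x ≤ N ∧ Inv (s'.reg x) s') ?_ ?_ ?_
  · simpa [Exp.eval] using h0
  · rintro s' hf ⟨hle, hI⟩ hb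
    have hN := he s' (hF s' hf)
    have hlt : s'.reg x < N := by simpa [Test.Holds, Exp.eval, hN] using hb
    rw [wp_seq]
    refine (hstep _ s' hlt (hF s' hf) rfl hI).conseq ?_
    rintro t s'' hf' ⟨ht, hI'⟩
    have hreg : s''.reg x = s'.reg x := hf'.reg x hx
    simp only [wp_set, Exp.eval, Exp.cost, hreg, State.reg_setReg_self]
    exact ⟨by omega, ⟨hlt, hI'⟩, by omega⟩
  · rintro t s' ht hf ⟨hle, hI⟩ hb
    have hN := he s' (hF s' hf)
    have hge : s'.reg x = N := by
      have : ¬ s'.reg x < N := by simpa [Test.Holds, Exp.eval, hN] using hb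
      omega
    refine hQ _ s' ?_ (hF s' hf) hge (hge ▸ hI)
    simp only [Exp.eval, State.reg_setReg_self, Test.cost, Exp.cost] at ht ⊢
    have e1 : (B + 4 + (1 + e.cost + 1) + 1) = B + e.cost + 7 := by ring
    rw [e1] at ht
    simp only [Nat.sub_zero] at ht
    omega

end AndOrSched

namespace AndOrSched

open Finset
section

open scoped Classical

/-! ### Schedules of jobs that are natural numbers -/

/-- An instance whose jobs are the natural numbers below `n`. -/
structure Ctx where
  n : ℕ
  m : ℕ
  pred : ℕ → ℕ → Prop
  isOr : ℕ → Prop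

namespace Ctx

variable (X : Ctx)

/-- `j` has a non-trivial constraint. -/
def isS (j : ℕ) : Prop := j < X.n ∧ (X.isOr j ∨ ∃ i < X.n, X.pred i j)

/-- The number of successors. -/
noncomputable def k : ℕ := by
  classical exact Nat.count X.isS X.n

/-- The `l`-th successor. -/
noncomputable def su (l : ℕ) : ℕ := Nat.nth X.isS l

theorem k_le : X.k ≤ X.n := Nat.count_le _

theorem isS_lt {X : Ctx} {j : ℕ} (h : X.isS j) : j < X.n := h.1

theorem finite_isS : (Set.ofPred X.isS).Finite :=
  (Set.finite_Iio X.n).subset fun _ h => isS_lt h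

theorem exists_su {X : Ctx} {j : ℕ} (h : X.isS j) : ∃ l < X.k, X.su l = j := by
  classical
  exact ⟨Nat.count X.isS j, by
    unfold k
    exact Nat.count_strict_mono h h.1, Nat.nth_count h⟩

theorem k_eq_card : X.k = ((range X.n).filter X.isS).card := by
  unfold k
  exact Nat.count_eq_card_filter_range _ _

theorem k_eq : X.k = X.finite_isS.toFinset.card := by
  rw [k_eq_card]
  congr 1
  ext j
  simp only [mem_filter, mem_range, Set.Finite.mem_toFinset]
  exact ⟨fun h => h.2, fun h => ⟨isS_lt h, h⟩⟩

theorem isS_su {X : Ctx} {l : ℕ} (h : l < X.k) : X.isS (X.su l) :=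
  Nat.nth_mem l fun hf => by rw [k_eq] at h; exact h

theorem su_lt {X : Ctx} {l : ℕ} (h : l < X.k) : X.su l < X.n := (isS_su h).1

theorem su_inj {X : Ctx} {l l' : ℕ} (h : l < X.k) (h' : l' < X.k) (e : X.su l = X.su l') :
    l = l' := by
  rw [k_eq] at h h'
  exact Nat.nth_injOn X.finite_isS (Set.mem_Iio.2 h) (Set.mem_Iio.2 h') e

/-- The number of jobs with completion time `t`. -/
def load (C : ℕ → ℕ) (t : ℕ) : ℕ := ((range X.n).filter fun i => C i = t).card

/-- The number of jobs with completion time greater than `t`. -/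
def tail (C : ℕ → ℕ) (t : ℕ) : ℕ := ((range X.n).filter fun i => t < C i).card

/-- `C` is a feasible schedule. -/
structure Feas (C : ℕ → ℕ) : Prop where
  pos : ∀ i < X.n, 1 ≤ C i
  load_le : ∀ t, X.load C t ≤ X.m
  and_lt : ∀ j < X.n, ¬ X.isOr j → ∀ i < X.n, X.pred i j → C i < C j
  or_lt : ∀ j < X.n, X.isOr j → ∃ i < X.n, X.pred i j ∧ C i < C j

/-- The objective value. -/
def val (γ : Objective) (C : ℕ → ℕ) : ℕ :=
  match γ with
  | .makespan => (range X.n).sup C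
  | .sumCompletion => ∑ i ∈ range X.n, C i

variable {X}

theorem load_congr {C C' : ℕ → ℕ} (h : ∀ i < X.n, C i = C' i) (t : ℕ) :
    X.load C t = X.load C' t := by
  unfold load
  congr 1
  apply filter_congr
  intro i hi
  rw [h i (mem_range.1 hi)]

theorem Feas.congr {C C' : ℕ → ℕ} (hC : X.Feas C) (h : ∀ i < X.n, C i = C' i) : X.Feas C' where
  pos i hi := h i hi ▸ hC.pos i hi
  load_le t := load_congr h t ▸ hC.load_le t
  and_lt j hj ho i hi hp := by rw [← h i hi, ← h j hj]; exact hC.and_lt j hj ho i hi hp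
  or_lt j hj ho := by
    obtain ⟨i, hi, hp, hlt⟩ := hC.or_lt j hj ho
    exact ⟨i, hi, hp, by rw [← h i hi, ← h j hj]; exact hlt⟩

theorem val_congr (γ : Objective) {C C' : ℕ → ℕ} (h : ∀ i < X.n, C i = C' i) :
    X.val γ C = X.val γ C' := by
  cases γ
  · exact Finset.sup_congr rfl fun i hi => h i (mem_range.1 hi)
  · exact Finset.sum_congr rfl fun i hi => h i (mem_range.1 hi)

/-- Double counting: job `i` contributes one to the tail at each of the `C i` values `t < C i`. -/
theorem sum_eq_sum_tail (C : ℕ → ℕ) {N : ℕ} (hN : ∀ i < X.n, C i ≤ N) :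
    ∑ i ∈ range X.n, C i = ∑ t ∈ range N, X.tail C t := by
  unfold tail
  simp only [card_filter]
  rw [sum_comm]
  refine sum_congr rfl fun i hi => ?_
  rw [← card_filter]
  have : (range N).filter (fun t => t < C i) = range (C i) := by
    ext t
    have := hN i (mem_range.1 hi)
    simp only [mem_filter, mem_range]
    omega
  rw [this, card_range]

/-- Both objectives are monotone in the tail counts: the makespan is the first `t` with empty tail,
and the sum of completion times is the sum of the tails. This allows both to be treated at once from
here on. -/
theorem val_le_of_tail_le (γ : Objective) {C E : ℕ → ℕ} (h : ∀ t, X.tail C t ≤ X.tail E t) :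
    X.val γ C ≤ X.val γ E := by
  cases γ
  · refine Finset.sup_le fun i hi => ?_
    by_contra! hlt
    have h1 : 0 < X.tail C ((range X.n).sup E) :=
      card_pos.2 ⟨i, mem_filter.2 ⟨hi, hlt⟩⟩
    obtain ⟨j, hj⟩ := card_pos.1 (h1.trans_le (h _))
    rw [mem_filter] at hj
    exact absurd (Finset.le_sup (f := E) hj.1) (not_le.2 hj.2)
  · let N := (range X.n).sup C + (range X.n).sup E
    have h1 : ∀ i < X.n, C i ≤ N := fun i hi =>
      (Finset.le_sup (f := C) (mem_range.2 hi)).trans (Nat.le_add_right _ _)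
    have h2 : ∀ i < X.n, E i ≤ N := fun i hi =>
      (Finset.le_sup (f := E) (mem_range.2 hi)).trans (Nat.le_add_left _ _)
    simp only [val]
    rw [sum_eq_sum_tail C h1, sum_eq_sum_tail E h2]
    exact sum_le_sum fun t _ => h t

theorem tail_mono {C E : ℕ → ℕ} (h : ∀ i < X.n, C i ≤ E i) (t : ℕ) :
    X.tail C t ≤ X.tail E t := by
  refine card_le_card fun i hi => ?_
  rw [mem_filter] at hi ⊢
  exact ⟨hi.1, hi.2.trans_le (h i (mem_range.1 hi.1))⟩

/-- A transposition permutes the jobs, so any count that depends only on completion times is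
unchanged. The exchange arguments get their loads and objective values from this. -/
theorem card_swap {x y : ℕ} (hx : x < X.n) (hy : y < X.n) (C : ℕ → ℕ) (p : ℕ → Prop)
    [DecidablePred p] :
    ((range X.n).filter fun i => p (C (Equiv.swap x y i))).card =
      ((range X.n).filter fun i => p (C i)).card := by
  have hr : ∀ i < X.n, Equiv.swap x y i < X.n := by
    intro i hi
    rw [Equiv.swap_apply_def]
    split_ifs <;> assumption
  refine card_bij' (fun i _ => Equiv.swap x y i) (fun i _ => Equiv.swap x y i) ?_ ?_ ?_ ?_
  · intro i hi
    rw [mem_filter, mem_range] at hi ⊢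
    exact ⟨hr i hi.1, hi.2⟩
  · intro i hi
    rw [mem_filter, mem_range] at hi ⊢
    exact ⟨hr i hi.1, by simpa using hi.2⟩
  · simp
  · simp

theorem load_swap {x y : ℕ} (hx : x < X.n) (hy : y < X.n) (C : ℕ → ℕ) (t : ℕ) :
    X.load (fun i => C (Equiv.swap x y i)) t = X.load C t :=
  card_swap hx hy C (· = t)

theorem tail_swap {x y : ℕ} (hx : x < X.n) (hy : y < X.n) (C : ℕ → ℕ) (t : ℕ) :
    X.tail (fun i => C (Equiv.swap x y i)) t = X.tail C t :=
  card_swap hx hy C (t < ·)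

/-- Placing an unplaced job increases the load of its slot by one. -/
theorem load_update {C : ℕ → ℕ} {x T t : ℕ} (hx : x < X.n) (h0 : C x = 0) (ht : 1 ≤ t) :
    X.load (Function.update C x T) t = X.load C t + if t = T then 1 else 0 := by
  unfold load
  split_ifs with h
  · subst h
    have : (range X.n).filter (fun i => Function.update C x t i = t) =
        insert x ((range X.n).filter fun i => C i = t) := by
      ext i
      rw [mem_filter, mem_insert, mem_filter, mem_range]
      by_cases hi : i = x
      · subst hi; simp [hx]
      · simp [hi]
    rw [this, card_insert_of_notMem]
    simp only [mem_filter, not_and]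
    omega
  · rw [Nat.add_zero]
    congr 1
    apply filter_congr
    intro i _
    by_cases hi : i = x
    · subst hi
      simp only [Function.update_self]
      omega
    · simp [hi]

theorem load_le_load_update {C : ℕ → ℕ} {x T t : ℕ} (hx : x < X.n) (h0 : C x = 0) (ht : 1 ≤ t) :
    X.load C t ≤ X.load (Function.update C x T) t := by
  rw [load_update hx h0 ht]
  omega

/-- As long as a job is unplaced, one of the slots `1, ..., n` has an idle machine. -/
theorem exists_idle {C : ℕ → ℕ} {x : ℕ} (hx : x < X.n) (h0 : C x = 0) (hm : 1 ≤ X.m) :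
    ∃ T, 1 ≤ T ∧ T ≤ X.n ∧ X.load C T < X.m := by
  by_contra! h
  -- Pigeonhole: if the slots `1, ..., n` were all full, each would contain a job (as `m ≥ 1`) other
  -- than `x`, but only `n - 1` such jobs exist. No upper bound on the loads is needed, so this also
  -- covers choices already discarded.
  have hsub : Icc 1 X.n ⊆ ((range X.n).erase x).image C := by
    intro T hT
    rw [mem_Icc] at hT
    have h1 : 0 < X.load C T := by have := h T hT.1 hT.2; omega
    obtain ⟨i, hi⟩ := card_pos.1 h1
    rw [mem_filter] at hi
    refine mem_image.2 ⟨i, mem_erase.2 ⟨?_, hi.1⟩, hi.2⟩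
    rintro rfl
    omega
  have h2 := (card_le_card hsub).trans card_image_le
  rw [card_erase_of_mem (mem_range.2 hx), Nat.card_Icc, card_range] at h2
  omega

/-- The number of jobs in the slots `1, ..., t`. -/
theorem card_le_eq_sum_load (C : ℕ → ℕ) (t : ℕ) :
    ((range X.n).filter fun i => 1 ≤ C i ∧ C i ≤ t).card = ∑ u ∈ Icc 1 t, X.load C u := by
  have h : ∀ i ∈ (range X.n).filter (fun i => 1 ≤ C i ∧ C i ≤ t), C i ∈ Icc 1 t := by
    intro i hi
    rw [mem_filter] at hi
    exact mem_Icc.2 hi.2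
  rw [card_eq_sum_card_fiberwise h]
  refine sum_congr rfl fun u hu => ?_
  unfold load
  rw [filter_filter]
  congr 1
  apply filter_congr
  intro i _
  rw [mem_Icc] at hu
  constructor
  · exact fun h => h.2
  · intro h; omega

/-- The correctness of placing the jobs in order of their deadlines: if all slots before `T` are
full with jobs that precede the deadline `d` in some feasible schedule `D`, then the next job
with deadline `d` is placed before `d`. -/
theorem lt_deadline {C D : ℕ → ℕ} {i d T : ℕ} (hi : i < X.n) (h0 : C i = 0)
    (hDpos : ∀ x < X.n, 1 ≤ D x) (hDload : ∀ t, X.load D t ≤ X.m) (hid : D i < d)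
    (hD : ∀ x < X.n, C x ≠ 0 → C x < d → D x < d)
    (hfull : ∀ u, 1 ≤ u → u < T → X.m ≤ X.load C u) : T < d := by
  by_contra! hT
  -- Were `T ≥ d`, the slots before `d` would all be full in `C`, so `D` could not have more jobs
  -- there.
  have h1 : ∑ u ∈ Icc 1 (d - 1), X.load D u ≤ ∑ u ∈ Icc 1 (d - 1), X.load C u := by
    refine sum_le_sum fun u hu => ?_
    rw [mem_Icc] at hu
    exact (hDload u).trans (hfull u hu.1 (by omega))
  rw [← card_le_eq_sum_load, ← card_le_eq_sum_load] at h1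
  -- But `D` does have more: all jobs that `C` has before `d`, and in addition the unplaced job `i`.
  have h2 : (range X.n).filter (fun i => 1 ≤ C i ∧ C i ≤ d - 1) ⊂
      (range X.n).filter (fun i => 1 ≤ D i ∧ D i ≤ d - 1) := by
    refine (ssubset_iff_of_subset ?_).2 ⟨i, ?_, ?_⟩
    · intro x hx
      rw [mem_filter, mem_range] at hx ⊢
      have := hD x hx.1 (by omega) (by omega)
      exact ⟨hx.1, hDpos x hx.1, by omega⟩
    · rw [mem_filter, mem_range]
      exact ⟨hi, hDpos i hi, by omega⟩
    · simp [h0]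
  exact absurd (card_lt_card h2) (not_lt.2 h1)

/-- Among the schedules with given completion times of the successors, those that leave no machine
idle before another job are best. -/
theorem val_le_of_full (γ : Objective) {C E : ℕ → ℕ} (hC : ∀ x < X.n, 1 ≤ C x)
    (hE : ∀ x < X.n, 1 ≤ E x)
    (hEload : ∀ t, X.load E t ≤ X.m) (hCE : ∀ x, X.isS x → C x = E x)
    (hfull : ∀ x < X.n, ¬ X.isS x → ∀ u, 1 ≤ u → u < C x → X.m ≤ X.load C u) :
    X.val γ C ≤ X.val γ E := by
  refine val_le_of_tail_le γ fun t => ?_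
  -- If a free job finishes after `t`, the slots up to `t` are full in `C` and hold at least as many
  -- jobs as in `E`; the tail is the complement. Otherwise only successors finish after `t`, at the
  -- same times in `E`.
  by_cases h : ∃ x < X.n, ¬ X.isS x ∧ t < C x
  · obtain ⟨x, hx, hs, ht⟩ := h
    have h1 : ∑ u ∈ Icc 1 t, X.load E u ≤ ∑ u ∈ Icc 1 t, X.load C u := by
      refine sum_le_sum fun u hu => ?_
      rw [mem_Icc] at hu
      exact (hEload u).trans (hfull x hx hs u hu.1 (by omega))
    rw [← card_le_eq_sum_load, ← card_le_eq_sum_load] at h1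
    have key : ∀ F : ℕ → ℕ, (∀ x < X.n, 1 ≤ F x) →
        ((range X.n).filter fun i => 1 ≤ F i ∧ F i ≤ t).card + X.tail F t = X.n := by
      intro F hF
      have e : (range X.n).filter (fun i => 1 ≤ F i ∧ F i ≤ t) =
          (range X.n).filter (fun i => ¬ t < F i) := by
        apply filter_congr
        intro i hi
        have := hF i (mem_range.1 hi)
        omega
      have := card_filter_add_card_filter_not (s := range X.n) (fun i => t < F i)
      rw [card_range] at this
      rw [e, tail]
      omega
    have := key C hC
    have := key E hE
    omega
  · push Not at h
    refine card_le_card fun i hi => ?_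
    rw [mem_filter, mem_range] at hi ⊢
    refine ⟨hi.1, ?_⟩
    by_cases hs : X.isS i
    · rw [← hCE i hs]; exact hi.2
    · exact absurd hi.2 (not_lt.2 (h i hi.1 hs))

end Ctx
end
end AndOrSched

namespace AndOrSched

open Finset
section

open scoped Classical
namespace Ctx

variable {X : Ctx}

/-! ### Optimal schedules in which the successors occupy consecutive slots -/

/-- The sum of the completion times of the jobs with trivial constraint. -/
noncomputable def freeSum (X : Ctx) (C : ℕ → ℕ) : ℕ :=
  ∑ i ∈ (range X.n).filter (fun i => ¬ X.isS i), C i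

theorem exists_minimizer {α : Type*} {p : α → Prop} (h : ∃ a, p a) (f : α → ℕ) :
    ∃ a, p a ∧ ∀ b, p b → f a ≤ f b := by
  obtain ⟨a, ha, hmin⟩ := WellFounded.has_min (measure f).wf {a | p a} h
  exact ⟨a, ha, fun b hb => not_lt.1 (hmin b hb)⟩

/-- An optimal schedule of minimum sum of completion times and, subject to this, of minimum sum of
the completion times of the jobs with trivial constraint. -/
theorem exists_lex_optimal (γ : Objective) (h : ∃ C, X.Feas C) :
    ∃ C, X.Feas C ∧ (∀ C', X.Feas C' → X.val γ C ≤ X.val γ C') ∧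
      (∀ C', X.Feas C' → X.val γ C' ≤ X.val γ C →
        X.val .sumCompletion C ≤ X.val .sumCompletion C') ∧
      (∀ C', X.Feas C' → X.val γ C' ≤ X.val γ C →
        X.val .sumCompletion C' ≤ X.val .sumCompletion C → X.freeSum C ≤ X.freeSum C') := by
  -- Each minimization runs over the schedules that are no worse than the previous minimizer in all
  -- earlier criteria.
  obtain ⟨C₁, h₁, hm₁⟩ := exists_minimizer h (X.val γ)
  obtain ⟨C₂, h₂, hm₂⟩ := exists_minimizer (p := fun C => X.Feas C ∧ X.val γ C ≤ X.val γ C₁)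
    ⟨C₁, h₁, le_rfl⟩ (X.val .sumCompletion)
  obtain ⟨C₃, h₃, hm₃⟩ := exists_minimizer
    (p := fun C => X.Feas C ∧ X.val γ C ≤ X.val γ C₁ ∧
      X.val .sumCompletion C ≤ X.val .sumCompletion C₂)
    ⟨C₂, h₂.1, h₂.2, le_rfl⟩ X.freeSum
  refine ⟨C₃, h₃.1, fun C' hC' => h₃.2.1.trans (hm₁ C' hC'), fun C' hC' hle => ?_,
    fun C' hC' hle hle' => ?_⟩
  · exact h₃.2.2.trans (hm₂ C' ⟨hC', hle.trans h₃.2.1⟩)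
  · exact hm₃ C' ⟨hC', hle.trans h₃.2.1, hle'.trans h₃.2.2⟩

/-- Removing an idle slot. -/
theorem Feas.removeSlot {C : ℕ → ℕ} (hC : X.Feas C) {t : ℕ} (ht : 1 ≤ t)
    (hidle : ∀ i < X.n, C i ≠ t) : X.Feas fun i => if t < C i then C i - 1 else C i where
  pos i hi := by
    have := hC.pos i hi
    split_ifs <;> omega
  load_le u := by
    by_cases hu : u < t
    · refine le_trans (le_of_eq ?_) (hC.load_le u)
      unfold load
      congr 1
      apply filter_congr
      intro i _
      dsimp only
      split_ifs <;> omega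
    -- From slot `t` on, the new slot `u` is the old slot `u + 1`; the old slot `t` contributes
    -- nothing.
    · refine le_trans (card_le_card ?_) (hC.load_le (u + 1))
      intro i hi
      rw [mem_filter] at hi ⊢
      have := hidle i (mem_range.1 hi.1)
      refine ⟨hi.1, ?_⟩
      have h2 := hi.2
      dsimp only at h2
      split_ifs at h2 <;> omega
  and_lt j hj ho i hi hp := by
    have h1 := hC.and_lt j hj ho i hi hp
    have h2 := hidle i hi
    split_ifs <;> omega
  or_lt j hj ho := by
    obtain ⟨i, hi, hp, h1⟩ := hC.or_lt j hj ho
    have h2 := hidle i hi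
    refine ⟨i, hi, hp, ?_⟩
    split_ifs <;> omega

/-- Exchanging a job with trivial constraint with a successor in the slot before, when no successor
occupies the slot of the former. -/
theorem Feas.exchange {C : ℕ → ℕ} (hC : X.Feas C) {x y : ℕ} (hx : x < X.n) (hxs : ¬ X.isS x)
    (hy : y < X.n) (hxy : C y + 1 = C x) (hno : ∀ z, X.isS z → C z ≠ C x) :
    X.Feas fun i => C (Equiv.swap x y i) := by
  have hrange : ∀ i < X.n, Equiv.swap x y i < X.n := by
    intro i hi
    rw [Equiv.swap_apply_def]
    split_ifs <;> assumption
  -- Only successors have constraints. Delaying `y` by one slot could only hurt a successor in the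
  -- slot of `x`, and there is none; `x` itself moves forward.
  have key : ∀ i j, i < X.n → X.isS j → C i < C j →
      C (Equiv.swap x y i) < C (Equiv.swap x y j) := by
    intro i j hi hj hlt
    have hjx : j ≠ x := by rintro rfl; exact hxs hj
    have hjC := hno j hj
    by_cases hjy : j = y
    · subst hjy
      have hix : i ≠ x := by rintro rfl; omega
      have hiy : i ≠ j := by rintro rfl; omega
      rw [Equiv.swap_apply_of_ne_of_ne hix hiy, Equiv.swap_apply_right]
      omega
    · rw [Equiv.swap_apply_of_ne_of_ne hjx hjy, Equiv.swap_apply_def]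
      split_ifs with h1 h2
      · subst h1; omega
      · subst h2; omega
      · exact hlt
  refine ⟨fun i hi => hC.pos _ (hrange i hi), fun t => ?_, ?_, ?_⟩
  · rw [load_swap hx hy]; exact hC.load_le t
  · intro j hj ho i hi hp
    exact key i j hi ⟨hj, Or.inr ⟨i, hi, hp⟩⟩ (hC.and_lt j hj ho i hi hp)
  · intro j hj ho
    obtain ⟨i, hi, hp, h1⟩ := hC.or_lt j hj ho
    exact ⟨i, hi, hp, key i j hi ⟨hj, Or.inl ho⟩ h1⟩

/-- A lexicographic minimizer admits neither the deletion of an idle slot nor a profitable exchange,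
which forces the successors into a short window and bounds its start. The window is what makes
tuples in `{1, ..., k}` and shifts in `{0, ..., n - k}` sufficient. -/
theorem exists_optimal_window (γ : Objective) (h : ∃ C, X.Feas C) :
    ∃ C, X.Feas C ∧ (∀ C', X.Feas C' → X.val γ C ≤ X.val γ C') ∧
      ∃ t, t + X.k ≤ X.n ∧ ∀ l < X.k, t + 1 ≤ C (X.su l) ∧ C (X.su l) ≤ t + X.k := by
  obtain ⟨C, hC, hopt, hsum, hfree⟩ := exists_lex_optimal γ h
  refine ⟨C, hC, hopt, ?_⟩
  -- Deleting an idle slot does not worsen `γ` and strictly decreases the sum of completion times.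
  have hidle : ∀ t, 1 ≤ t → (∃ i < X.n, t < C i) → ∃ i < X.n, C i = t := by
    rintro t ht ⟨i, hi, hti⟩
    by_contra! hno
    have hF := hC.removeSlot ht hno
    have hle : ∀ i < X.n, (if t < C i then C i - 1 else C i) ≤ C i := by
      intro i _
      split_ifs <;> omega
    have h1 := hsum _ hF (val_le_of_tail_le γ (tail_mono hle))
    refine absurd h1 (not_le.2 ?_)
    refine sum_lt_sum (fun i hi => hle i (mem_range.1 hi)) ⟨i, mem_range.2 hi, ?_⟩
    rw [if_pos hti]
    omega
  -- The exchange keeps both objectives, but lowers the sum over the free jobs, as `x` is free and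
  -- `y` is not.
  have hexch : ∀ x y, x < X.n → ¬ X.isS x → X.isS y → C y + 1 = C x →
      ∃ z, X.isS z ∧ C z = C x := by
    intro x y hx hxs hys hxy
    by_contra! hno
    have hy := isS_lt hys
    have hF := hC.exchange hx hxs hy hxy hno
    have hv : ∀ γ, X.val γ (fun i => C (Equiv.swap x y i)) ≤ X.val γ C := fun γ =>
      val_le_of_tail_le γ fun t => (tail_swap hx hy C t).le
    refine absurd (hfree _ hF (hv _) (hv _)) (not_le.2 ?_)
    have hne : ∀ i, ¬ X.isS i → i ≠ y := by rintro i hi rfl; exact hi hys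
    refine sum_lt_sum (fun i hi => ?_) ⟨x, by simp [hx, hxs], ?_⟩
    · rw [mem_filter] at hi
      by_cases hix : i = x
      · subst hix; rw [Equiv.swap_apply_left]; omega
      · rw [Equiv.swap_apply_of_ne_of_ne hix (hne i hi.2)]
    · rw [Equiv.swap_apply_left]; omega
  rcases Nat.eq_zero_or_pos X.k with hk | hk
  · exact ⟨0, by omega, fun l hl => by omega⟩
  obtain ⟨la, hla, hmin⟩ := exists_minimizer (p := fun l => l < X.k) ⟨0, hk⟩ fun l => C (X.su l)
  obtain ⟨lb, hlb, hmax⟩ := exists_max_image (range X.k) (fun l => C (X.su l)) ⟨0, by simpa using hk⟩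
  rw [mem_range] at hlb
  have ha := hC.pos _ (su_lt hla)
  -- Going from the first successor slot to the last: the next slot is not idle, and if it holds a
  -- free job, the exchange argument supplies a successor in it.
  have hcont : ∀ d, C (X.su la) + d ≤ C (X.su lb) → ∃ l < X.k, C (X.su l) = C (X.su la) + d := by
    intro d
    induction d with
    | zero => exact fun _ => ⟨la, hla, rfl⟩
    | succ d ih =>
      intro hd
      obtain ⟨l, hl, hCl⟩ := ih (by omega)
      rcases eq_or_lt_of_le hd with heq | hlt
      · exact ⟨lb, hlb, heq.symm⟩
      · obtain ⟨x, hx, hCx⟩ := hidle _ (by omega) ⟨_, su_lt hlb, hlt⟩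
        by_cases hxs : X.isS x
        · obtain ⟨l', hl', rfl⟩ := exists_su hxs
          exact ⟨l', hl', hCx⟩
        · obtain ⟨z, hz, hCz⟩ := hexch x _ hx hxs (isS_su hl) (by omega)
          obtain ⟨l', hl', rfl⟩ := exists_su hz
          exact ⟨l', hl', hCz.trans hCx⟩
  -- Every slot of the run contains one of the `k` successors.
  have hspan : C (X.su lb) + 1 - C (X.su la) ≤ X.k := by
    have hsub : Icc (C (X.su la)) (C (X.su lb)) ⊆ (range X.k).image fun l => C (X.su l) := by
      intro u hu
      rw [mem_Icc] at hu
      obtain ⟨l, hl, hCl⟩ := hcont (u - C (X.su la)) (by omega)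
      exact mem_image.2 ⟨l, mem_range.2 hl, by omega⟩
    have := (card_le_card hsub).trans card_image_le
    rwa [Nat.card_Icc, card_range] at this
  -- Every slot before the run contains one of the `n - k` free jobs.
  have hshift : C (X.su la) - 1 ≤ X.n - X.k := by
    have hsub : Icc 1 (C (X.su la) - 1) ⊆ ((range X.n).filter fun i => ¬ X.isS i).image C := by
      intro u hu
      rw [mem_Icc] at hu
      obtain ⟨x, hx, hCx⟩ := hidle u hu.1 ⟨_, su_lt hla, by omega⟩
      refine mem_image.2 ⟨x, mem_filter.2 ⟨mem_range.2 hx, fun hs => ?_⟩, hCx⟩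
      obtain ⟨l, hl, rfl⟩ := exists_su hs
      have := hmin l hl
      omega
    have h1 := (card_le_card hsub).trans card_image_le
    have h2 := card_filter_add_card_filter_not (s := range X.n) X.isS
    rw [← k_eq_card, card_range] at h2
    rw [Nat.card_Icc] at h1
    omega
  have hk' := X.k_le
  refine ⟨C (X.su la) - 1, by omega, fun l hl => ?_⟩
  have h1 := hmin l hl
  have h2 := hmax l (mem_range.2 hl)
  omega

end Ctx
end
end AndOrSched

namespace AndOrSched

open Finset
section

/-! ### The memory contents after preprocessing -/

/-- The registers and arrays that stay fixed after preprocessing. -/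
structure Env (X : Ctx) (s : State) : Prop where
  n : s.reg rN = X.n
  m : s.reg rM = X.m
  k : s.reg rK = X.k
  off : ∀ j < X.n, s.arr aOff j = j * X.n
  pred : ∀ i < X.n, ∀ j < X.n, s.arr aPred (s.arr aOff j + i) = 1 ↔ X.pred i j
  kind : ∀ j < X.n, s.arr aKind j = 1 ↔ X.isOr j
  isSucc_eq_one : ∀ j < X.n, s.arr aIsSucc j = 1 ↔ X.isS j
  isSucc_eq_zero : ∀ j < X.n, s.arr aIsSucc j = 0 ↔ ¬ X.isS j
  succ : ∀ l < X.k, s.arr aSucc l = X.su l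

namespace Env

variable {X : Ctx} {s : State}

@[simp] theorem setReg_iff {r v : ℕ} (hr : 2 < r) : Env X (s.setReg r v) ↔ Env X s := by
  have h0 : rN ≠ r := by rintro rfl; exact absurd hr (by decide)
  have h1 : rM ≠ r := by rintro rfl; exact absurd hr (by decide)
  have h2 : rK ≠ r := by rintro rfl; exact absurd hr (by decide)
  constructor <;> rintro ⟨a, b, c, d, e, f, g, g', h⟩ <;>
    exact ⟨by simpa [h0] using a, by simpa [h1] using b, by simpa [h2] using c, d, e, f, g, g', h⟩

@[simp] theorem setArr_iff {a i v : ℕ} (ha : 4 < a) : Env X (s.setArr a i v) ↔ Env X s := by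
  have h0 : aPred ≠ a := by rintro rfl; exact absurd ha (by decide)
  have h1 : aKind ≠ a := by rintro rfl; exact absurd ha (by decide)
  have h2 : aOff ≠ a := by rintro rfl; exact absurd ha (by decide)
  have h3 : aIsSucc ≠ a := by rintro rfl; exact absurd ha (by decide)
  have h4 : aSucc ≠ a := by rintro rfl; exact absurd ha (by decide)
  constructor <;> rintro ⟨a, b, c, d, e, f, g, g', h⟩ <;>
    exact ⟨a, b, c, by simpa [h2] using d, by simpa [h0, h2] using e, by simpa [h1] using f,
      by simpa [h3] using g,
      by simpa [h3] using g', by simpa [h4] using h⟩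

theorem frame {c : Cmd} {s' : State} (h : Env X s) (hF : Frame c s s')
    (hc : (c.writesReg rN || c.writesReg rM || c.writesReg rK || c.writesArr aPred ||
      c.writesArr aKind || c.writesArr aOff || c.writesArr aIsSucc || c.writesArr aSucc) = false) :
    Env X s' := by
  simp only [Bool.or_eq_false_iff] at hc
  obtain ⟨⟨⟨⟨⟨⟨⟨c1, c2⟩, c3⟩, c4⟩, c5⟩, c6⟩, c7⟩, c8⟩ := hc
  obtain ⟨h1, h2, h3, h4, h5, h6, h7, h7', h8⟩ := h
  exact ⟨by rw [hF.reg _ c1, h1], by rw [hF.reg _ c2, h2], by rw [hF.reg _ c3, h3],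
    by rwa [hF.arr _ c6], by rwa [hF.arr _ c4, hF.arr _ c6], by rwa [hF.arr _ c5],
    by rwa [hF.arr _ c7], by rwa [hF.arr _ c7], by rwa [hF.arr _ c8]⟩

end Env

/-- The array of the numbers of jobs in the time slots matches the completion times. -/
def CntOK (X : Ctx) (s : State) : Prop :=
  ∀ t, 1 ≤ t → t ≤ X.n → s.arr aCnt t = X.load (s.arr aC) t

variable {X : Ctx} {s : State}

/-- The bounds on tuple and shift keep all assigned times in `1, ..., n`, so only these slots matter
for the load test. The counts stay correct even when the choice is discarded, since the program goes
on with the flag lowered. Time 0 marks a job as unplaced. -/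
theorem placeSuccessors_spec (hE : Env X s)
    (hτ : ∀ l < X.k, 1 ≤ s.arr aTau l ∧ s.arr aTau l ≤ X.k)
    (hsh : s.reg rShift + X.k ≤ X.n) :
    wp placeSuccessors s fun t s' => t ≤ 100 * X.n + 100 ∧
      (∀ l < X.k, s'.arr aC (X.su l) = s.arr aTau l + s.reg rShift) ∧
      (∀ i < X.n, ¬ X.isS i → s'.arr aC i = 0) ∧ CntOK X s' ∧
      (s'.reg rOk = 1 ↔ ∀ t, 1 ≤ t → t ≤ X.n → s'.arr aCnt t ≤ X.m) := by
  have hk := X.k_le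
  simp only [placeSuccessors, wp_block_cons, wp_set, Exp.eval, Exp.cost]
  refine wp_forLt X.n 5 (fun i s' => ∀ j < i, s'.arr aC j = 0) rfl ?_ ?_ ?_ ?_
  · intro s' hF
    simp +decide [Exp.eval, hF.reg rN rfl, hE.n]
  · simp
  · intro i s₁ hi hF hr hI
    simp +decide only [wp_store, Exp.eval, Exp.cost, State.arr_setReg, State.arr_setArr_self, hr]
    refine ⟨by simp, fun j hj => ?_⟩
    by_cases h : j = i
    · simp [h]
    · simp [h, hI j (by omega)]
  intro t₁ s₁ ht₁ hF₁ _ hI₁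
  have hE₁ : Env X s₁ := Env.frame (by simpa +decide using hE) hF₁ rfl
  refine wp_forLt (X.n + 1) 5 (fun i s' => ∀ j < i, s'.arr aCnt j = 0) rfl ?_ ?_ ?_ ?_
  · intro s' hF
    simp +decide [Exp.eval, hF.reg rN rfl, hE₁.n]
  · simp
  · intro i s₁ hi hF hr hI
    simp +decide only [wp_store, Exp.eval, Exp.cost, State.arr_setReg, State.arr_setArr_self, hr]
    refine ⟨by simp, fun j hj => ?_⟩
    by_cases h : j = i
    · simp [h]
    · simp [h, hI j (by omega)]
  intro t₂ s₂ ht₂ hF₂ _ hI₂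
  have hE₂ : Env X s₂ := hE₁.frame hF₂ rfl
  have hC₂ : ∀ j < X.n, s₂.arr aC j = 0 := by rwa [hF₂.arr aC rfl]
  have hτ₂ : s₂.arr aTau = s.arr aTau := by rw [hF₂.arr aTau rfl, hF₁.arr aTau rfl]; rfl
  have hs₂ : s₂.reg rShift = s.reg rShift := by
    rw [hF₂.reg rShift rfl, hF₁.reg rShift rfl]; simp +decide
  have ho₂ : s₂.reg rOk = 1 := by
    rw [hF₂.reg rOk rfl, hF₁.reg rOk rfl]; simp +decide
  refine wp_forLt X.k 50 (fun l s' =>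
    (∀ l' < l, s'.arr aC (X.su l') = s.arr aTau l' + s.reg rShift) ∧
    (∀ i < X.n, (∀ l' < l, X.su l' ≠ i) → s'.arr aC i = 0) ∧ CntOK X s' ∧
    (s'.reg rOk = 1 ↔ ∀ t, 1 ≤ t → t ≤ X.n → s'.arr aCnt t ≤ X.m)) rfl ?_ ?_ ?_ ?_
  · intro s' hF
    simp +decide [Exp.eval, hF.reg rK rfl, hE₂.k]
  · simp +decide only [Nat.not_lt_zero, false_imp_iff, implies_true, true_and, State.arr_setReg,
      CntOK, ne_eq, not_false_eq_true, State.reg_setReg_of_ne, ho₂, true_iff]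
    refine ⟨fun i hi _ => hC₂ i hi, fun t ht htn => ?_, fun t ht htn => ?_⟩
    · rw [hI₂ t (by omega), Ctx.load, eq_comm, card_eq_zero, filter_eq_empty_iff]
      intro i hi
      rw [hC₂ i (mem_range.1 hi)]
      omega
    · rw [hI₂ t (by omega)]; omega
  · rintro l s₃ hl hF hr ⟨h1, h2, h3, h4⟩
    have hE₃ : Env X s₃ := hE₂.frame hF rfl
    have hτ₃ : s₃.arr aTau = s.arr aTau := by rw [hF.arr aTau rfl, hτ₂]
    have hs₃ : s₃.reg rShift = s.reg rShift := by rw [hF.reg rShift rfl, hs₂]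
    have hl1 := hτ l hl
    have hsu := Ctx.su_lt hl
    -- The enumeration of the successors is injective, so this one has not been placed before and
    -- its slot count must rise by exactly one.
    have h0 : s₃.arr aC (X.su l) = 0 :=
      h2 _ hsu fun l' hl' he => by
        have := Ctx.su_inj (hl'.trans hl) hl he
        omega
    have hcn : s₃.arr aCnt (s.arr aTau l + s.reg rShift) =
        X.load (s₃.arr aC) (s.arr aTau l + s.reg rShift) := h3 _ (by omega) (by omega)
    have hup : ∀ l' < l + 1, Function.update (s₃.arr aC) (X.su l) (s.arr aTau l + s.reg rShift)
        (X.su l') = s.arr aTau l' + s.reg rShift := by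
      intro l' hl'
      by_cases h : l' = l
      · simp [h]
      · rw [Function.update_of_ne, h1 l' (by omega)]
        exact fun he => h (Ctx.su_inj (by omega) hl he)
    have hup0 : ∀ i < X.n, (∀ l' < l + 1, X.su l' ≠ i) →
        Function.update (s₃.arr aC) (X.su l) (s.arr aTau l + s.reg rShift) i = 0 := by
      intro i hi hne
      rw [Function.update_of_ne (hne l (by omega)).symm, h2 i hi fun l' hl' => hne l' (by omega)]
    have hcnt : ∀ t, 1 ≤ t → t ≤ X.n →
        Function.update (s₃.arr aCnt) (s.arr aTau l + s.reg rShift)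
          (s₃.arr aCnt (s.arr aTau l + s.reg rShift) + 1) t =
        X.load (Function.update (s₃.arr aC) (X.su l) (s.arr aTau l + s.reg rShift)) t := by
      intro t ht htn
      rw [Ctx.load_update hsu h0 ht]
      by_cases h : t = s.arr aTau l + s.reg rShift
      · subst h; simp [hcn]
      · simp [h, h3 t ht htn]
    have hex : 1 ≤ s.arr aTau l + s.reg rShift ∧ s.arr aTau l + s.reg rShift ≤ X.n := by omega
    simp +decide only [wp_block_cons, wp_block_nil, wp_set, wp_store, wp_when, wp_incArr, Exp.eval,
      Exp.cost, succOf, ne_eq, not_false_eq_true, State.arr_setReg, State.arr_setArr_self,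
      State.arr_setArr_of_ne, State.reg_setReg_of_ne, State.reg_setReg_self, State.reg_setArr,
      Test.Holds, Test.cost, CntOK, hr, hτ₃, hs₃, hE₃.succ l hl, hE₃.m, Function.update_self]
    refine ⟨fun hlt => ⟨trivial, hup, hup0, hcnt, ?_⟩, fun hlt => ⟨trivial, hup, hup0, hcnt, ?_⟩⟩
    · simp only [false_iff]
      intro h
      have := h _ hex.1 hex.2
      simp only [Function.update_self] at this
      omega
    · rw [h4]
      refine forall_congr' fun t => forall_congr' fun ht => forall_congr' fun htn => ?_
      by_cases h : t = s.arr aTau l + s.reg rShift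
      · subst h; simp only [Function.update_self]; omega
      · simp [h]
  · rintro t s₃ ht₃ hF₃ _ ⟨h1, h2, h3, h4⟩
    rw [wp_block_nil]
    simp only [Exp.cost] at ht₁ ht₂ ht₃
    refine ⟨by omega, h1, fun i hi hs => h2 i hi ?_, h3, h4⟩
    rintro l hl rfl
    exact hs (Ctx.isS_su hl)

end
end AndOrSched

namespace AndOrSched

open Finset
section

/-! ### Sorting the successors and searching for representatives -/

variable {X : Ctx} {s : State}

/-- Successor `l` comes before successor `l'` in the order by completion time. -/
def Before (τ : ℕ → ℕ) (l l' : ℕ) : Prop := τ l < τ l' ∨ τ l = τ l' ∧ l < l'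

/-- `ord` lists the indices of the successors in order of non-decreasing completion time. -/
structure Sorted (X : Ctx) (τ ord : ℕ → ℕ) : Prop where
  lt : ∀ p < X.k, ord p < X.k
  before : ∀ p q, p < q → q < X.k → Before τ (ord p) (ord q)
  surj : ∀ l < X.k, ∃ p < X.k, ord p = l

theorem Sorted.mono {τ ord : ℕ → ℕ} (h : Sorted X τ ord) {p q : ℕ} (hpq : p ≤ q) (hq : q < X.k) :
    τ (ord p) ≤ τ (ord q) := by
  rcases eq_or_lt_of_le hpq with rfl | hlt
  · exact le_rfl
  · rcases h.before p q hlt hq with h | h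
    · exact h.le
    · exact h.1.le

/-- Bridges the two descriptions of the order: the program compares positions, while the exchange
argument compares completion times with ties broken by index. -/
theorem Sorted.not_before_iff {τ ord : ℕ → ℕ} (h : Sorted X τ ord) {p q : ℕ} (hp : p < X.k)
    (hq : q < X.k) : ¬ Before τ (ord q) (ord p) ↔ p ≤ q := by
  constructor
  · intro hb
    by_contra! hlt
    exact hb (h.before q p hlt hp)
  · intro hpq hb
    rcases eq_or_lt_of_le hpq with rfl | hlt
    · rcases hb with hb | hb
      · exact lt_irrefl _ hb
      · exact lt_irrefl _ hb.2
    · rcases h.before p q hlt hq with h1 | h1 <;> rcases hb with hb | hb <;> omega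

/-- Bucket sort: one scan over the indices per time value. It lists ties by increasing index, so the
output is strictly increasing for the total order `Before`. -/
theorem sortSuccessors_spec (hE : Env X s)
    (hτ : ∀ l < X.k, 1 ≤ s.arr aTau l ∧ s.arr aTau l ≤ X.k) :
    wp sortSuccessors s fun t s' => t ≤ 100 * (X.k * X.k) + 100 * X.k + 100 ∧
      Sorted X (s.arr aTau) (s'.arr aOrd) := by
  -- The indices already listed when the scan for the value `T + 1` has treated the indices below
  -- `L`. Nothing is done at `T = L = 0` because all times are positive.
  let done : ℕ → ℕ → ℕ → Prop := fun T L l => s.arr aTau l ≤ T ∨ s.arr aTau l = T + 1 ∧ l < L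
  let J : ℕ → ℕ → State → Prop := fun T L s' =>
    (∀ p < s'.reg rP, s'.arr aOrd p < X.k ∧ done T L (s'.arr aOrd p)) ∧
    (∀ l < X.k, done T L l → ∃ p < s'.reg rP, s'.arr aOrd p = l) ∧
    (∀ p q, p < q → q < s'.reg rP → Before (s.arr aTau) (s'.arr aOrd p) (s'.arr aOrd q))
  have hJr : ∀ T L r v s', rP ≠ r → (J T L (s'.setReg r v) ↔ J T L s') := by
    intro T L r v s' hr
    simp only [J, State.reg_setReg_of_ne _ _ hr, State.arr_setReg]
  simp only [sortSuccessors, wp_block_cons, wp_set, Exp.eval, Exp.cost]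
  refine wp_forLt X.k (50 * X.k + 20) (fun T s' => J T 0 s') rfl ?_ ?_ ?_ ?_
  · intro s' hF
    simp +decide [Exp.eval, hF.reg rK rfl, hE.k]
  · rw [hJr _ _ _ _ _ (by decide)]
    refine ⟨by simp, fun l hl hd => ?_, by simp⟩
    have := hτ l hl
    simp only [done] at hd
    omega
  · intro T s₁ hT hF hr hI
    have hE₁ : Env X s₁ := Env.frame (by simpa +decide using hE) hF rfl
    have hτ₁ : s₁.arr aTau = s.arr aTau := by rw [hF.arr aTau rfl]; rfl
    refine wp_forLt X.k 38 (fun L s' => J T L s') rfl ?_ ?_ ?_ ?_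
    · intro s' hF
      simp +decide [Exp.eval, hF.reg rK rfl, hE₁.k]
    · rw [hJr _ _ _ _ _ (by decide)]
      exact hI
    · rintro L s₂ hL hF₂ hr₂ ⟨h1, h2, h3⟩
      have hτ₂ : s₂.arr aTau = s.arr aTau := by rw [hF₂.arr aTau rfl, hτ₁]
      have hT₂ : s₂.reg rT = T := by rw [hF₂.reg rT rfl, hr]
      simp +decide only [wp_when, wp_block_cons, wp_block_nil, wp_set, wp_store, Exp.eval,
        Exp.cost, Test.Holds, Test.cost, hr₂, hτ₂, hT₂, State.reg_setArr]
      refine ⟨fun he => ⟨by simp, ?_⟩, fun he => ⟨by simp, ?_⟩⟩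
      · rw [hJr _ _ _ _ _ (by decide)]
        simp +decide only [J, State.reg_setReg_self, State.arr_setReg, State.arr_setArr_self]
        refine ⟨fun p hp => ?_, fun l hl hd => ?_, fun p q hpq hq => ?_⟩
        · by_cases h : p = s₂.reg rP
          · subst h
            simp only [Function.update_self]
            exact ⟨hL, Or.inr ⟨he, by omega⟩⟩
          · rw [Function.update_of_ne h]
            obtain ⟨ha, hb⟩ := h1 p (by omega)
            refine ⟨ha, ?_⟩
            simp only [done] at hb ⊢
            omega
        · by_cases h : l = L
          · exact ⟨s₂.reg rP, by omega, by simp [h]⟩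
          · obtain ⟨p, hp, hpl⟩ := h2 l hl (by simp only [done] at hd ⊢; omega)
            exact ⟨p, by omega, by rw [Function.update_of_ne (by omega), hpl]⟩
        · rw [Function.update_of_ne (by omega)]
          by_cases h : q = s₂.reg rP
          · subst h
            rw [Function.update_self]
            obtain ⟨_, hb⟩ := h1 p (by omega)
            simp only [done] at hb
            simp only [Before]
            omega
          · rw [Function.update_of_ne h]
            exact h3 p q hpq (by omega)
      · rw [hJr _ _ _ _ _ (by decide)]
        refine ⟨fun p hp => ?_, fun l hl hd => h2 l hl ?_, h3⟩
        · obtain ⟨ha, hb⟩ := h1 p hp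
          refine ⟨ha, ?_⟩
          simp only [done] at hb ⊢
          omega
        · simp only [done] at hd ⊢
          by_cases h : l = L
          · subst h; omega
          · omega
    · rintro t s₂ ht hF₂ _ ⟨h1, h2, h3⟩
      refine ⟨by simp only [Exp.cost] at ht; nlinarith, ?_⟩
      rw [hJr _ _ _ _ _ (by decide)]
      refine ⟨fun p hp => ?_, fun l hl hd => h2 l hl ?_, h3⟩
      · obtain ⟨ha, hb⟩ := h1 p hp
        refine ⟨ha, ?_⟩
        simp only [done] at hb ⊢
        omega
      · simp only [done] at hd ⊢
        omega
  · rintro t s₁ ht hF hr ⟨h1, h2, h3⟩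
    rw [wp_block_nil]
    refine ⟨by simp only [Exp.cost] at ht ⊢; nlinarith, ?_⟩
    -- Strict monotonicity makes the list injective; since it also covers all indices, its length
    -- must be `k`.
    have hinj : Set.InjOn (s₁.arr aOrd) (range (s₁.reg rP)) := by
      intro p hp q hq he
      rw [coe_range, Set.mem_Iio] at hp hq
      by_contra hne
      rcases lt_or_gt_of_ne hne with h | h
      · have := h3 p q h hq
        rw [he, Before] at this
        omega
      · have := h3 q p h hp
        rw [he, Before] at this
        omega
    have himg : (range (s₁.reg rP)).image (s₁.arr aOrd) = range X.k := by
      ext l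
      simp only [mem_image, mem_range]
      constructor
      · rintro ⟨p, hp, rfl⟩
        exact (h1 p hp).1
      · intro hl
        exact h2 l hl (Or.inl (hτ l hl).2)
    have hP : s₁.reg rP = X.k := by
      rw [← card_range X.k, ← himg, card_image_of_injOn hinj, card_range]
    rw [hP] at h1 h2 h3
    exact ⟨fun p hp => (h1 p hp).1, h3, fun l hl => h2 l hl (Or.inl (hτ l hl).2)⟩

theorem Env.isPred_iff (hE : Env X s) {i j : Exp} (hi : i.eval s < X.n) (hj : j.eval s < X.n) :
    (isPred i j).Holds s ↔ X.pred (i.eval s) (j.eval s) :=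
  hE.pred _ hi _ hj

theorem Env.isOrJob_iff (hE : Env X s) {j : Exp} (hj : j.eval s < X.n) :
    (isOrJob j).Holds s ↔ X.isOr (j.eval s) :=
  hE.kind _ hj

/-- `i` is a successor that can represent the or-job `j`. -/
def SuccRep (X : Ctx) (C : ℕ → ℕ) (i j : ℕ) : Prop :=
  X.isOr j ∧ X.isS i ∧ X.pred i j ∧ C i < C j

/-- The entry `n`, which is not a job, means that no representative has been chosen; and-jobs always
keep it because `SuccRep` demands an or-job. -/
theorem successorRepresentatives_spec (hE : Env X s) :
    wp successorRepresentatives s fun t s' => t ≤ 100 * (X.k * X.n) + 100 * X.k + 100 ∧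
      ∀ l < X.k, s'.arr aRep l = X.n ∧ (∀ i < X.n, ¬ SuccRep X (s.arr aC) i (X.su l)) ∨
        s'.arr aRep l < X.n ∧ SuccRep X (s.arr aC) (s'.arr aRep l) (X.su l) := by
  rw [successorRepresentatives]
  refine wp_forLt X.k (60 * X.n + 60) (fun L s' => ∀ l < L,
      s'.arr aRep l = X.n ∧ (∀ i < X.n, ¬ SuccRep X (s.arr aC) i (X.su l)) ∨
        s'.arr aRep l < X.n ∧ SuccRep X (s.arr aC) (s'.arr aRep l) (X.su l)) rfl ?_ ?_ ?_ ?_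
  · intro s' hF
    simp +decide [Exp.eval, hF.reg rK rfl, hE.k]
  · simp
  · intro L s₁ hL hF hr hI
    have hE₁ : Env X s₁ := hE.frame hF rfl
    have hC₁ : s₁.arr aC = s.arr aC := hF.arr aC rfl
    have hsu := Ctx.su_lt hL
    rw [wp_block_cons, wp_store]
    simp only [Exp.eval, Exp.cost, hr, hE₁.n, wp_block_cons, wp_block_nil, wp_when]
    have hE₂ : Env X (s₁.setArr aRep L X.n) := by simpa +decide using hE₁
    have hj : (succOf rL).eval (s₁.setArr aRep L X.n) = X.su L := by
      simp +decide [succOf, Exp.eval, hr, hE₁.succ L hL]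
    have hor := hE₂.isOrJob_iff (j := succOf rL) (by rwa [hj])
    rw [hor, hj]
    refine ⟨fun ho => ?_, fun ho => ⟨by simp [isOrJob, succOf, Test.cost, Exp.cost], ?_⟩⟩
    · refine wp_forLt X.n 50 (fun i s' => (∀ l, l ≠ L → s'.arr aRep l = s₁.arr aRep l) ∧
        (s'.arr aRep L = X.n ∧ (∀ i' < i, ¬ SuccRep X (s.arr aC) i' (X.su L)) ∨
          s'.arr aRep L < X.n ∧ SuccRep X (s.arr aC) (s'.arr aRep L) (X.su L))) rfl ?_ ?_ ?_ ?_
      · intro s' hF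
        simp +decide [Exp.eval, hF.reg rN rfl, hE₁.n]
      · simp +contextual
      · rintro i s₂ hi hF₂ hr₂ ⟨h1, h2⟩
        have hE₃ := hE₂.frame hF₂ rfl
        have hL₃ : s₂.reg rL = L := by rw [hF₂.reg rL rfl]; exact hr
        have hC₃ : s₂.arr aC = s.arr aC := by rw [hF₂.arr aC rfl, ← hC₁]; simp +decide
        have hj₃ : (succOf rL).eval s₂ = X.su L := by
          simp +decide [succOf, Exp.eval, hL₃, hE₃.succ L hL]
        have hp := hE₃.isPred_iff (i := .reg rI) (j := succOf rL)
          (by simpa [Exp.eval, hr₂] using hi) (by rwa [hj₃])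
        have hb : (Test.and (.eq (.get aIsSucc (.reg rI)) (.lit 1))
            (.and (isPred (.reg rI) (succOf rL))
              (.lt (.get aC (.reg rI)) (.get aC (succOf rL))))).Holds s₂ ↔
            SuccRep X (s.arr aC) i (X.su L) := by
          simp only [Test.Holds, hp, hj₃, Exp.eval, hr₂, hE₃.isSucc_eq_one i hi, hC₃, SuccRep, ho,
            true_and]
        rw [wp_when, hb]
        simp only [wp_store, Exp.eval, hL₃, hr₂, State.arr_setReg, State.arr_setArr_self]
        refine ⟨fun h => ⟨by simp [isPred, succOf, Test.cost, Exp.cost], fun l hl => ?_, ?_⟩,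
          fun h => ⟨by simp [isPred, succOf, Test.cost, Exp.cost], h1, ?_⟩⟩
        · rw [Function.update_of_ne hl, h1 l hl]
        · right
          rw [Function.update_self]
          exact ⟨hi, h⟩
        · rcases h2 with h2 | h2
          · left
            refine ⟨h2.1, fun i' hi' => ?_⟩
            by_cases he : i' = i
            · rwa [he]
            · exact h2.2 i' (by omega)
          · exact Or.inr h2
      · rintro t s₂ ht hF₂ hr₂ ⟨h1, h2⟩
        refine ⟨?_, fun l hl => ?_⟩
        · simp only [isOrJob, succOf, Test.cost, Exp.cost] at ht ⊢
          omega
        · rw [State.arr_setReg]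
          by_cases he : l = L
          · subst he; exact h2
          · rw [h1 l he]; exact hI l (by omega)
    · intro l hl
      simp only [State.arr_setReg, State.arr_setArr_self]
      by_cases he : l = L
      · subst he
        rw [Function.update_self]
        exact Or.inl ⟨rfl, fun i _ h => ho h.1⟩
      · rw [Function.update_of_ne he]; exact hI l (by omega)
  · intro t s₁ ht hF hr hI
    refine ⟨?_, hI⟩
    simp only [Exp.cost] at ht
    nlinarith

/-- The condition on a representative of the successor at position `p` with set `S` that concerns
the successor at position `p'`. -/
def Fits (X : Ctx) (ord : ℕ → ℕ) (S : ℕ → Prop) (p i p' : ℕ) : Prop :=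
  (S (ord p') → X.pred i (X.su (ord p'))) ∧
  (¬ S (ord p') → X.pred i (X.su (ord p')) → X.isOr (X.su (ord p')) ∧ p' < p)

/-- The conditions on a representative of the successor at position `p` with set `S`. -/
def IsMatch (X : Ctx) (ord : ℕ → ℕ) (S : ℕ → Prop) (p i : ℕ) : Prop :=
  ¬ X.isS i ∧ ∀ p' < X.k, Fits X ord S p i p'

/-- The search is exhaustive, so the value `n` certifies that no job matches. Which match is found
does not matter: the exchange argument works for any of them. -/
theorem searchRepresentative_spec (hE : Env X s) (hp : s.reg rP < X.k) (hl : s.reg rL < X.k)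
    (hord : ∀ p < X.k, s.arr aOrd p < X.k) (S : ℕ → Prop)
    (hS : ∀ l' < X.k, s.arr aSel (s.reg rL * X.n + l') = 1 ↔ S l') :
    wp searchRepresentative s fun t s' => t ≤ 100 * (X.n * X.k) + 100 * X.n + 100 ∧
      (s'.reg rRep = X.n ∧ (∀ i < X.n, ¬ IsMatch X (s.arr aOrd) S (s.reg rP) i) ∨
        s'.reg rRep < X.n ∧ IsMatch X (s.arr aOrd) S (s.reg rP) (s'.reg rRep)) := by
  have hk := X.k_le
  simp only [searchRepresentative, wp_block_cons, wp_set, Exp.eval, Exp.cost, hE.n]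
  refine wp_forLt X.n (80 * X.k + 60) (fun i s' =>
      s'.reg rRep = X.n ∧ (∀ i' < i, ¬ IsMatch X (s.arr aOrd) S (s.reg rP) i') ∨
        s'.reg rRep < X.n ∧ IsMatch X (s.arr aOrd) S (s.reg rP) (s'.reg rRep)) rfl ?_ ?_ ?_ ?_
  · intro s' hF
    simp +decide [Exp.eval, hF.reg rN rfl, hE.n]
  · simp +decide
  · intro i s₁ hi hF hr hI
    have hE₁ : Env X s₁ := Env.frame (by simpa +decide using hE) hF rfl
    have hstep : ∀ v, (v = s₁.reg rRep ∧ ¬ IsMatch X (s.arr aOrd) S (s.reg rP) i ∨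
          v = i ∧ IsMatch X (s.arr aOrd) S (s.reg rP) i) →
        (v = X.n ∧ (∀ i' < i + 1, ¬ IsMatch X (s.arr aOrd) S (s.reg rP) i') ∨
          v < X.n ∧ IsMatch X (s.arr aOrd) S (s.reg rP) v) := by
      rintro v (⟨rfl, hn⟩ | ⟨rfl, hm⟩)
      · rcases hI with hI | hI
        · left
          refine ⟨hI.1, fun i' hi' => ?_⟩
          by_cases he : i' = i
          · rwa [he]
          · exact hI.2 i' (by omega)
        · exact Or.inr hI
      · exact Or.inr ⟨hi, hm⟩
    rw [wp_when]
    simp only [Test.Holds, Exp.eval, hr, hE₁.isSucc_eq_zero i hi, wp_block_cons, wp_block_nil,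
      wp_set]
    refine ⟨fun hns => ?_, fun hns => ⟨by simp [Test.cost, Exp.cost], ?_⟩⟩
    · have hE₂ : Env X (s₁.setReg rMatch 1) := by simpa +decide using hE₁
      refine wp_forLt X.k 70 (fun p' s' => s'.reg rMatch = 1 ↔ ∀ q < p',
        Fits X (s.arr aOrd) S (s.reg rP) i q) rfl ?_ ?_ ?_ ?_
      · intro s' hF
        simp +decide [Exp.eval, hF.reg rK rfl, hE₁.k]
      · simp +decide
      · intro p' s₂ hp' hF₂ hr₂ hI₂
        have hE₃ := hE₂.frame hF₂ rfl
        have ho : s₂.arr aOrd = s.arr aOrd := by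
          rw [hF₂.arr aOrd rfl, State.arr_setReg, hF.arr aOrd rfl]
          rfl
        have hse : s₂.arr aSel = s.arr aSel := by
          rw [hF₂.arr aSel rfl, State.arr_setReg, hF.arr aSel rfl]
          rfl
        have hrI : s₂.reg rI = i := by rw [hF₂.reg rI rfl, ← hr]; simp +decide
        have hrL : s₂.reg rL = s.reg rL := by
          rw [hF₂.reg rL rfl, State.reg_setReg_of_ne _ _ (by decide), hF.reg rL rfl,
            State.reg_setReg_of_ne _ _ (by decide)]
        have hrP : s₂.reg rP = s.reg rP := by
          rw [hF₂.reg rP rfl, State.reg_setReg_of_ne _ _ (by decide), hF.reg rP rfl,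
            State.reg_setReg_of_ne _ _ (by decide)]
        have hl' := hord p' hp'
        have hsu := Ctx.su_lt hl'
        rw [wp_block_cons, wp_set]
        simp only [Exp.eval, hr₂, ho, wp_block_cons, wp_block_nil]
        set l' := s.arr aOrd p' with hl'def
        have hE₄ : Env X (s₂.setReg rL' l') := by simpa +decide using hE₃
        have hj : (succOf rL').eval (s₂.setReg rL' l') = X.su l' := by
          simp +decide [succOf, Exp.eval, hE₃.succ _ hl']
        have hp₄ := hE₄.isPred_iff (i := .reg rI) (j := succOf rL')
          (by simpa +decide [Exp.eval, hrI] using hi) (by rwa [hj])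
        have ho₄ := hE₄.isOrJob_iff (j := succOf rL') (by rwa [hj])
        have hrI' : (Exp.reg rI).eval (s₂.setReg rL' l') = i := by simp +decide [Exp.eval, hrI]
        rw [hj, hrI'] at hp₄
        rw [hj] at ho₄
        have hsel : (Test.eq (.get aSel (.add (.get aOff (.reg rL)) (.reg rL'))) (.lit 1)).Holds
            (s₂.setReg rL' l') ↔ S l' := by
          rw [← hS l' hl']
          simp +decide [Test.Holds, Exp.eval, hse, hrL, hE₃.off _ (hl.trans_le hk)]
        have hb2 : (Test.not (isPred (.reg rI) (succOf rL'))).Holds (s₂.setReg rL' l') ↔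
            ¬ X.pred i (X.su l') := by
          rw [Test.Holds, hp₄]
        have hb3 : (Test.and (isPred (.reg rI) (succOf rL'))
            (.or (.not (isOrJob (succOf rL'))) (.not (.lt (.reg rP') (.reg rP))))).Holds
            (s₂.setReg rL' l') ↔
            X.pred i (X.su l') ∧ (¬ X.isOr (X.su l') ∨ ¬ p' < s.reg rP) := by
          simp +decide [Test.Holds, hp₄, ho₄, Exp.eval, hr₂, hrP]
        -- The flag is kept if the condition `c` at position `p'` holds and zeroed otherwise; the
        -- four branches of the program only have to identify `c`.
        have hadd : ∀ v c, (v = s₂.reg rMatch ∧ c ∨ v = 0 ∧ ¬ c) →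
            (c ↔ Fits X (s.arr aOrd) S (s.reg rP) i p') →
            (v = 1 ↔ ∀ q < p' + 1, Fits X (s.arr aOrd) S (s.reg rP) i q) := by
          rintro v c hv hc
          rw [Nat.forall_lt_succ_right, ← hI₂, ← hc]
          rcases hv with ⟨rfl, hv⟩ | ⟨rfl, hv⟩ <;> simp [hv]
        have hm : (s₂.setReg rL' l').reg rMatch = s₂.reg rMatch := by simp +decide
        simp only [wp_ite, wp_when, hsel, hb2, hb3, wp_set, Exp.eval]
        have ht : ∀ v, (v = 1 ↔ ∀ q < p' + 1, Fits X (s.arr aOrd) S (s.reg rP) i q) →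
            ((((s₂.setReg rL' l').setReg rMatch v).setReg rP' (p' + 1)).reg rMatch = 1 ↔
              ∀ q < p' + 1, Fits X (s.arr aOrd) S (s.reg rP) i q) := by
          intro v hv
          rw [State.reg_setReg_of_ne _ _ (by decide), State.reg_setReg_self, hv]
        have ht' : (s₂.reg rMatch = 1 ↔ ∀ q < p' + 1, Fits X (s.arr aOrd) S (s.reg rP) i q) →
            (((s₂.setReg rL' l').setReg rP' (p' + 1)).reg rMatch = 1 ↔
              ∀ q < p' + 1, Fits X (s.arr aOrd) S (s.reg rP) i q) := by
          intro hv
          rw [State.reg_setReg_of_ne _ _ (by decide), hm, hv]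
        refine ⟨fun hs => ⟨fun hc => ⟨by simp [isPred, isOrJob, succOf, Test.cost, Exp.cost],
            ht _ (hadd _ False (Or.inr ⟨rfl, not_false⟩) (iff_of_false not_false fun h => hc (h.1 hs)))⟩,
          fun hc => ⟨by simp [isPred, isOrJob, succOf, Test.cost, Exp.cost],
            ht' (hadd _ True (Or.inl ⟨rfl, trivial⟩) (iff_of_true trivial ⟨fun _ => not_not.1 hc, fun h => absurd hs h⟩))⟩⟩,
          fun hs => ⟨fun hc => ⟨by simp [isPred, isOrJob, succOf, Test.cost, Exp.cost],
            ht _ (hadd _ False (Or.inr ⟨rfl, not_false⟩) (iff_of_false not_false fun h =>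
              hc.2.elim (fun h1 => h1 (h.2 hs hc.1).1) fun h1 => h1 (h.2 hs hc.1).2))⟩,
          fun hc => ⟨by simp [isPred, isOrJob, succOf, Test.cost, Exp.cost],
            ht' (hadd _ True (Or.inl ⟨rfl, trivial⟩) (iff_of_true trivial ⟨fun h => absurd h hs, fun _ hp =>
              ⟨not_not.1 fun h1 => hc ⟨hp, Or.inl h1⟩,
                not_not.1 fun h1 => hc ⟨hp, Or.inr h1⟩⟩⟩))⟩⟩⟩
      · intro t s₂ ht hF₂ hr₂ hI₂
        have hrI : s₂.reg rI = i := by rw [hF₂.reg rI rfl, ← hr]; simp +decide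
        have hrR : s₂.reg rRep = s₁.reg rRep := by rw [hF₂.reg rRep rfl]; simp +decide
        simp only [Test.cost, Exp.cost] at ht ⊢
        simp +decide only [hI₂, wp_when, wp_set, Test.Holds, Exp.eval, Test.cost, Exp.cost, hrI,
          State.reg_setReg_of_ne, State.reg_setReg_self, hrR]
        exact ⟨fun hm => ⟨by omega, hstep _ (Or.inr ⟨rfl, hns, hm⟩)⟩,
          fun hm => ⟨by omega, hstep _ (Or.inl ⟨rfl, fun h => hm h.2⟩)⟩⟩
    · rw [State.reg_setReg_of_ne _ _ (by decide)]
      exact hstep _ (Or.inl ⟨rfl, fun h => hns h.1⟩)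
  · intro t s₁ ht hF hr hI
    rw [wp_block_nil]
    refine ⟨?_, hI⟩
    simp only [Exp.cost] at ht
    nlinarith

end
end AndOrSched

namespace AndOrSched

open Finset
section

/-! ### Choosing representatives: the exchange argument -/

variable {X : Ctx} {s : State}

/-- Two jobs are predecessors of the same and-jobs and of the same or-jobs that do not come before
successor `l`. -/
def Similar (X : Ctx) (τ : ℕ → ℕ) (l i i' : ℕ) : Prop :=
  ∀ l' < X.k, ¬ X.isOr (X.su l') ∨ ¬ Before τ l' l → (X.pred i (X.su l') ↔ X.pred i' (X.su l'))

/-- `D` is a schedule that agrees with `E` on the successors and respects the representatives that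
have been chosen so far, and every other or-job has a predecessor similar to `f`. -/
structure Witness (X : Ctx) (τ f E rep D : ℕ → ℕ) : Prop where
  pos : ∀ i < X.n, 1 ≤ D i
  load_le : ∀ t, X.load D t ≤ X.m
  eq : ∀ j, X.isS j → D j = E j
  and_lt : ∀ l < X.k, ¬ X.isOr (X.su l) → ∀ i < X.n, X.pred i (X.su l) → D i < D (X.su l)
  rep_lt : ∀ l < X.k, X.isOr (X.su l) → rep l ≠ X.n → D (rep l) < D (X.su l)
  exists_similar : ∀ l < X.k, X.isOr (X.su l) → rep l = X.n →
    ∃ w < X.n, ¬ X.isS w ∧ Similar X τ l w (f l) ∧ D w < D (X.su l)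
  not_pred : ∀ l < X.k, X.isOr (X.su l) → rep l ≠ X.n → ¬ X.isS (rep l) →
    ∀ l' < X.k, X.isOr (X.su l') → rep l' = X.n → ¬ X.pred (rep l) (X.su l')

/-- The family of sets `S` belongs to the choice `f` of predecessors. -/
def FamilyOf (X : Ctx) (τ f : ℕ → ℕ) (S : ℕ → Prop) (l : ℕ) : Prop :=
  X.pred (f l) (X.su l) ∧ ∀ l' < X.k,
    (S l' ↔ X.pred (f l) (X.su l') ∧ (¬ X.isOr (X.su l') ∨ ¬ Before τ l' l))

/-- The set records exactly the incidences of `f` with and-jobs and with or-jobs not before the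
current one. On these jobs a match must agree with the set, and on earlier or-jobs it is
unrestricted. -/
theorem isMatch_iff_similar {τ ord f : ℕ → ℕ} {S : ℕ → Prop} {p i : ℕ} (hs : Sorted X τ ord)
    (hp : p < X.k) (hS : FamilyOf X τ f S (ord p)) :
    IsMatch X ord S p i ↔ ¬ X.isS i ∧ Similar X τ (ord p) i (f (ord p)) := by
  refine and_congr_right fun _ => ⟨fun h l' hl' hc => ?_, fun h p' hp' => ?_⟩
  · obtain ⟨p', hp', rfl⟩ := hs.surj l' hl'
    have h1 := h p' hp'
    have h2 := hS.2 _ hl'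
    have h3 := hs.not_before_iff hp hp'
    by_cases hm : S (ord p')
    · exact iff_of_true (h1.1 hm) (h2.1 hm).1
    · refine iff_of_false (fun hpr => ?_) (fun hpr => hm (h2.2 ⟨hpr, hc⟩))
      obtain ⟨ho, hlt⟩ := h1.2 hm hpr
      rcases hc with hc | hc
      · exact hc ho
      · exact absurd (h3.1 hc) (not_le.2 hlt)
  · have hl' := hs.lt p' hp'
    have h2 := hS.2 _ hl'
    have h3 := hs.not_before_iff hp hp'
    refine ⟨fun hm => (h _ hl' (h2.1 hm).2).2 (h2.1 hm).1, fun hm hpr => ?_⟩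
    by_contra hc
    have hc' : ¬ X.isOr (X.su (ord p')) ∨ ¬ Before τ (ord p') (ord p) := by
      rw [h3]
      by_contra! h4
      exact hc h4
    exact hm (h2.2 ⟨(h _ hl' hc').1 hpr, hc'⟩)

/-- Exchanging the predecessor used in `D` with the representative found by the algorithm. -/
theorem Witness.step {τ f E rep D rep' : ℕ → ℕ} (hD : Witness X τ f E rep D) {l r sh : ℕ}
    (hl : l < X.k) (ho : X.isOr (X.su l)) (hrep : rep l = X.n)
    (hτ : ∀ l < X.k, E (X.su l) = τ l + sh)
    (hfl : X.pred (f l) (X.su l)) (hr : r < X.n) (hrs : ¬ X.isS r)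
    (hsim : Similar X τ l r (f l))
    (hlate : ∀ l' < X.k, X.isOr (X.su l') → rep l' = X.n → ¬ Before τ l' l)
    (hnew : ∀ l' < X.k, X.isOr (X.su l') → rep l' = X.n → X.pred r (X.su l') → rep' l' = r)
    (hold : ∀ l' < X.k, ¬ (X.isOr (X.su l') ∧ rep l' = X.n ∧ X.pred r (X.su l')) →
      rep' l' = rep l') :
    ∃ D', Witness X τ f E rep' D' := by
  -- The free predecessor that `D` currently uses for `l`. Earlier exchanges may have displaced `f
  -- l`, but `w` is still similar to it, and hence to `r`; the new schedule swaps `r` and `w`.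
  obtain ⟨w, hw, hws, hwsim, hwlt⟩ := hD.exists_similar l hl ho hrep
  have hnb : ¬ Before τ l l := by simp [Before]
  have hrw : Similar X τ l r w := fun l' hl' hc =>
    (hsim l' hl' hc).trans (hwsim l' hl' hc).symm
  have hpr : X.pred r (X.su l) := (hsim l hl (Or.inr hnb)).2 hfl
  have hpw : X.pred w (X.su l) := (hwsim l hl (Or.inr hnb)).2 hfl
  have hσ : ∀ x, X.isS x → Equiv.swap r w x = x := fun x hx =>
    Equiv.swap_apply_of_ne_of_ne (by rintro rfl; exact hrs hx) (by rintro rfl; exact hws hx)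
  have hrange : ∀ i < X.n, Equiv.swap r w i < X.n := by
    intro i hi
    rw [Equiv.swap_apply_def]
    split_ifs <;> assumption
  have hσpred : ∀ i l', l' < X.k → ¬ X.isOr (X.su l') ∨ ¬ Before τ l' l →
      (X.pred (Equiv.swap r w i) (X.su l') ↔ X.pred i (X.su l')) := by
    intro i l' hl' hc
    rw [Equiv.swap_apply_def]
    split_ifs with h1 h2
    · rw [h1]; exact (hrw l' hl' hc).symm
    · rw [h2]; exact hrw l' hl' hc
    · rfl
  have hn : r ≠ X.n := hr.ne
  have hcase : ∀ l' < X.k, X.isOr (X.su l') →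
      (rep l' = X.n ∧ X.pred r (X.su l') ∧ rep' l' = r) ∨
      (¬ (rep l' = X.n ∧ X.pred r (X.su l')) ∧ rep' l' = rep l') := by
    intro l' hl' ho'
    by_cases h : rep l' = X.n ∧ X.pred r (X.su l')
    · exact Or.inl ⟨h.1, h.2, hnew l' hl' ho' h.1 h.2⟩
    · exact Or.inr ⟨h, hold l' hl' fun h' => h h'.2⟩
  refine ⟨fun i => D (Equiv.swap r w i), fun i hi => hD.pos _ (hrange i hi), fun t => ?_, ?_, ?_,
    ?_, ?_, ?_⟩
  · rw [Ctx.load_swap hr hw]; exact hD.load_le t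
  · intro j hj
    rw [hσ j hj]; exact hD.eq j hj
  · intro l' hl' ho' i hi hp
    rw [hσ _ (Ctx.isS_su hl')]
    exact hD.and_lt l' hl' ho' _ (hrange i hi) ((hσpred i l' hl' (Or.inl ho')).2 hp)
  · intro l' hl' ho' hne
    rw [hσ _ (Ctx.isS_su hl')]
    rcases hcase l' hl' ho' with ⟨h1, h2, h3⟩ | ⟨h1, h2⟩
    · rw [h3, Equiv.swap_apply_left]
      have h4 := hlate l' hl' ho' h1
      -- After the swap `r` takes the slot of `w`, before `l`; the newly served or-jobs are not
      -- before `l` and so complete no earlier than `l`.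
      rw [hD.eq _ (Ctx.isS_su hl), hτ l hl] at hwlt
      rw [hD.eq _ (Ctx.isS_su hl'), hτ l' hl']
      simp only [Before] at h4
      omega
    · rw [h2] at hne ⊢
      -- A free representative chosen earlier is not a predecessor of the unserved job `l`, whereas
      -- `r` and `w` both are; so the swap does not touch it.
      have h4 : Equiv.swap r w (rep l') = rep l' := by
        by_cases hs : X.isS (rep l')
        · exact hσ _ hs
        · have h5 := hD.not_pred l' hl' ho' hne hs l hl ho hrep
          exact Equiv.swap_apply_of_ne_of_ne (by rintro h; rw [h] at h5; exact h5 hpr)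
            (by rintro h; rw [h] at h5; exact h5 hpw)
      rw [h4]
      exact hD.rep_lt l' hl' ho' hne
  · intro l' hl' ho' he
    rw [hσ _ (Ctx.isS_su hl')]
    rcases hcase l' hl' ho' with ⟨h1, h2, h3⟩ | ⟨h1, h2⟩
    · exact absurd (h3.symm.trans he) hn
    · rw [h2] at he
      obtain ⟨w', hw', hws', hwsim', hwlt'⟩ := hD.exists_similar l' hl' ho' he
      refine ⟨Equiv.swap r w w', hrange _ hw', ?_, ?_, by simpa using hwlt'⟩
      · rw [Equiv.swap_apply_def]
        split_ifs <;> assumption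
      · intro l₂ hl₂ hc
        rw [hσpred w' l₂ hl₂ ?_]
        · exact hwsim' l₂ hl₂ hc
        · have h4 := hlate l' hl' ho' he
          refine hc.imp_right fun h5 h6 => h5 ?_
          simp only [Before] at h4 h6 ⊢
          omega
  · intro l₁ hl₁ ho₁ hne hs l₂ hl₂ ho₂ he
    rcases hcase l₂ hl₂ ho₂ with ⟨-, -, h3⟩ | ⟨h1, h2⟩
    · exact absurd (h3.symm.trans he) hn
    · rw [h2] at he
      rcases hcase l₁ hl₁ ho₁ with ⟨-, -, h3⟩ | ⟨-, h3⟩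
      · rw [h3]; exact fun h => h1 ⟨he, h⟩
      · rw [h3] at hne hs ⊢
        exact hD.not_pred l₁ hl₁ ho₁ hne hs l₂ hl₂ ho₂ he

theorem Sorted.inj {τ ord : ℕ → ℕ} (h : Sorted X τ ord) {p q : ℕ} (hp : p < X.k) (hq : q < X.k)
    (e : ord p = ord q) : p = q := by
  have h1 := (h.not_before_iff hp hq).1 (by rw [e]; simp [Before])
  have h2 := (h.not_before_iff hq hp).1 (by rw [e]; simp [Before])
  omega

/-- The loop that assigns the representative `r` to the later or-jobs of which it is a predecessor. -/
theorem assignRepresentative_spec (hE : Env X s) {τ : ℕ → ℕ} (hs : Sorted X τ (s.arr aOrd))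
    (hr : s.reg rRep < X.n) :
    wp (.forLt rP' (.reg rK) (.block [
          .set rL' (.get aOrd (.reg rP')),
          .when (.and (.not (.lt (.reg rP') (.reg rP)))
              (.and (isOrJob (succOf rL'))
                (.and (.eq (.get aRep (.reg rL')) (.reg rN)) (isPred (.reg rRep) (succOf rL')))))
            (.store aRep (.reg rL') (.reg rRep))])) s fun t s' => t ≤ 100 * X.k + 100 ∧
      ∀ q < X.k,
        (s.reg rP ≤ q ∧ X.isOr (X.su (s.arr aOrd q)) ∧ s.arr aRep (s.arr aOrd q) = X.n ∧
          X.pred (s.reg rRep) (X.su (s.arr aOrd q)) → s'.arr aRep (s.arr aOrd q) = s.reg rRep) ∧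
        (¬ (s.reg rP ≤ q ∧ X.isOr (X.su (s.arr aOrd q)) ∧ s.arr aRep (s.arr aOrd q) = X.n ∧
          X.pred (s.reg rRep) (X.su (s.arr aOrd q))) →
          s'.arr aRep (s.arr aOrd q) = s.arr aRep (s.arr aOrd q)) := by
  set ord := s.arr aOrd with hord
  set r := s.reg rRep with hrr
  let c : ℕ → Prop := fun q => s.reg rP ≤ q ∧ X.isOr (X.su (ord q)) ∧
    s.arr aRep (ord q) = X.n ∧ X.pred r (X.su (ord q))
  refine wp_forLt X.k 60 (fun P s' => ∀ q < X.k,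
    (q < P ∧ c q → s'.arr aRep (ord q) = r) ∧
    (¬ (q < P ∧ c q) → s'.arr aRep (ord q) = s.arr aRep (ord q))) rfl ?_ ?_ ?_ ?_
  · intro s' hF
    simp +decide [Exp.eval, hF.reg rK rfl, hE.k]
  · simp
  · intro P s₁ hP hF hr₁ hI
    have hE₁ : Env X s₁ := hE.frame hF rfl
    have ho₁ : s₁.arr aOrd = ord := hF.arr aOrd rfl
    have hR₁ : s₁.reg rRep = r := hF.reg rRep rfl
    have hP₁ : s₁.reg rP = s.reg rP := hF.reg rP rfl
    have hl' := hs.lt P hP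
    have hsu := Ctx.su_lt hl'
    have hrep : s₁.arr aRep (ord P) = s.arr aRep (ord P) := (hI P hP).2 (by omega)
    rw [wp_block_cons, wp_set]
    simp only [Exp.eval, hr₁, ho₁, wp_block_cons, wp_block_nil]
    have hE₂ : Env X (s₁.setReg rL' (ord P)) := by simpa +decide using hE₁
    have hj : (succOf rL').eval (s₁.setReg rL' (ord P)) = X.su (ord P) := by
      simp +decide [succOf, Exp.eval, hE₁.succ _ hl']
    have hp := hE₂.isPred_iff (i := .reg rRep) (j := succOf rL')
      (by simpa +decide [Exp.eval, hR₁] using hr) (by rwa [hj])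
    have ho := hE₂.isOrJob_iff (j := succOf rL') (by rwa [hj])
    rw [hj] at hp ho
    have hb : (Test.and (.not (.lt (.reg rP') (.reg rP)))
              (.and (isOrJob (succOf rL'))
                (.and (.eq (.get aRep (.reg rL')) (.reg rN))
                  (isPred (.reg rRep) (succOf rL'))))).Holds (s₁.setReg rL' (ord P)) ↔ c P := by
      simp only [Test.Holds, ho, hp]
      simp +decide [Exp.eval, hr₁, hP₁, hE₁.n, hrep, hR₁, c]
    simp only [wp_when, hb, wp_store, Exp.eval]
    refine ⟨fun hc => ⟨by simp [isPred, isOrJob, succOf, Test.cost, Exp.cost], fun q hq => ?_⟩,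
      fun hc => ⟨by simp [isPred, isOrJob, succOf, Test.cost, Exp.cost], fun q hq => ?_⟩⟩
    · simp +decide only [State.arr_setReg, State.arr_setArr_self, State.reg_setReg_self,
        State.reg_setReg_of_ne, hR₁]
      by_cases he : q = P
      · subst he
        rw [Function.update_self]
        exact ⟨fun _ => rfl, fun h => absurd ⟨by omega, hc⟩ h⟩
      · have hne : ord q ≠ ord P := fun h => he (hs.inj hq hP h)
        rw [Function.update_of_ne hne]
        refine ⟨fun h => (hI q hq).1 ⟨by omega, h.2⟩, fun h => (hI q hq).2 fun h' => h ⟨by omega, h'.2⟩⟩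
    · simp only [State.arr_setReg]
      refine ⟨fun h => (hI q hq).1 ⟨?_, h.2⟩, fun h => (hI q hq).2 fun h' => h ⟨by omega, h'.2⟩⟩
      have : q ≠ P := by rintro rfl; exact hc h.2
      omega
  · intro t s₁ ht hF _ hI
    refine ⟨by simp only [Exp.cost] at ht; omega, fun q hq => ⟨fun h => (hI q hq).1 ⟨hq, h⟩,
      fun h => (hI q hq).2 fun h' => h h'.2⟩⟩

/-- Soundness is unconditional: chosen representatives are predecessors, and the flag survives only
if none is missing. Completeness is stated as an implication for the choice of sets that belongs to
`f`, so one execution serves both purposes. -/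
theorem chooseRepresentatives_spec (hE : Env X s) {τ f E : ℕ → ℕ} {sh : ℕ}
    (hs : Sorted X τ (s.arr aOrd))
    (hdiag : ∀ l < X.k, s.arr aSel (l * X.n + l) = 1)
    (hrep : ∀ l < X.k, X.isOr (X.su l) →
      s.arr aRep l = X.n ∨ s.arr aRep l < X.n ∧ X.pred (s.arr aRep l) (X.su l)) :
    wp chooseRepresentatives s fun t s' =>
      t ≤ X.k * (100 * (X.n * X.k) + 100 * X.n + 100 * X.k + 300) + 100 ∧
      (∀ l < X.k, X.isOr (X.su l) →
        s'.arr aRep l = X.n ∨ s'.arr aRep l < X.n ∧ X.pred (s'.arr aRep l) (X.su l)) ∧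
      (s'.reg rOk = 1 → s.reg rOk = 1 ∧ ∀ l < X.k, X.isOr (X.su l) → s'.arr aRep l ≠ X.n) ∧
      ((∀ l < X.k, E (X.su l) = τ l + sh) →
        (∀ l < X.k, X.isOr (X.su l) → s.arr aRep l = X.n →
          FamilyOf X τ f (fun l' => s.arr aSel (l * X.n + l') = 1) l) →
        (∃ D, Witness X τ f E (s.arr aRep) D) → s.reg rOk = 1 →
        s'.reg rOk = 1 ∧ ∃ D, Witness X τ f E (s'.arr aRep) D) := by
  have hk := X.k_le
  rw [chooseRepresentatives]
  refine wp_forLt X.k (100 * (X.n * X.k) + 100 * X.n + 100 * X.k + 280) (fun P s' =>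
      (∀ l < X.k, X.isOr (X.su l) →
        s'.arr aRep l = X.n ∨ s'.arr aRep l < X.n ∧ X.pred (s'.arr aRep l) (X.su l)) ∧
      (s'.reg rOk = 1 → s.reg rOk = 1 ∧
        ∀ p < P, X.isOr (X.su (s.arr aOrd p)) → s'.arr aRep (s.arr aOrd p) ≠ X.n) ∧
      -- The assumption on the sets concerns the or-jobs unserved at the start; this clause makes it
      -- applicable to those still unserved.
      (∀ l < X.k, s'.arr aRep l = X.n → s.arr aRep l = X.n) ∧
      ((∀ l < X.k, E (X.su l) = τ l + sh) →
        (∀ l < X.k, X.isOr (X.su l) → s.arr aRep l = X.n →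
          FamilyOf X τ f (fun l' => s.arr aSel (l * X.n + l') = 1) l) →
        (∃ D, Witness X τ f E (s.arr aRep) D) → s.reg rOk = 1 →
        s'.reg rOk = 1 ∧ ∃ D, Witness X τ f E (s'.arr aRep) D)) rfl ?_ ?_ ?_ ?_
  · intro s' hF
    simp +decide [Exp.eval, hF.reg rK rfl, hE.k]
  · simp +decide only [State.arr_setReg, State.reg_setReg_of_ne, Nat.not_lt_zero]
    exact ⟨hrep, fun h => ⟨h, fun _ hp => hp.elim⟩, fun _ _ h => h,
      fun _ _ h h' => ⟨h', h⟩⟩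
  · rintro P s₁ hP hF hr ⟨h1, h2, h3, h4⟩
    have hE₁ : Env X s₁ := hE.frame hF rfl
    have ho₁ : s₁.arr aOrd = s.arr aOrd := hF.arr aOrd rfl
    have hse₁ : s₁.arr aSel = s.arr aSel := hF.arr aSel rfl
    set ord := s.arr aOrd with hord
    have hl := hs.lt P hP
    have hsu := Ctx.su_lt hl
    rw [wp_block_cons, wp_set]
    simp only [Exp.eval, hr, ho₁, wp_block_cons, wp_block_nil]
    have hE₂ : Env X (s₁.setReg rL (ord P)) := by simpa +decide using hE₁
    have hj : (succOf rL).eval (s₁.setReg rL (ord P)) = X.su (ord P) := by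
      simp +decide [succOf, Exp.eval, hE₁.succ _ hl]
    have ho := hE₂.isOrJob_iff (j := succOf rL) (by rwa [hj])
    rw [hj] at ho
    have hb : (Test.and (isOrJob (succOf rL)) (.eq (.get aRep (.reg rL)) (.reg rN))).Holds
        (s₁.setReg rL (ord P)) ↔ X.isOr (X.su (ord P)) ∧ s₁.arr aRep (ord P) = X.n := by
      simp only [Test.Holds, ho]
      simp +decide [Exp.eval, hE₁.n]
    have hcost : (Test.and (isOrJob (succOf rL)) (.eq (.get aRep (.reg rL)) (.reg rN))).cost =
      10 := rfl
    simp only [wp_when, hb, hcost]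
    have hP₂ : (s₁.setReg rL (ord P)).reg rP = P := by simpa +decide using hr
    have hL₂ : (s₁.setReg rL (ord P)).reg rL = ord P := by simp
    set s₂ := s₁.setReg rL (ord P) with hs₂
    have hA₂ : s₂.arr = s₁.arr := rfl
    have hO₂ : s₂.reg rOk = s₁.reg rOk := by simp +decide [hs₂]
    refine ⟨fun hc => ?_, fun hc => ⟨by simp only [Exp.cost]; omega, ?_⟩⟩
    · rw [wp_block_cons]
      refine (searchRepresentative_spec hE₂ (by rwa [hP₂]) (by rwa [hL₂])
        (by rw [hA₂, ho₁]; exact hs.lt) (fun l' => s.arr aSel (ord P * X.n + l') = 1)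
        (by rw [hL₂, hA₂, hse₁]; exact fun _ _ => Iff.rfl)).conseq ?_
      rintro t₃ s₃ hF₃ ⟨ht₃, hsearch⟩
      have hE₃ := hE₂.frame hF₃ rfl
      rw [hA₂, ho₁, hP₂] at hsearch
      have hrep₃ : s₃.arr aRep = s₁.arr aRep := by rw [hF₃.arr aRep rfl, hA₂]
      have hord₃ : s₃.arr aOrd = ord := by rw [hF₃.arr aOrd rfl, hA₂, ho₁]
      have hO₃ : s₃.reg rOk = s₁.reg rOk := by rw [hF₃.reg rOk rfl, hO₂]
      have hP₃ : s₃.reg rP = P := by rw [hF₃.reg rP rfl, hP₂]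
      have hT : (Test.eq (.reg rRep) (.reg rN)).Holds s₃ ↔ s₃.reg rRep = X.n := by
        simp [Test.Holds, Exp.eval, hE₃.n]
      simp only [wp_block_cons, wp_block_nil, wp_ite, hT, wp_set, Exp.eval]
      refine ⟨fun hn => ⟨?_, ?_⟩, fun hn => ?_⟩
      · simp only [Exp.cost, Test.cost]
        nlinarith
      · simp +decide only [State.arr_setReg, State.reg_setReg_of_ne, State.reg_setReg_self, hrep₃]
        refine ⟨h1, by simp, h3, fun hτ hfam hw hok => ?_⟩
        obtain ⟨-, D, hD⟩ := h4 hτ hfam hw hok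
        -- The search cannot fail at the target choice, because the predecessor used by the witness
        -- is itself a match.
        obtain ⟨w, hw, hws, hwsim, -⟩ := hD.exists_similar _ hl hc.1 hc.2
        have hm := (isMatch_iff_similar (i := w) hs hP
          (hfam _ hl hc.1 (h3 _ hl hc.2))).2 ⟨hws, hwsim⟩
        rcases hsearch with h | h
        · exact absurd hm (h.2 w hw)
        · exact absurd hn h.1.ne
      · obtain ⟨hrn, hm⟩ := hsearch.resolve_left fun h => hn h.1
        refine (assignRepresentative_spec hE₃ (τ := τ) (by rw [hord₃]; exact hs) hrn).conseq ?_
        rintro t₄ s₄ hF₄ ⟨ht₄, hass⟩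
        have hO₄ : s₄.reg rOk = s₁.reg rOk := by rw [hF₄.reg rOk rfl, hO₃]
        rw [hord₃, hrep₃, hP₃] at hass
        set r := s₃.reg rRep with hrdef
        -- Membership of every job in its own set guarantees that a match is a predecessor of the
        -- job it is sought for.
        have hpr : X.pred r (X.su (ord P)) := (hm.2 P hP).1 (hdiag _ hl)
        have hA₄ : (s₄.setReg rP (P + 1)).arr = s₄.arr := rfl
        have hO₅ : (s₄.setReg rP (P + 1)).reg rOk = s₁.reg rOk := by simpa +decide using hO₄
        rw [hA₄, hO₅]
        have hcases : ∀ q < X.k, s₄.arr aRep (ord q) = s₁.arr aRep (ord q) ∨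
            s₁.arr aRep (ord q) = X.n ∧ s₄.arr aRep (ord q) = r ∧ X.pred r (X.su (ord q)) := by
          intro q hq
          by_cases h : P ≤ q ∧ X.isOr (X.su (ord q)) ∧ s₁.arr aRep (ord q) = X.n ∧
              X.pred r (X.su (ord q))
          · exact Or.inr ⟨h.2.2.1, (hass q hq).1 h, h.2.2.2⟩
          · exact Or.inl ((hass q hq).2 h)
        refine ⟨?_, ?_, ?_, ?_, ?_⟩
        · simp only [Exp.cost, Test.cost]
          omega
        · intro l' hl' ho'
          obtain ⟨q, hq, rfl⟩ := hs.surj l' hl'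
          rcases hcases q hq with h | ⟨-, h, h'⟩
          · rw [h]; exact h1 _ hl' ho'
          · rw [h]; exact Or.inr ⟨hrn, h'⟩
        · intro hok
          refine ⟨(h2 hok).1, fun p hp ho' => ?_⟩
          rcases hcases p (by omega) with h | ⟨-, h, -⟩
          · by_cases he : p = P
            · subst he
              rw [(hass p hP).1 ⟨le_rfl, hc.1, hc.2, hpr⟩]
              exact hn
            · rw [h]; exact (h2 hok).2 p (by omega) ho'
          · rw [h]; exact hn
        · intro l' hl' he
          obtain ⟨q, hq, rfl⟩ := hs.surj l' hl'
          rcases hcases q hq with h | ⟨h, -, -⟩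
          · exact h3 _ hl' (h ▸ he)
          · exact h3 _ hl' h
        · intro hτ hfam hw hok
          obtain ⟨hok₁, D, hD⟩ := h4 hτ hfam hw hok
          have hf := hfam _ hl hc.1 (h3 _ hl hc.2)
          -- With the flag still 1, all or-jobs at earlier positions have been served.
          have hlate : ∀ q < X.k, X.isOr (X.su (ord q)) → s₁.arr aRep (ord q) = X.n → P ≤ q := by
            intro q hq ho' he
            by_contra! hlt
            exact (h2 hok₁).2 q hlt ho' he
          refine ⟨hok₁, hD.step hl hc.1 hc.2 hτ hf.1 hrn hm.1 ((isMatch_iff_similar hs hP hf).1 hm).2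
            ?_ ?_ ?_⟩
          · intro l' hl' ho' he
            obtain ⟨q, hq, rfl⟩ := hs.surj l' hl'
            exact (hs.not_before_iff hP hq).2 (hlate q hq ho' he)
          · intro l' hl' ho' he hp'
            obtain ⟨q, hq, rfl⟩ := hs.surj l' hl'
            exact (hass q hq).1 ⟨hlate q hq ho' he, ho', he, hp'⟩
          · intro l' hl' h
            obtain ⟨q, hq, rfl⟩ := hs.surj l' hl'
            exact (hass q hq).2 fun h' => h h'.2
    · have hO₅ : (s₂.setReg rP (P + 1)).reg rOk = s₁.reg rOk := by simpa +decide using hO₂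
      rw [hO₅, State.arr_setReg, hA₂]
      refine ⟨h1, fun hok => ⟨(h2 hok).1, fun p hp ho' => ?_⟩, h3, h4⟩
      by_cases he : p = P
      · subst he; exact fun h => hc ⟨ho', h⟩
      · exact (h2 hok).2 p (by omega) ho'
  · rintro t s₁ ht hF _ ⟨h1, h2, -, h4⟩
    refine ⟨?_, h1, fun hok => ⟨(h2 hok).1, fun l hl ho => ?_⟩, h4⟩
    · simp only [Exp.cost] at ht
      generalize 100 * (X.n * X.k) + 100 * X.n + 100 * X.k = Y at ht ⊢
      linarith
    · obtain ⟨p, hp, rfl⟩ := hs.surj l hl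
      exact (h2 hok).2 p hp ho

end
end AndOrSched

namespace AndOrSched

open Finset
section

/-! ### Insertion of the free jobs in order of their deadlines -/

variable {X : Ctx} {s : State}

/-- While a job is unplaced, a slot in `1, ..., n` has an idle machine; this bounds the scan by `n`
and makes all slots it skips full. -/
theorem placeJob_spec (hE : Env X s) (hI : s.reg rI < X.n) (hcnt : CntOK X s) (hm : 1 ≤ X.m) :
    wp placeJob s fun t s' => t ≤ 30 * X.n + 60 ∧ CntOK X s' ∧
      (s.arr aC (s.reg rI) ≠ 0 ∧ s'.arr aC = s.arr aC ∨
        s.arr aC (s.reg rI) = 0 ∧ ∃ T, 1 ≤ T ∧ T ≤ X.n ∧ X.load (s.arr aC) T < X.m ∧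
          (∀ u, 1 ≤ u → u < T → X.m ≤ X.load (s.arr aC) u) ∧
          s'.arr aC = Function.update (s.arr aC) (s.reg rI) T) := by
  rw [placeJob, wp_when]
  simp only [Test.Holds, Test.cost, Exp.eval, Exp.cost]
  refine ⟨fun h0 => ?_, fun h0 => ⟨by omega, hcnt, Or.inl ⟨h0, trivial⟩⟩⟩
  obtain ⟨T₀, h1, h2, h3⟩ := Ctx.exists_idle hI h0 hm
  rw [wp_block_cons, wp_set, wp_block_cons]
  refine wp_loop (fun s' => X.n - s'.reg rT) 10 (fun s' => 1 ≤ s'.reg rT ∧ s'.reg rT ≤ T₀ ∧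
    ∀ u, 1 ≤ u → u < s'.reg rT → X.m ≤ X.load (s.arr aC) u) ?_ ?_ ?_
  · simp only [Exp.eval, State.reg_setReg_self]
    exact ⟨le_rfl, h1, fun u _ _ => by omega⟩
  · rintro s₁ hF ⟨ha, hb, hc⟩ hT
    have hcn : s₁.arr aCnt = s.arr aCnt := by rw [hF.arr aCnt rfl]; rfl
    have hM : s₁.reg rM = X.m := by
      rw [hF.reg rM rfl, State.reg_setReg_of_ne _ _ (by decide), hE.m]
    have hfull : X.m ≤ X.load (s.arr aC) (s₁.reg rT) := by
      rw [← hcnt _ ha (by omega)]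
      simpa [Test.Holds, Exp.eval, hcn, hM] using hT
    have hne : s₁.reg rT ≠ T₀ := by intro h; rw [h] at hfull; omega
    rw [wp_set]
    simp only [Exp.eval, Exp.cost, State.reg_setReg_self]
    refine ⟨by omega, ⟨by omega, by omega, fun u hu hlt => ?_⟩, by omega⟩
    by_cases h : u = s₁.reg rT
    · rw [h]; exact hfull
    · exact hc u hu (by omega)
  · rintro t s₁ ht hF ⟨ha, hb, hc⟩ hT
    have hcn : s₁.arr aCnt = s.arr aCnt := by rw [hF.arr aCnt rfl]; rfl
    have hC : s₁.arr aC = s.arr aC := by rw [hF.arr aC rfl]; rfl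
    have hrI : s₁.reg rI = s.reg rI := by
      rw [hF.reg rI rfl, State.reg_setReg_of_ne _ _ (by decide)]
    have hM : s₁.reg rM = X.m := by
      rw [hF.reg rM rfl, State.reg_setReg_of_ne _ _ (by decide), hE.m]
    have hidle : X.load (s.arr aC) (s₁.reg rT) < X.m := by
      rw [← hcnt _ ha (by omega)]
      simpa [Test.Holds, Exp.eval, hcn, hM] using hT
    simp +decide only [wp_block_cons, wp_block_nil, wp_store, wp_incArr, Exp.eval, Exp.cost,
      State.reg_setArr, State.arr_setArr_of_ne, State.arr_setArr_self, hcn, hC, hrI, CntOK]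
    refine ⟨?_, ?_, Or.inr ⟨h0, _, ha, by omega, hidle, hc, rfl⟩⟩
    · simp only [Exp.eval, Exp.cost, Test.cost, State.reg_setReg_self] at ht
      omega
    · intro u hu hun
      rw [Ctx.load_update hI h0 hu]
      by_cases h : u = s₁.reg rT
      · rw [h, Function.update_self, if_pos rfl, hcnt _ ha (by omega)]
      · rw [Function.update_of_ne h, if_neg h, hcnt u hu hun, Nat.add_zero]

/-- `C` arises from `C₀` by placing jobs with trivial constraint as early as possible. -/
structure Partial (X : Ctx) (C₀ C : ℕ → ℕ) : Prop where
  keep : ∀ x, X.isS x → C x = C₀ x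
  le : ∀ x < X.n, C x ≤ X.n
  load_le : (∀ t, 1 ≤ t → t ≤ X.n → X.load C₀ t ≤ X.m) →
    ∀ t, 1 ≤ t → t ≤ X.n → X.load C t ≤ X.m
  full : ∀ x < X.n, ¬ X.isS x → ∀ u, 1 ≤ u → u < C x → X.m ≤ X.load C u

/-- Placing a job never lowers a load, so slots that were full remain full. Successors are never
moved since they are already placed. -/
theorem Partial.place {C₀ C : ℕ → ℕ} (h : Partial X C₀ C) (hpos : ∀ x, X.isS x → C₀ x ≠ 0)
    {i T : ℕ} (hi : i < X.n) (h0 : C i = 0) (hTn : T ≤ X.n) (hT : X.load C T < X.m)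
    (hfull : ∀ u, 1 ≤ u → u < T → X.m ≤ X.load C u) : Partial X C₀ (Function.update C i T) where
  keep x hx := by
    have : x ≠ i := by rintro rfl; exact hpos x hx ((h.keep x hx).symm.trans h0)
    rw [Function.update_of_ne this, h.keep x hx]
  le x hx := by
    by_cases he : x = i
    · rw [he, Function.update_self]; exact hTn
    · rw [Function.update_of_ne he]; exact h.le x hx
  load_le hl t ht htn := by
    rw [Ctx.load_update hi h0 ht]
    split_ifs with he
    · rw [he]; omega
    · exact h.load_le hl t ht htn
  full x hx hs u hu hlt := by
    refine le_trans ?_ (Ctx.load_le_load_update hi h0 hu)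
    by_cases he : x = i
    · rw [he, Function.update_self] at hlt
      exact hfull u hu hlt
    · rw [Function.update_of_ne he] at hlt
      exact h.full x hx hs u hu hlt

/-- Job `i` has to precede the `l`-th successor in the and-variation. -/
def Required (X : Ctx) (rep : ℕ → ℕ) (l i : ℕ) : Prop :=
  X.isOr (X.su l) ∧ rep l = i ∨ ¬ X.isOr (X.su l) ∧ X.pred i (X.su l)

/-- The invariant of the insertion of the predecessors of successors. Here `C₀` are the
completion times and `ok` the flag at the beginning, `D` is a feasible schedule of the
and-variation, and the predecessors `x` of the successors at the positions `p` with `R p x` have been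
treated. -/
structure InsertInv (X : Ctx) (C₀ ord rep D : ℕ → ℕ) (H : Prop) (ok : ℕ) (R : ℕ → ℕ → Prop) (P : ℕ)
    (s : State) : Prop where
  cnt : CntOK X s
  part : Partial X C₀ (s.arr aC)
  sound : s.reg rOk = 1 → ok = 1 ∧ ∀ p < X.k, ∀ x < X.n, R p x → Required X rep (ord p) x →
    s.arr aC x ≠ 0 ∧ s.arr aC x < C₀ (X.su (ord p))
  complete : H → ok = 1 → s.reg rOk = 1 ∧ ∀ x < X.n, ¬ X.isS x → s.arr aC x ≠ 0 →
    ∃ p < P, D x < C₀ (X.su (ord p)) ∧ s.arr aC x < C₀ (X.su (ord p))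

theorem InsertInv.mono {C₀ ord rep D : ℕ → ℕ} {H : Prop} {ok P P' : ℕ} {R R' : ℕ → ℕ → Prop}
    (h : InsertInv X C₀ ord rep D H ok R P s)
    (hR : ∀ p < X.k, ∀ x < X.n, R' p x → R p x) (hP : P ≤ P') :
    InsertInv X C₀ ord rep D H ok R' P' s where
  cnt := h.cnt
  part := h.part
  sound ho := ⟨(h.sound ho).1, fun p hp x hx hr => (h.sound ho).2 p hp x hx (hR p hp x hx hr)⟩
  complete hH ho := ⟨(h.complete hH ho).1, fun x hx hs h0 => by
    obtain ⟨p, hp, h1⟩ := (h.complete hH ho).2 x hx hs h0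
    exact ⟨p, by omega, h1⟩⟩

theorem InsertInv.setReg {C₀ ord rep D : ℕ → ℕ} {H : Prop} {ok P r v : ℕ} {R : ℕ → ℕ → Prop}
    (h : InsertInv X C₀ ord rep D H ok R P s) (hr : rOk ≠ r) :
    InsertInv X C₀ ord rep D H ok R P (s.setReg r v) where
  cnt := h.cnt
  part := h.part
  sound := by rw [State.reg_setReg_of_ne _ _ hr]; exact h.sound
  complete := by rw [State.reg_setReg_of_ne _ _ hr]; exact h.complete

/-- `D` is a feasible schedule of the and-variation with the completion times `C₀` of the
successors. -/
structure AndFeas (X : Ctx) (C₀ rep D : ℕ → ℕ) : Prop where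
  pos : ∀ i < X.n, 1 ≤ D i
  load_le : ∀ t, X.load D t ≤ X.m
  eq : ∀ j, X.isS j → D j = C₀ j
  lt : ∀ l < X.k, ∀ x < X.n, Required X rep l x → D x < D (X.su l)

/-- One step of earliest-deadline-first scheduling, the deadline being the time of the current
successor. The invariant keeps, for each placed free job, an earlier or equal deadline met both by
the current times and by `D`; the former is needed if the job is met again, the latter for the
counting argument. -/
theorem insertPredecessor_spec (hE : Env X s) (hm : 1 ≤ X.m) {C₀ ord rep D : ℕ → ℕ}
    (hpos : ∀ x, X.isS x → C₀ x ≠ 0) (hord : ∀ p < X.k, ord p < X.k)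
    (hmono : ∀ p q, p ≤ q → q < X.k → C₀ (X.su (ord p)) ≤ C₀ (X.su (ord q)))
    {P i ok : ℕ} (hP : P < X.k) (hL : s.reg rL = ord P) (hI : s.reg rI = i) (hi : i < X.n)
    (hrep : s.arr aRep (ord P) = rep (ord P))
    (hInv : InsertInv X C₀ ord rep D (AndFeas X C₀ rep D) ok
      (fun p x => p < P ∨ p = P ∧ x < i) (P + 1) s) :
    wp (.when (.or (.and (isOrJob (succOf rL)) (.eq (.get aRep (.reg rL)) (.reg rI)))
          (.and (.not (isOrJob (succOf rL))) (isPred (.reg rI) (succOf rL)))) (.block [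
        placeJob,
        .when (.not (.lt (.get aC (.reg rI)) (.get aC (succOf rL)))) (.set rOk (.lit 0))]))
      s fun t s' => t ≤ 30 * X.n + 200 ∧
        InsertInv X C₀ ord rep D (AndFeas X C₀ rep D) ok
          (fun p x => p < P ∨ p = P ∧ x < i + 1) (P + 1) s' := by
  have hl := hord P hP
  have hsu := Ctx.su_lt hl
  have hj : (succOf rL).eval s = X.su (ord P) := by
    simp +decide [succOf, Exp.eval, hL, hE.succ _ hl]
  have ho := hE.isOrJob_iff (j := succOf rL) (by rwa [hj])
  have hp := hE.isPred_iff (i := .reg rI) (j := succOf rL)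
    (by simpa [Exp.eval, hI] using hi) (by rwa [hj])
  rw [hj] at ho hp
  have hb : (Test.or (.and (isOrJob (succOf rL)) (.eq (.get aRep (.reg rL)) (.reg rI)))
      (.and (.not (isOrJob (succOf rL))) (isPred (.reg rI) (succOf rL)))).Holds s ↔
      Required X rep (ord P) i := by
    simp only [Test.Holds, ho, hp]
    simp +decide [Exp.eval, hL, hI, hrep, Required]
  have hc : (Test.or (.and (isOrJob (succOf rL)) (.eq (.get aRep (.reg rL)) (.reg rI)))
      (.and (.not (isOrJob (succOf rL))) (isPred (.reg rI) (succOf rL)))).cost = 26 := rfl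
  rw [wp_when, hb, hc]
  refine ⟨fun hreq => ?_, fun hreq => ⟨by omega, hInv.cnt, hInv.part, fun h => ?_,
    hInv.complete⟩⟩
  · rw [wp_block_cons]
    refine (placeJob_spec hE (hI ▸ hi) hInv.cnt hm).conseq ?_
    rintro t₁ s₁ hF₁ ⟨ht₁, hcnt₁, hplace⟩
    rw [hI] at hplace
    have hE₁ := hE.frame hF₁ rfl
    have hI₁ : s₁.reg rI = i := by rw [hF₁.reg rI rfl, hI]
    have hO₁ : s₁.reg rOk = s.reg rOk := hF₁.reg rOk rfl
    have hj₁ : (succOf rL).eval s₁ = X.su (ord P) := by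
      simp +decide [succOf, Exp.eval, hF₁.reg rL rfl, hL, hE₁.succ _ hl]
    have hpart₁ : Partial X C₀ (s₁.arr aC) := by
      rcases hplace with ⟨-, h⟩ | ⟨h0, T, hT1, hTn, hT, hfull, h⟩
      · rw [h]; exact hInv.part
      · rw [h]; exact hInv.part.place hpos hi h0 hTn hT hfull
    have hkeep : ∀ x, s.arr aC x ≠ 0 → s₁.arr aC x = s.arr aC x := by
      intro x hx
      rcases hplace with ⟨-, h⟩ | ⟨h0, T, hT1, hTn, hT, hfull, h⟩
      · rw [h]
      · rw [h, Function.update_of_ne]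
        rintro rfl; exact hx h0
    have hi0 : s₁.arr aC i ≠ 0 := by
      rcases hplace with ⟨h0, h⟩ | ⟨h0, T, hT1, hTn, hT, hfull, h⟩
      · rw [h]; exact h0
      · rw [h, Function.update_self]; omega
    -- If `i` is already placed, it is a successor with the same time in `D`, or it met a deadline
    -- no later than the present one. If it is new, `Ctx.lt_deadline` applies, because every job now
    -- before the deadline is also before it in `D`.
    have hlt : AndFeas X C₀ rep D → ok = 1 →
        D i < C₀ (X.su (ord P)) ∧ s₁.arr aC i < C₀ (X.su (ord P)) := by
      intro hD hok
      obtain ⟨-, h2⟩ := hInv.complete hD hok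
      have hDi : D i < C₀ (X.su (ord P)) := by
        rw [← hD.eq _ (Ctx.isS_su hl)]; exact hD.lt _ hl i hi hreq
      refine ⟨hDi, ?_⟩
      rcases hplace with ⟨h0, h⟩ | ⟨h0, T, hT1, hTn, hT, hfull, h⟩
      · rw [h]
        by_cases hs : X.isS i
        · rw [hInv.part.keep i hs, ← hD.eq i hs]; exact hDi
        · obtain ⟨p, hp, -, h3⟩ := h2 i hi hs h0
          exact h3.trans_le (hmono p P (by omega) hP)
      · rw [h, Function.update_self]
        refine Ctx.lt_deadline hi h0 hD.pos hD.load_le hDi ?_ hfull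
        intro x hx hx0 hxd
        by_cases hs : X.isS x
        · rw [hD.eq x hs, ← hInv.part.keep x hs]; exact hxd
        · obtain ⟨p, hp, h3, -⟩ := h2 x hx hs hx0
          exact h3.trans_le (hmono p P (by omega) hP)
    have hsuC : s₁.arr aC (X.su (ord P)) = C₀ (X.su (ord P)) := hpart₁.keep _ (Ctx.isS_su hl)
    have hT : (Test.not (.lt (.get aC (.reg rI)) (.get aC (succOf rL)))).Holds s₁ ↔
        ¬ s₁.arr aC i < C₀ (X.su (ord P)) := by
      simp only [Test.Holds, Exp.eval, hI₁, hj₁, hsuC]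
    have hc' : (Test.not (.lt (.get aC (.reg rI)) (.get aC (succOf rL)))).cost = 7 := rfl
    simp only [wp_block_cons, wp_block_nil, wp_when, hT, hc', wp_set, Exp.eval, Exp.cost]
    refine ⟨fun h => ⟨by omega, hcnt₁, hpart₁, fun h' => ?_, fun hD hok => ?_⟩,
      fun h => ⟨by omega, hcnt₁, hpart₁, fun h' => ?_, fun hD hok => ⟨?_, ?_⟩⟩⟩
    · simp at h'
    · exact absurd (hlt hD hok).2 h
    · rw [hO₁] at h'
      obtain ⟨h1, h2⟩ := hInv.sound h'
      refine ⟨h1, fun p hp x hx hr hq => ?_⟩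
      by_cases he : p = P ∧ x = i
      · rw [he.1, he.2]; exact ⟨hi0, not_not.1 h⟩
      · obtain ⟨h3, h4⟩ := h2 p hp x hx (by omega) hq
        rw [hkeep x h3]; exact ⟨h3, h4⟩
    · rw [hO₁]; exact (hInv.complete hD hok).1
    · intro x hx hs hx0
      by_cases he : x = i
      · rw [he]; exact ⟨P, by omega, hlt hD hok⟩
      · have hne : s₁.arr aC x = s.arr aC x := by
          rcases hplace with ⟨-, h⟩ | ⟨h0, T, hT1, hTn, hT, hfull, h⟩
          · rw [h]
          · rw [h, Function.update_of_ne he]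
        rw [hne] at hx0 ⊢
        exact (hInv.complete hD hok).2 x hx hs hx0
  · obtain ⟨h1, h2⟩ := hInv.sound h
    refine ⟨h1, fun p hp x hx hr hq => ?_⟩
    by_cases he : p = P ∧ x = i
    · rw [he.1, he.2] at hq; exact absurd hq hreq
    · exact h2 p hp x hx (by omega) hq

/-- Required predecessors are placed first, under the deadline argument; the other free jobs then
only fill gaps, which changes no placed job and cannot lower the flag. -/
theorem insertJobs_spec (hE : Env X s) (hm : 1 ≤ X.m) {τ D : ℕ → ℕ} {sh : ℕ}
    (hs : Sorted X τ (s.arr aOrd)) (hcnt : CntOK X s)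
    (hτ : ∀ l < X.k, s.arr aC (X.su l) = τ l + sh)
    (hpos : ∀ x, X.isS x → 1 ≤ s.arr aC x ∧ s.arr aC x ≤ X.n)
    (h0 : ∀ x < X.n, ¬ X.isS x → s.arr aC x = 0) :
    wp insertJobs s fun t s' => t ≤ 300 * ((X.k + 1) * (X.n + 1) * (X.n + 1)) ∧
      Partial X (s.arr aC) (s'.arr aC) ∧ (∀ x < X.n, 1 ≤ s'.arr aC x) ∧
      (s'.reg rOk = 1 → s.reg rOk = 1 ∧ ∀ l < X.k, ∀ x < X.n, Required X (s.arr aRep) l x →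
        s'.arr aC x < s.arr aC (X.su l)) ∧
      (AndFeas X (s.arr aC) (s.arr aRep) D → s.reg rOk = 1 → s'.reg rOk = 1) := by
  set C₀ := s.arr aC with hC₀
  set ord := s.arr aOrd with hordd
  set rep := s.arr aRep with hrepd
  have hpos' : ∀ x, X.isS x → C₀ x ≠ 0 := fun x hx => by have := hpos x hx; omega
  have hmono : ∀ p q, p ≤ q → q < X.k → C₀ (X.su (ord p)) ≤ C₀ (X.su (ord q)) := by
    intro p q hpq hq
    rw [hτ _ (hs.lt p (by omega)), hτ _ (hs.lt q hq)]
    have := hs.mono hpq hq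
    omega
  have hbegin : InsertInv X C₀ ord rep D (AndFeas X C₀ rep D) (s.reg rOk)
      (fun p _ => p < 0) 0 s := by
    refine ⟨hcnt, ⟨fun _ _ => rfl, fun x hx => ?_, fun h => h, fun x hx hxs u hu hlt => ?_⟩,
      fun h => ⟨h, fun p _ x _ hp => absurd hp (by omega)⟩,
      fun _ h => ⟨h, fun x hx hxs hx0 => absurd (h0 x hx hxs) hx0⟩⟩
    · by_cases hxs : X.isS x
      · exact (hpos x hxs).2
      · rw [← hC₀, h0 x hx hxs]; omega
    · rw [← hC₀, h0 x hx hxs] at hlt; omega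
  rw [insertJobs, wp_block_cons]
  refine wp_forLt X.k (X.n * (30 * X.n + 220) + 40) (fun P s' =>
    InsertInv X C₀ ord rep D (AndFeas X C₀ rep D) (s.reg rOk) (fun p _ => p < P) P s')
    rfl ?_ ?_ ?_ ?_
  · intro s' hF
    simp +decide [Exp.eval, hF.reg rK rfl, hE.k]
  · exact hbegin.setReg (by decide)
  · intro P s₁ hP hF hr hI
    have hE₁ : Env X s₁ := hE.frame hF rfl
    have ho₁ : s₁.arr aOrd = ord := hF.arr aOrd rfl
    have hr₁ : s₁.arr aRep = rep := hF.arr aRep rfl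
    rw [wp_block_cons, wp_set]
    simp only [Exp.eval, Exp.cost, hr, ho₁, wp_block_cons, wp_block_nil]
    have hE₂ : Env X (s₁.setReg rL (ord P)) := by simpa +decide using hE₁
    refine wp_forLt X.n (30 * X.n + 200) (fun i s' =>
      InsertInv X C₀ ord rep D (AndFeas X C₀ rep D) (s.reg rOk)
        (fun p x => p < P ∨ p = P ∧ x < i) (P + 1) s') rfl ?_ ?_ ?_ ?_
    · intro s' hF
      simp +decide [Exp.eval, hF.reg rN rfl, hE₁.n]
    · exact ((hI.setReg (by decide)).setReg (by decide)).mono (by omega) (by omega)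
    · intro i s₂ hi hF₂ hr₂ hI₂
      have hE₃ := hE₂.frame hF₂ rfl
      refine (insertPredecessor_spec hE₃ hm hpos' hs.lt hmono hP ?_ hr₂ hi ?_ hI₂).conseq ?_
      · rw [hF₂.reg rL rfl, State.reg_setReg_self]
      · rw [hF₂.arr aRep rfl, State.arr_setReg, hr₁]
      · exact fun t s' _ h => ⟨h.1, h.2.setReg (by decide)⟩
    · intro t s₂ ht hF₂ _ hI₂
      refine ⟨?_, (hI₂.mono (fun p _ x hx h => by omega) le_rfl).setReg (by decide)⟩
      simp only [Exp.cost] at ht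
      have : X.n * (30 * X.n + 200 + 1 + 7) ≤ X.n * (30 * X.n + 220) :=
        Nat.mul_le_mul_left _ (by omega)
      omega
  · intro t₁ s₁ ht₁ hF₁ _ hI₁
    have hE₁ : Env X s₁ := hE.frame hF₁ rfl
    have hx0 : ∀ l < X.k, ∀ x < X.n, s₁.reg rOk = 1 → Required X rep l x →
        s₁.arr aC x ≠ 0 ∧ s₁.arr aC x < C₀ (X.su l) := by
      intro l hl x hx hok hq
      obtain ⟨p, hp, rfl⟩ := hs.surj l hl
      exact (hI₁.sound hok).2 p hp x hx hp hq
    rw [wp_block_cons]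
    -- The last clause freezes everything placed in the first phase, so the precedence relations
    -- established there persist.
    refine wp_forLt X.n (30 * X.n + 60) (fun i s' => CntOK X s' ∧ Partial X C₀ (s'.arr aC) ∧
      (∀ x < i, s'.arr aC x ≠ 0) ∧ ∀ x, s₁.arr aC x ≠ 0 → s'.arr aC x = s₁.arr aC x)
      rfl ?_ ?_ ?_ ?_
    · intro s' hF
      simp +decide [Exp.eval, hF.reg rN rfl, hE₁.n]
    · exact ⟨hI₁.cnt, hI₁.part, by simp, fun _ _ => rfl⟩
    · rintro i s₂ hi hF₂ hr₂ ⟨h1, h2, h3, h4⟩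
      have hE₂ := hE₁.frame hF₂ rfl
      refine (placeJob_spec hE₂ (hr₂ ▸ hi) h1 hm).conseq ?_
      rintro t₃ s₃ - ⟨ht₃, hcnt₃, hplace⟩
      rw [hr₂] at hplace
      refine ⟨ht₃, hcnt₃, ?_⟩
      rw [State.arr_setReg]
      rcases hplace with ⟨ha, h⟩ | ⟨ha, T, hT1, hTn, hT, hfull, h⟩
      · rw [h]
        refine ⟨h2, fun x hx => ?_, h4⟩
        by_cases he : x = i
        · rw [he]; exact ha
        · exact h3 x (by omega)
      · rw [h]
        refine ⟨h2.place hpos' hi ha hTn hT hfull, fun x hx => ?_, fun x hx => ?_⟩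
        · by_cases he : x = i
          · rw [he, Function.update_self]; omega
          · rw [Function.update_of_ne he]; exact h3 x (by omega)
        · have he : x ≠ i := by
            rintro rfl
            rw [h4 x hx] at ha
            exact hx ha
          rw [Function.update_of_ne he]; exact h4 x hx
    · rintro t₂ s₂ ht₂ hF₂ _ ⟨h1, h2, h3, h4⟩
      have hO₂ : s₂.reg rOk = s₁.reg rOk := hF₂.reg rOk rfl
      rw [wp_block_nil, hO₂]
      refine ⟨?_, h2, fun x hx => Nat.pos_of_ne_zero (h3 x hx), fun hok => ⟨(hI₁.sound hok).1,
        fun l hl x hx hq => ?_⟩, fun hD hok => (hI₁.complete hD hok).1⟩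
      · simp only [Exp.cost] at ht₁ ht₂
        nlinarith [Nat.zero_le (X.k * X.n), Nat.zero_le (X.k * (X.n * X.n)),
          Nat.zero_le (X.n * X.n)]
      · obtain ⟨h5, h6⟩ := hx0 l hl x hx hok hq
        rw [h4 x h5]; exact h6

end
end AndOrSched

namespace AndOrSched

open Finset
section

/-! ### Treating one choice: soundness always, optimality at the target -/

variable {X : Ctx} {s : State}

theorem evaluate_spec (γ : Objective) (hE : Env X s) :
    wp (evaluate γ) s fun t s' => t ≤ 30 * X.n + 30 ∧ s'.reg rVal = X.val γ (s.arr aC) := by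
  cases γ
  · simp only [evaluate, wp_block_cons, wp_set, Exp.eval, Exp.cost]
    refine wp_forLt X.n 20 (fun i s' => s'.reg rVal = (range i).sup (s.arr aC)) rfl ?_ ?_ ?_ ?_
    · intro s' hF
      simp +decide [Exp.eval, hF.reg rN rfl, hE.n]
    · simp +decide
    · intro i s₁ hi hF hr hI
      have hC : s₁.arr aC = s.arr aC := hF.arr aC rfl
      simp only [wp_when, wp_set, Test.Holds, Exp.eval, Exp.cost, Test.cost, hr, hC]
      rw [range_add_one, sup_insert, ← hI]
      refine ⟨fun h => ⟨by omega, ?_⟩, fun h => ⟨by omega, ?_⟩⟩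
      · rw [State.reg_setReg_of_ne _ _ (by decide), State.reg_setReg_self,
          sup_eq_left.2 h.le]
      · rw [State.reg_setReg_of_ne _ _ (by decide), sup_eq_right.2 (not_lt.1 h)]
    · intro t s₁ ht hF _ hI
      rw [wp_block_nil]
      simp only [Exp.cost] at ht
      exact ⟨by omega, hI⟩
  · simp only [evaluate, wp_block_cons, wp_set, Exp.eval, Exp.cost]
    refine wp_forLt X.n 20 (fun i s' => s'.reg rVal = ∑ x ∈ range i, s.arr aC x) rfl ?_ ?_ ?_ ?_
    · intro s' hF
      simp +decide [Exp.eval, hF.reg rN rfl, hE.n]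
    · simp +decide
    · intro i s₁ hi hF hr hI
      have hC : s₁.arr aC = s.arr aC := hF.arr aC rfl
      simp only [wp_set, Exp.eval, Exp.cost, hr, hC]
      refine ⟨by omega, ?_⟩
      rw [State.reg_setReg_of_ne _ _ (by decide), State.reg_setReg_self, sum_range_succ, hI]
    · intro t s₁ ht hF _ hI
      rw [wp_block_nil]
      simp only [Exp.cost] at ht
      exact ⟨by omega, hI⟩

/-- The best schedule found so far is feasible, and its value is recorded. -/
def BestOK (X : Ctx) (γ : Objective) (s : State) : Prop :=
  s.reg rFound = 0 ∨
    s.reg rFound = 1 ∧ X.Feas (s.arr aOut) ∧ s.reg rBest = X.val γ (s.arr aOut)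

/-- A schedule of value at most `v` has been found. -/
def Reached (v : ℕ) (s : State) : Prop := s.reg rFound = 1 ∧ s.reg rBest ≤ v

/-- The threshold `v` will be the optimal value. Once reached it stays reached, since the recorded
value never increases. -/
theorem updateBest_spec (γ : Objective) (hE : Env X s) (hB : BestOK X γ s)
    (hval : s.reg rVal = X.val γ (s.arr aC)) (hok : s.reg rOk = 1 → X.Feas (s.arr aC)) (v : ℕ) :
    wp updateBest s fun t s' => t ≤ 30 * X.n + 60 ∧ BestOK X γ s' ∧
      (Reached v s → Reached v s') ∧ (s.reg rOk = 1 → s.reg rVal ≤ v → Reached v s') := by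
  rw [updateBest, wp_when]
  simp only [Test.Holds, Exp.eval, Test.cost, Exp.cost]
  refine ⟨fun h => ?_, fun h => ⟨by omega, hB, id, fun hok hv => ?_⟩⟩
  · simp only [wp_block_cons, wp_set, Exp.eval, Exp.cost]
    refine wp_forLt X.n 20 (fun i s' => ∀ x < i, s'.arr aOut x = s.arr aC x) rfl ?_ ?_ ?_ ?_
    · intro s' hF
      simp +decide [Exp.eval, hF.reg rN rfl, hE.n]
    · simp
    · intro i s₁ hi hF hr hI
      have hC : s₁.arr aC = s.arr aC := hF.arr aC rfl
      simp only [wp_store, Exp.eval, Exp.cost, hr, hC, State.arr_setReg, State.arr_setArr_self]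
      refine ⟨by omega, fun x hx => ?_⟩
      by_cases he : x = i
      · rw [he, Function.update_self]
      · rw [Function.update_of_ne he]; exact hI x (by omega)
    · intro t s₁ ht hF _ hI
      have h1 : s₁.reg rFound = 1 := by rw [hF.reg rFound rfl]; simp +decide
      have h2 : s₁.reg rBest = s.reg rVal := by rw [hF.reg rBest rfl]; simp +decide
      simp only [Exp.cost] at ht
      rw [wp_block_nil]
      refine ⟨by omega, Or.inr ⟨h1, (hok h.1).congr fun x hx => (hI x hx).symm, ?_⟩, fun hR => ?_,
        fun _ hv => ⟨h1, by omega⟩⟩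
      · rw [h2, hval]
        exact Ctx.val_congr γ fun x hx => (hI x hx).symm
      · obtain ⟨h3, h4⟩ := hR
        refine ⟨h1, ?_⟩
        have := h.2
        omega
  · have h1 : ¬ (s.reg rFound = 0 ∨ s.reg rVal < s.reg rBest) := fun h' => h ⟨hok, h'⟩
    refine ⟨?_, by omega⟩
    rcases hB with hB | hB
    · exact absurd (Or.inl hB) h1
    · exact hB.1

/-- The data of a choice that leads to a schedule at least as good as the feasible schedule `E`: the
shift `sh` and, for every or-job without earlier predecessor among the successors, a predecessor. -/
structure Target (X : Ctx) (E f : ℕ → ℕ) (sh : ℕ) : Prop where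
  feas : X.Feas E
  le : sh + X.k ≤ X.n
  window : ∀ l < X.k, sh + 1 ≤ E (X.su l) ∧ E (X.su l) ≤ sh + X.k
  pred : ∀ l < X.k, (∃ w < X.n, ¬ X.isS w ∧ X.pred w (X.su l) ∧ E w < E (X.su l)) →
    f l < X.n ∧ ¬ X.isS (f l) ∧ X.pred (f l) (X.su l) ∧ E (f l) < E (X.su l)

/-- The family of sets that belongs to a choice of predecessors. -/
def targetSel (X : Ctx) (τ f : ℕ → ℕ) (l l' : ℕ) : Prop :=
  l = l' ∨ X.isOr (X.su l) ∧ X.pred (f l) (X.su l') ∧ (¬ X.isOr (X.su l') ∨ ¬ Before τ l' l)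

/-- The memory holds the choice of the target. -/
def AtTarget (X : Ctx) (E f : ℕ → ℕ) (sh : ℕ) (s : State) : Prop :=
  s.reg rShift = sh ∧ (∀ l < X.k, s.arr aTau l + sh = E (X.su l)) ∧
  ∀ l < X.k, ∀ l' < X.k,
    (s.arr aSel (l * X.n + l') = 1 ↔ targetSel X (s.arr aTau) f l l')

/-- For arbitrary choices only feasibility of what is recorded is claimed; at the target choice the
witness is carried through all phases and the result is compared with `E`. -/
theorem tryChoice_spec (γ : Objective) (hE : Env X s) (hm : 1 ≤ X.m)
    (hτ : ∀ l < X.k, 1 ≤ s.arr aTau l ∧ s.arr aTau l ≤ X.k)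
    (hsh : s.reg rShift + X.k ≤ X.n)
    (hdiag : ∀ l < X.k, s.arr aSel (l * X.n + l) = 1) (hB : BestOK X γ s)
    {E f : ℕ → ℕ} {sh : ℕ} (hT : Target X E f sh) :
    wp (tryChoice γ) s fun t s' => t ≤ 5000 * ((X.k + 1) * (X.n + 1) * (X.n + 1)) ∧
      BestOK X γ s' ∧ (Reached (X.val γ E) s → Reached (X.val γ E) s') ∧
      (AtTarget X E f sh s → Reached (X.val γ E) s') := by
  have hk := X.k_le
  rw [tryChoice, wp_block_cons]
  refine (placeSuccessors_spec hE hτ hsh).conseq ?_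
  rintro t₁ s₁ hF₁ ⟨ht₁, hC₁, hC₁', hcnt₁, hok₁⟩
  have hE₁ := hE.frame hF₁ rfl
  have hτ₁ : s₁.arr aTau = s.arr aTau := hF₁.arr aTau rfl
  rw [wp_block_cons]
  refine (sortSuccessors_spec hE₁ (by rw [hτ₁]; exact hτ)).conseq ?_
  rintro t₂ s₂ hF₂ ⟨ht₂, hs⟩
  rw [hτ₁] at hs
  have hE₂ := hE₁.frame hF₂ rfl
  rw [wp_block_cons]
  refine (successorRepresentatives_spec hE₂).conseq ?_
  rintro t₃ s₃ hF₃ ⟨ht₃, hrep₃⟩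
  have hE₃ := hE₂.frame hF₃ rfl
  have hC₃ : s₃.arr aC = s₁.arr aC := by rw [hF₃.arr aC rfl, hF₂.arr aC rfl]
  rw [hF₂.arr aC rfl] at hrep₃
  have hord₃ : s₃.arr aOrd = s₂.arr aOrd := hF₃.arr aOrd rfl
  have hsel₃ : s₃.arr aSel = s.arr aSel := by
    rw [hF₃.arr aSel rfl, hF₂.arr aSel rfl, hF₁.arr aSel rfl]
  have hO₃ : s₃.reg rOk = s₁.reg rOk := by rw [hF₃.reg rOk rfl, hF₂.reg rOk rfl]
  rw [wp_block_cons]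
  refine (chooseRepresentatives_spec hE₃ (τ := s.arr aTau) (f := f) (E := E)
    (sh := s.reg rShift) (by rw [hord₃]; exact hs) (by rw [hsel₃]; exact hdiag) ?_).conseq ?_
  · intro l hl _
    rcases hrep₃ l hl with h | h
    · exact Or.inl h.1
    · exact Or.inr ⟨h.1, h.2.2.2.1⟩
  rintro t₄ s₄ hF₄ ⟨ht₄, hrep₄, hok₄, hcomp₄⟩
  have hE₄ := hE₃.frame hF₄ rfl
  have hC₄ : s₄.arr aC = s₁.arr aC := by rw [hF₄.arr aC rfl, hC₃]
  have hcnt₄ : CntOK X s₄ := by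
    intro t ht htn
    rw [hC₄, hF₄.arr aCnt rfl, hF₃.arr aCnt rfl, hF₂.arr aCnt rfl]
    exact hcnt₁ t ht htn
  have hord₄ : s₄.arr aOrd = s₂.arr aOrd := by rw [hF₄.arr aOrd rfl, hord₃]
  rw [hO₃] at hok₄ hcomp₄
  rw [hsel₃] at hcomp₄
  -- The insertion specification needs `D` fixed in advance, although a witness is known to exist
  -- only at the target; elsewhere a dummy serves.
  obtain ⟨D, hD⟩ : ∃ D : ℕ → ℕ, (∃ D, Witness X (s.arr aTau) f E (s₄.arr aRep) D) →
      Witness X (s.arr aTau) f E (s₄.arr aRep) D := by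
    by_cases h : ∃ D, Witness X (s.arr aTau) f E (s₄.arr aRep) D
    · exact ⟨h.choose, fun _ => h.choose_spec⟩
    · exact ⟨fun _ => 0, fun h' => absurd h' h⟩
  rw [wp_block_cons]
  refine (insertJobs_spec hE₄ hm (τ := s.arr aTau) (D := D) (sh := s.reg rShift)
    (by rw [hord₄]; exact hs) hcnt₄ (by rw [hC₄]; exact hC₁) ?_
    (by rw [hC₄]; exact hC₁')).conseq ?_
  · intro x hx
    obtain ⟨l, hl, rfl⟩ := Ctx.exists_su hx
    have := hτ l hl
    rw [hC₄, hC₁ l hl]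
    omega
  rintro t₅ s₅ hF₅ ⟨ht₅, hpart, hpos₅, hok₅, hcomp₅⟩
  rw [hC₄] at hpart hok₅ hcomp₅
  have hE₅ := hE₄.frame hF₅ rfl
  rw [wp_block_cons]
  refine (evaluate_spec γ hE₅).conseq ?_
  rintro t₆ s₆ hF₆ ⟨ht₆, hval₆⟩
  have hE₆ := hE₅.frame hF₆ (by cases γ <;> rfl)
  have hC₆ : s₆.arr aC = s₅.arr aC := hF₆.arr aC (by cases γ <;> rfl)
  have hO₆ : s₆.reg rOk = s₅.reg rOk := hF₆.reg rOk (by cases γ <;> rfl)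
  have hfound : s₆.reg rFound = s.reg rFound := by
    rw [hF₆.reg rFound (by cases γ <;> rfl), hF₅.reg rFound rfl, hF₄.reg rFound rfl, hF₃.reg rFound rfl,
      hF₂.reg rFound rfl, hF₁.reg rFound rfl]
  have hbest : s₆.reg rBest = s.reg rBest := by
    rw [hF₆.reg rBest (by cases γ <;> rfl), hF₅.reg rBest rfl, hF₄.reg rBest rfl, hF₃.reg rBest rfl,
      hF₂.reg rBest rfl, hF₁.reg rBest rfl]
  have hout : s₆.arr aOut = s.arr aOut := by
    rw [hF₆.arr aOut (by cases γ <;> rfl), hF₅.arr aOut rfl, hF₄.arr aOut rfl, hF₃.arr aOut rfl,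
      hF₂.arr aOut rfl, hF₁.arr aOut rfl]
  have hB₆ : BestOK X γ s₆ := by rwa [BestOK, hfound, hbest, hout]
  have hfeas : s₆.reg rOk = 1 → X.Feas (s₆.arr aC) := by
    intro hok
    rw [hO₆] at hok
    obtain ⟨ho4, hreq⟩ := hok₅ hok
    obtain ⟨ho1, hne⟩ := hok₄ ho4
    have hload : ∀ t, 1 ≤ t → t ≤ X.n → X.load (s₁.arr aC) t ≤ X.m := fun t ht htn => by
      rw [← hcnt₁ t ht htn]; exact hok₁.1 ho1 t ht htn
    rw [hC₆]
    refine ⟨hpos₅, fun t => ?_, fun j hj ho i hi hp => ?_, fun j hj ho => ?_⟩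
    · by_cases ht : 1 ≤ t ∧ t ≤ X.n
      · exact hpart.load_le hload t ht.1 ht.2
      -- All jobs have times in `1, ..., n`, so the remaining slots are empty.
      · refine le_trans (le_of_eq ?_) (Nat.zero_le _)
        rw [Ctx.load, card_eq_zero, filter_eq_empty_iff]
        intro i hi he
        rw [mem_range] at hi
        have h1 := hpos₅ i hi
        have h2 := hpart.le i hi
        omega
    · obtain ⟨l, hl, rfl⟩ := Ctx.exists_su (X := X) ⟨hj, Or.inr ⟨i, hi, hp⟩⟩
      rw [hpart.keep _ (Ctx.isS_su hl)]
      exact hreq l hl i hi (Or.inr ⟨ho, hp⟩)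
    · obtain ⟨l, hl, rfl⟩ := Ctx.exists_su (X := X) ⟨hj, Or.inl ho⟩
      rw [hpart.keep _ (Ctx.isS_su hl)]
      obtain ⟨h1, h2⟩ := (hrep₄ l hl ho).resolve_left (hne l hl ho)
      exact ⟨_, h1, h2, hreq l hl _ h1 (Or.inl ⟨ho, rfl⟩)⟩
  rw [wp_block_cons]
  refine (updateBest_spec γ hE₆ hB₆ (by rw [hval₆, hC₆]) hfeas (X.val γ E)).conseq ?_
  rintro t₇ s₇ hF₇ ⟨ht₇, hB₇, hR₇, hgoal⟩
  rw [wp_block_nil]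
  refine ⟨?_, hB₇, fun h => hR₇ (by rwa [Reached, hfound, hbest]), fun hAt => ?_⟩
  · have e1 : X.k * X.k ≤ X.k * X.n := Nat.mul_le_mul_left _ hk
    have e2 : X.k * (100 * (X.n * X.k) + 100 * X.n + 100 * X.k + 300) ≤
        X.k * (100 * (X.n * X.n) + 200 * X.n + 300) := by
      refine Nat.mul_le_mul_left _ ?_
      have : X.n * X.k ≤ X.n * X.n := Nat.mul_le_mul_left _ hk
      omega
    nlinarith [Nat.zero_le (X.k * X.n), Nat.zero_le (X.k * (X.n * X.n)),
          Nat.zero_le (X.n * X.n)]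
  · obtain ⟨hsheq, htau, hsel⟩ := hAt
    have hCE : ∀ x, X.isS x → s₁.arr aC x = E x := by
      intro x hx
      obtain ⟨l, hl, rfl⟩ := Ctx.exists_su hx
      rw [hC₁ l hl, hsheq, htau l hl]
    -- At this stage the only jobs in positive slots are the successors, at their times in `E`, and
    -- `E` respects the machine bound.
    have hok₁' : s₁.reg rOk = 1 := by
      refine hok₁.2 fun t ht htn => ?_
      rw [hcnt₁ t ht htn]
      refine le_trans (card_le_card ?_) (hT.feas.load_le t)
      intro x hx
      rw [mem_filter, mem_range] at hx ⊢
      refine ⟨hx.1, ?_⟩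
      by_cases hxs : X.isS x
      · rw [← hCE x hxs]; exact hx.2
      · have := hC₁' x hx.1 hxs
        omega
    -- An or-job left without a representative has no earlier successor as predecessor, so the
    -- predecessor satisfying it in `E` is free; hence `f l` is a valid choice.
    have hfl : ∀ l < X.k, X.isOr (X.su l) → s₃.arr aRep l = X.n →
        f l < X.n ∧ ¬ X.isS (f l) ∧ X.pred (f l) (X.su l) ∧ E (f l) < E (X.su l) := by
      intro l hl ho he
      refine hT.pred l hl ?_
      obtain ⟨w, hw, hp, hlt⟩ := hT.feas.or_lt _ (Ctx.su_lt hl) ho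
      refine ⟨w, hw, fun hws => ?_, hp, hlt⟩
      rcases hrep₃ l hl with h | h
      · refine h.2 w hw ⟨ho, hws, hp, ?_⟩
        rw [hCE w hws, hCE _ (Ctx.isS_su hl)]
        exact hlt
      · exact absurd he h.1.ne
    -- The initial witness is `E` itself. An unserved or-job uses `f l`, similar to itself, and the
    -- condition on free representatives is vacuous because all representatives so far are
    -- successors.
    obtain ⟨hok₄', hW⟩ := hcomp₄ (fun l hl => by rw [hsheq, htau l hl]) (by
      intro l hl ho he
      obtain ⟨h1, h2, h3, h4⟩ := hfl l hl ho he
      refine ⟨h3, fun l' hl' => ?_⟩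
      refine (hsel l hl l' hl').trans ?_
      rw [targetSel]
      constructor
      · rintro (rfl | h)
        · exact ⟨h3, Or.inr (by simp [Before])⟩
        · exact h.2
      · exact fun h => Or.inr ⟨ho, h⟩) ⟨E, hT.feas.pos, hT.feas.load_le, fun _ _ => rfl,
        fun l hl ho i hi hp => hT.feas.and_lt _ (Ctx.su_lt hl) ho i hi hp, (by
          intro l hl ho hne
          rcases hrep₃ l hl with h | h
          · exact absurd h.1 hne
          · have h' := h.2.2.2.2
            rwa [hCE _ h.2.2.1, hCE _ (Ctx.isS_su hl)] at h'), (by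
          intro l hl ho he
          obtain ⟨h1, h2, h3, h4⟩ := hfl l hl ho he
          exact ⟨f l, h1, h2, fun _ _ _ => Iff.rfl, h4⟩), (by
          intro l hl ho hne hns
          rcases hrep₃ l hl with h | h
          · exact absurd h.1 hne
          · exact absurd h.2.2.1 hns)⟩ hok₁'
    have hWD := hD hW
    have hok₆ : s₆.reg rOk = 1 := by
      rw [hO₆]
      refine hcomp₅ ⟨hWD.pos, hWD.load_le, fun j hj => (hWD.eq j hj).trans (hCE j hj).symm,
        fun l hl x hx hq => ?_⟩ hok₄'
      rcases hq with ⟨ho, rfl⟩ | ⟨ho, hp⟩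
      · exact hWD.rep_lt l hl ho hx.ne
      · exact hWD.and_lt l hl ho x hx hp
    refine hgoal hok₆ ?_
    rw [hval₆]
    refine Ctx.val_le_of_full γ hpos₅ hT.feas.pos hT.feas.load_le (fun x hx => ?_) hpart.full
    rw [hpart.keep x hx, hCE x hx]

end
end AndOrSched

namespace AndOrSched

open Finset
section

/-! ### Counters -/

/-- The weight of the digit `q` in the mixed radix system with radices `r`. -/
def weight (r : ℕ → ℕ) (q : ℕ) : ℕ := ∏ i ∈ range q, r i

/-- The number with digits `d 0, ..., d (q - 1)`. -/
def radixVal (r d : ℕ → ℕ) (q : ℕ) : ℕ := ∑ i ∈ range q, d i * weight r i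

theorem weight_succ (r : ℕ → ℕ) (q : ℕ) : weight r (q + 1) = weight r q * r q :=
  prod_range_succ r q

theorem radixVal_succ (r d : ℕ → ℕ) (q : ℕ) :
    radixVal r d (q + 1) = radixVal r d q + d q * weight r q :=
  sum_range_succ _ q

theorem radixVal_congr {r d e : ℕ → ℕ} {q : ℕ} (h : ∀ i < q, d i = e i) :
    radixVal r d q = radixVal r e q :=
  sum_congr rfl fun i hi => by rw [h i (mem_range.1 hi)]

theorem radixVal_lt {r d : ℕ → ℕ} {q : ℕ} (h : ∀ i < q, d i < r i) :
    radixVal r d q < weight r q := by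
  induction q with
  | zero => simp [radixVal, weight]
  | succ q ih =>
    have h1 := ih fun i hi => h i (by omega)
    have h2 : (d q + 1) * weight r q ≤ r q * weight r q := Nat.mul_le_mul_right _ (h q (by omega))
    rw [radixVal_succ, weight_succ, Nat.mul_comm (weight r q)]
    rw [Nat.add_mul, Nat.one_mul] at h2
    omega

/-- The top digit is the quotient by its weight, as the lower digits stay below that weight. This
turns equality of counter values into equality of choices. -/
theorem radixVal_inj {r d e : ℕ → ℕ} {q : ℕ} (hd : ∀ i < q, d i < r i) (he : ∀ i < q, e i < r i)
    (h : radixVal r d q = radixVal r e q) : ∀ i < q, d i = e i := by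
  induction q with
  | zero => intro i hi; omega
  | succ q ih =>
    have h1 := radixVal_lt fun i hi => hd i (Nat.lt_succ_of_lt hi)
    have h2 := radixVal_lt fun i hi => he i (Nat.lt_succ_of_lt hi)
    rw [radixVal_succ, radixVal_succ] at h
    have hq : d q = e q := by
      have h3 : (radixVal r d q + d q * weight r q) / weight r q = d q := by
        rw [Nat.add_mul_div_right _ _ (by omega), Nat.div_eq_of_lt h1, Nat.zero_add]
      have h4 : (radixVal r e q + e q * weight r q) / weight r q = e q := by
        rw [Nat.add_mul_div_right _ _ (by omega), Nat.div_eq_of_lt h2, Nat.zero_add]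
      rw [← h3, h, h4]
    intro i hi
    rcases Nat.lt_succ_iff_lt_or_eq.1 hi with hi | rfl
    · refine ih (fun i hi => hd i (by omega)) (fun i hi => he i (by omega)) ?_ i hi
      rw [hq] at h
      omega
    · exact hq

variable {X : Ctx} {s : State}

/-- The number represented by the tuple of completion times. -/
noncomputable def tauVal (X : Ctx) (s : State) : ℕ :=
  radixVal (fun _ => X.k) (fun l => s.arr aTau l - 1) X.k

/-- The tuple of completion times is valid. -/
def TauOK (X : Ctx) (s : State) : Prop :=
  ∀ l < X.k, 1 ≤ s.arr aTau l ∧ s.arr aTau l ≤ X.k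

theorem firstTau_spec (hE : Env X s) :
    wp firstTau s fun t s' => t ≤ 30 * X.k + 30 ∧ TauOK X s' ∧ tauVal X s' = 0 ∧
      s'.reg rDoneTau = 0 := by
  rw [firstTau, wp_block_cons]
  refine wp_forLt X.k 20 (fun i s' => ∀ l < i, s'.arr aTau l = 1) rfl ?_ ?_ ?_ ?_
  · intro s' hF
    simp +decide [Exp.eval, hF.reg rK rfl, hE.k]
  · simp
  · intro i s₁ hi hF hr hI
    simp only [wp_store, Exp.eval, Exp.cost, hr, State.arr_setReg, State.arr_setArr_self]
    refine ⟨by omega, fun x hx => ?_⟩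
    by_cases he : x = i
    · rw [he, Function.update_self]
    · rw [Function.update_of_ne he]; exact hI x (by omega)
  · intro t s₁ ht hF _ hI
    simp only [wp_block_cons, wp_block_nil, wp_set, Exp.eval, Exp.cost, State.reg_setReg_self,
      TauOK, tauVal, State.arr_setReg] at ht ⊢
    refine ⟨by omega, fun l hl => ?_, ?_, trivial⟩
    · rw [hI l hl]; omega
    · rw [radixVal_congr (e := fun _ => 0) fun l hl => by rw [hI l hl]]
      simp [radixVal]

/-- Increment with overflow: the invariant `value + carry * weight = old value + 1` holds digit by
digit, and the final carry is the flag that ends the enumeration. The digits are the times minus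
one. -/
theorem nextTau_spec (hE : Env X s) (hτ : TauOK X s) :
    wp nextTau s fun t s' => t ≤ 60 * X.k + 60 ∧ TauOK X s' ∧ s'.reg rDoneTau ≤ 1 ∧
      tauVal X s' + s'.reg rDoneTau * X.k ^ X.k = tauVal X s + 1 := by
  let V : State → ℕ → ℕ := fun s' => radixVal (fun _ => X.k) fun l => s'.arr aTau l - 1
  let W := weight fun _ => X.k
  rw [nextTau, wp_block_cons, wp_set, wp_block_cons]
  refine wp_forLt X.k 50 (fun L s' => TauOK X s' ∧ s'.reg rCarry ≤ 1 ∧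
    (∀ l, L ≤ l → s'.arr aTau l = s.arr aTau l) ∧
    V s' L + s'.reg rCarry * W L = V s L + 1) rfl ?_ ?_ ?_ ?_
  · intro s' hF
    simp +decide [Exp.eval, hF.reg rK rfl, hE.k]
  · refine ⟨hτ, ?_, fun _ _ => rfl, ?_⟩ <;> simp +decide [Exp.eval, V, W, weight, radixVal]
  · rintro L s₁ hL hF hr ⟨h1, h2, h3, h4⟩
    have hE₁ : Env X s₁ := Env.frame (by simpa +decide using hE) hF rfl
    have hL₁ := h1 L hL
    have hsL := h3 L le_rfl
    have hVs : V s (L + 1) = V s L + (s.arr aTau L - 1) * W L := radixVal_succ _ _ _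
    have hW : W (L + 1) = W L * X.k := weight_succ _ _
    -- The three branches (increase, reset with carry, nothing to carry) only have to satisfy the
    -- equation for a single digit.
    have key : ∀ (s₂ : State) (v : ℕ), s₂.arr aTau = Function.update (s₁.arr aTau) L v →
        1 ≤ v → v ≤ X.k → s₂.reg rCarry ≤ 1 →
        (v - 1) + s₂.reg rCarry * X.k = (s.arr aTau L - 1) + s₁.reg rCarry →
        TauOK X s₂ ∧ s₂.reg rCarry ≤ 1 ∧ (∀ l, L + 1 ≤ l → s₂.arr aTau l = s.arr aTau l) ∧
        V s₂ (L + 1) + s₂.reg rCarry * W (L + 1) = V s (L + 1) + 1 := by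
      intro s₂ v ha hv1 hvk hc he
      refine ⟨fun l hl => ?_, hc, fun l hl => ?_, ?_⟩
      · rw [ha]
        by_cases h : l = L
        · rw [h, Function.update_self]; exact ⟨hv1, hvk⟩
        · rw [Function.update_of_ne h]; exact h1 l hl
      · rw [ha, Function.update_of_ne (by omega)]; exact h3 l (by omega)
      · have hV₂ : V s₂ (L + 1) = V s₁ L + (v - 1) * W L := by
          refine (radixVal_succ _ _ _).trans ?_
          rw [ha, Function.update_self]
          congr 1
          refine radixVal_congr fun l hl => ?_
          rw [Function.update_of_ne (by omega)]
        rw [hV₂, hVs, hW]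
        have e1 : ((v - 1) + s₂.reg rCarry * X.k) * W L =
            ((s.arr aTau L - 1) + s₁.reg rCarry) * W L := by rw [he]
        have e2 : s₂.reg rCarry * (W L * X.k) = s₂.reg rCarry * X.k * W L := by ring
        rw [Nat.add_mul, Nat.add_mul] at e1
        omega
    simp only [wp_when, wp_ite, wp_block_cons, wp_block_nil, wp_set, wp_store, wp_incArr,
      Test.Holds, Test.cost, Exp.eval, Exp.cost, hr, hE₁.k]
    refine ⟨fun hc => ⟨fun hlt => ⟨by omega, key _ (s₁.arr aTau L + 1) ?_ ?_ ?_ ?_ ?_⟩,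
      fun hlt => ⟨by omega, key _ 1 ?_ ?_ ?_ ?_ ?_⟩⟩, fun hc => ?_⟩
    · simp
    · omega
    · omega
    · simp +decide
    · simp +decide [hc]; omega
    · simp
    · omega
    · omega
    · simp +decide [hc]
    · simp +decide [hc]; omega
    · have hc0 : s₁.reg rCarry = 0 := by omega
      refine ⟨by omega, key _ (s₁.arr aTau L) ?_ ?_ ?_ ?_ ?_⟩
      · simp
      · omega
      · omega
      · simp +decide [hc0]
      · simp +decide [hc0, hsL]
  · rintro t s₁ ht hF _ ⟨h1, h2, h3, h4⟩
    simp +decide only [wp_block_cons, wp_block_nil, wp_set, Exp.eval, Exp.cost,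
      State.reg_setReg_self] at ht ⊢
    refine ⟨by omega, h1, h2, ?_⟩
    have hW : W X.k = X.k ^ X.k := by simp [W, weight]
    rw [← hW]
    exact h4

end
end AndOrSched

namespace AndOrSched

open Finset
section

/-! ### The counter for the families of sets -/

variable {X : Ctx} {s : State}

/-- Whether the `l'`-th successor lies in the set of the `l`-th successor, as a digit; the
diagonal is not counted. -/
def selDigit (X : Ctx) (s : State) (l l' : ℕ) : ℕ :=
  if l = l' then 0 else s.arr aSel (l * X.n + l')

open scoped Classical in
/-- The radix of the digit `selDigit X s l l'`. -/
noncomputable def selRadix (X : Ctx) (l l' : ℕ) : ℕ :=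
  if X.isOr (X.su l) ∧ l ≠ l' then 2 else 1

/-- The radix of the row `l`. -/
noncomputable def rowRadix (X : Ctx) (l : ℕ) : ℕ := weight (selRadix X l) X.k

/-- The number represented by a family of sets. -/
noncomputable def selVal (X : Ctx) (d : ℕ → ℕ → ℕ) (q : ℕ) : ℕ :=
  radixVal (rowRadix X) (fun l => radixVal (selRadix X l) (d l) X.k) q

/-- The family of sets is valid. -/
def SelOK (X : Ctx) (s : State) : Prop :=
  (∀ l < X.k, ∀ l' < X.k, selDigit X s l l' < selRadix X l l') ∧
  ∀ l < X.k, s.arr aSel (l * X.n + l) = 1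

theorem selRadix_pos (l l' : ℕ) : 0 < selRadix X l l' := by
  unfold selRadix; split_ifs <;> omega

/-- A row has at most `k - 1` binary digits because the diagonal has radix 1. The factor `2 ^ k`
saved against `2 ^ (k ^ 2)` later absorbs the factor `k + 1` in the cost of a choice. -/
theorem weight_rowRadix_le : weight (rowRadix X) X.k ≤ 2 ^ ((X.k - 1) * X.k) := by
  have hrow : ∀ l ∈ range X.k, rowRadix X l ≤ 2 ^ (X.k - 1) := by
    intro l hl
    have h1 : selRadix X l l = 1 := by simp [selRadix]
    rw [rowRadix, weight, ← mul_prod_erase _ _ hl, h1, one_mul]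
    refine (prod_le_pow_card _ _ 2 fun l' _ => ?_).trans (le_of_eq ?_)
    · unfold selRadix; split_ifs <;> omega
    · rw [card_erase_of_mem hl, card_range]
  refine (prod_le_pow_card _ _ _ hrow).trans (le_of_eq ?_)
  rw [card_range, pow_mul]

theorem selVal_lt {d : ℕ → ℕ → ℕ} (h : ∀ l < X.k, ∀ l' < X.k, d l l' < selRadix X l l') :
    selVal X d X.k < weight (rowRadix X) X.k :=
  radixVal_lt fun l hl => radixVal_lt (h l hl)

theorem selVal_inj {d e : ℕ → ℕ → ℕ} (hd : ∀ l < X.k, ∀ l' < X.k, d l l' < selRadix X l l')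
    (he : ∀ l < X.k, ∀ l' < X.k, e l l' < selRadix X l l') (h : selVal X d X.k = selVal X e X.k) :
    ∀ l < X.k, ∀ l' < X.k, d l l' = e l l' := fun l hl =>
  radixVal_inj (hd l hl) (he l hl)
    (radixVal_inj (fun l hl => radixVal_lt (hd l hl)) (fun l hl => radixVal_lt (he l hl)) h l hl)

theorem index_inj {l l₁ l' l₁' : ℕ} (h : l' < X.n) (h₁ : l₁' < X.n)
    (e : l * X.n + l' = l₁ * X.n + l₁') : l = l₁ ∧ l' = l₁' := by
  have hn : 0 < X.n := by omega
  have h1 : (l * X.n + l') / X.n = l := by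
    rw [Nat.add_comm, Nat.add_mul_div_right _ _ hn, Nat.div_eq_of_lt h, Nat.zero_add]
  have h2 : (l₁ * X.n + l₁') / X.n = l₁ := by
    rw [Nat.add_comm, Nat.add_mul_div_right _ _ hn, Nat.div_eq_of_lt h₁, Nat.zero_add]
  have : l = l₁ := by rw [← h1, e, h2]
  subst this
  exact ⟨rfl, by omega⟩

theorem selDigit_congr {s' : State} {l l' : ℕ}
    (h : s'.arr aSel (l * X.n + l') = s.arr aSel (l * X.n + l')) :
    selDigit X s' l l' = selDigit X s l l' := by
  simp only [selDigit, h]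

theorem firstSel_spec (hE : Env X s) :
    wp firstSel s fun t s' => t ≤ 60 * (X.k * X.k) + 60 * X.k + 60 ∧ SelOK X s' ∧
      selVal X (selDigit X s') X.k = 0 ∧ s'.reg rDoneSel = 0 := by
  have hk := X.k_le
  rw [firstSel, wp_block_cons]
  refine wp_forLt X.k (40 * X.k + 20) (fun L s' => ∀ l < L, ∀ l' < X.k,
    s'.arr aSel (l * X.n + l') = if l = l' then 1 else 0) rfl ?_ ?_ ?_ ?_
  · intro s' hF
    simp +decide [Exp.eval, hF.reg rK rfl, hE.k]
  · simp
  · intro L s₁ hL hF hr hI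
    have hE₁ : Env X s₁ := hE.frame hF rfl
    refine wp_forLt X.k 25 (fun L' s' => (∀ l < L, ∀ l' < X.k,
        s'.arr aSel (l * X.n + l') = if l = l' then 1 else 0) ∧
      ∀ l' < L', s'.arr aSel (L * X.n + l') = if L = l' then 1 else 0) rfl ?_ ?_ ?_ ?_
    · intro s' hF
      simp +decide [Exp.eval, hF.reg rK rfl, hE₁.k]
    · exact ⟨hI, by simp⟩
    · rintro L' s₂ hL' hF₂ hr₂ ⟨h1, h2⟩
      have hE₂ : Env X s₂ := hE₁.frame hF₂ rfl
      have hrL : s₂.reg rL = L := by rw [hF₂.reg rL rfl, hr]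
      have key : ∀ v, v = (if L = L' then 1 else 0) →
          (∀ l < L, ∀ l' < X.k, Function.update (s₂.arr aSel) (L * X.n + L') v (l * X.n + l') =
            if l = l' then 1 else 0) ∧
          ∀ l' < L' + 1, Function.update (s₂.arr aSel) (L * X.n + L') v (L * X.n + l') =
            if L = l' then 1 else 0 := by
        intro v hv
        refine ⟨fun l hl l' hl' => ?_, fun l' hl' => ?_⟩
        · rw [Function.update_of_ne, h1 l hl l' hl']
          intro e
          have := (index_inj (by omega) (by omega) e).1
          omega
        · by_cases h : l' = L'
          · rw [h, Function.update_self, hv]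
          · rw [Function.update_of_ne (by omega), h2 l' (by omega)]
      simp only [wp_ite, wp_store, Test.Holds, Test.cost, Exp.eval, Exp.cost, hr₂, hrL,
        hE₂.off L (by omega), State.arr_setReg, State.arr_setArr_self]
      exact ⟨fun h => ⟨by omega, key 1 (by rw [if_pos h])⟩,
        fun h => ⟨by omega, key 0 (by rw [if_neg h])⟩⟩
    · rintro t s₂ ht _ _ ⟨h1, h2⟩
      simp only [Exp.cost] at ht
      refine ⟨by omega, fun l hl l' hl' => ?_⟩
      rw [State.arr_setReg]
      by_cases h : l = L
      · rw [h]; exact h2 l' hl'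
      · exact h1 l (by omega) l' hl'
  · intro t s₁ ht hF _ hI
    simp only [wp_block_cons, wp_block_nil, wp_set, Exp.eval, Exp.cost, State.reg_setReg_self]
      at ht ⊢
    have hd : ∀ l < X.k, ∀ l' < X.k, selDigit X (s₁.setReg rDoneSel 0) l l' = 0 := by
      intro l hl l' hl'
      rw [selDigit, State.arr_setReg, hI l hl l' hl']
      split_ifs <;> rfl
    refine ⟨by nlinarith, ⟨fun l hl l' hl' => ?_, fun l hl => ?_⟩, ?_, trivial⟩
    · rw [hd l hl l' hl']; exact selRadix_pos l l'
    · rw [State.arr_setReg, hI l hl l hl, if_pos rfl]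
    · rw [selVal, radixVal_congr (e := fun _ => 0)]
      · simp [radixVal]
      · intro l hl
        rw [radixVal_congr (e := fun _ => 0) (hd l hl)]
        simp [radixVal]

/-- Two nested counters: each row is a number in its own radices and acts as one digit of the outer
number, so the inner final carry is the outer carry. And-jobs have only digits of radix 1 and are
passed over. -/
theorem nextSel_spec (hE : Env X s) (hS : SelOK X s) :
    wp nextSel s fun t s' => t ≤ 100 * (X.k * X.k) + 60 * X.k + 60 ∧ SelOK X s' ∧
      s'.reg rDoneSel ≤ 1 ∧
      selVal X (selDigit X s') X.k + s'.reg rDoneSel * weight (rowRadix X) X.k =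
        selVal X (selDigit X s) X.k + 1 := by
  have hk := X.k_le
  rw [nextSel, wp_block_cons, wp_set, wp_block_cons]
  refine wp_forLt X.k (80 * X.k + 20) (fun L s' => SelOK X s' ∧ s'.reg rCarry ≤ 1 ∧
    (∀ l < X.k, L ≤ l → ∀ l' < X.k, s'.arr aSel (l * X.n + l') = s.arr aSel (l * X.n + l')) ∧
    selVal X (selDigit X s') L + s'.reg rCarry * weight (rowRadix X) L =
      selVal X (selDigit X s) L + 1) rfl ?_ ?_ ?_ ?_
  · intro s' hF
    simp +decide [Exp.eval, hF.reg rK rfl, hE.k]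
  · refine ⟨hS, ?_, fun _ _ _ _ _ => rfl, ?_⟩ <;>
      simp +decide [Exp.eval, selVal, weight, radixVal]
  · rintro L s₁ hL hF hr ⟨h1, h2, h3, h4⟩
    have hE₁ : Env X s₁ := Env.frame (by simpa +decide using hE) hF rfl
    let R : State → ℕ → ℕ := fun s' => radixVal (selRadix X L) (selDigit X s' L)
    let W := weight (selRadix X L)
    have hsu := Ctx.su_lt hL
    refine wp_forLt X.k 65 (fun L' s' => SelOK X s' ∧ s'.reg rCarry ≤ 1 ∧
      (∀ l < X.k, ∀ l' < X.k, l ≠ L ∨ L' ≤ l' →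
        s'.arr aSel (l * X.n + l') = s₁.arr aSel (l * X.n + l')) ∧
      R s' L' + s'.reg rCarry * W L' = R s₁ L' + s₁.reg rCarry) rfl ?_ ?_ ?_ ?_
    · intro s' hF
      simp +decide [Exp.eval, hF.reg rK rfl, hE₁.k]
    · exact ⟨h1, by simpa +decide using h2, fun _ _ _ _ _ => rfl, by
        simp +decide [R, W, weight, radixVal]⟩
    · rintro L' s₂ hL' hF₂ hr₂ ⟨g1, g2, g3, g4⟩
      have hE₂ : Env X s₂ := hE₁.frame hF₂ rfl
      have hrL : s₂.reg rL = L := by rw [hF₂.reg rL rfl, hr]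
      have hd₁ : selDigit X s₁ L L' = selDigit X s₂ L L' :=
        (selDigit_congr (g3 L hL L' hL' (Or.inr le_rfl))).symm
      -- As for tuples, every branch reduces to the equation for one digit; the diagonal entries are
      -- not counted and have to be preserved separately.
      have key : ∀ s₃ : State, (∀ l < X.k, ∀ l' < X.k, l ≠ L ∨ l' ≠ L' →
            s₃.arr aSel (l * X.n + l') = s₂.arr aSel (l * X.n + l')) →
          (L = L' → s₃.arr aSel (L * X.n + L) = s₂.arr aSel (L * X.n + L)) →
          s₃.reg rCarry ≤ 1 → selDigit X s₃ L L' < selRadix X L L' →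
          selDigit X s₃ L L' + s₃.reg rCarry * selRadix X L L' =
            selDigit X s₂ L L' + s₂.reg rCarry →
          SelOK X s₃ ∧ s₃.reg rCarry ≤ 1 ∧
          (∀ l < X.k, ∀ l' < X.k, l ≠ L ∨ L' + 1 ≤ l' →
            s₃.arr aSel (l * X.n + l') = s₁.arr aSel (l * X.n + l')) ∧
          R s₃ (L' + 1) + s₃.reg rCarry * W (L' + 1) = R s₁ (L' + 1) + s₁.reg rCarry := by
        intro s₃ ha hdg hc hlt he
        refine ⟨⟨fun l hl l' hl' => ?_, fun l hl => ?_⟩, hc, fun l hl l' hl' hne => ?_, ?_⟩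
        · by_cases h : l = L ∧ l' = L'
          · rw [h.1, h.2]; exact hlt
          · rw [selDigit_congr (ha l hl l' hl' (by omega))]
            exact g1.1 l hl l' hl'
        · by_cases h : l = L ∧ l = L'
          · obtain ⟨rfl, h⟩ := h
            rw [hdg h]; exact g1.2 l hl
          · rw [ha l hl l hl (by omega)]; exact g1.2 l hl
        · rw [ha l hl l' hl' (by omega)]
          exact g3 l hl l' hl' (by omega)
        · have e1 : R s₃ (L' + 1) = R s₂ L' + selDigit X s₃ L L' * W L' := by
            refine (radixVal_succ _ _ _).trans ?_
            congr 1
            exact radixVal_congr fun l' hl' => selDigit_congr (ha L hL l' (by omega) (by omega))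
          have e2 : R s₁ (L' + 1) = R s₁ L' + selDigit X s₁ L L' * W L' := radixVal_succ _ _ _
          have e3 : W (L' + 1) = W L' * selRadix X L L' := weight_succ _ _
          have e4 : (selDigit X s₃ L L' + s₃.reg rCarry * selRadix X L L') * W L' =
            (selDigit X s₂ L L' + s₂.reg rCarry) * W L' := by rw [he]
          have e5 : s₃.reg rCarry * (W L' * selRadix X L L') =
            s₃.reg rCarry * selRadix X L L' * W L' := by ring
          rw [e1, e2, e3, e5, hd₁]
          rw [Nat.add_mul, Nat.add_mul] at e4
          omega
      have hj : (succOf rL).eval s₂ = X.su L := by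
        simp +decide [succOf, Exp.eval, hrL, hE₂.succ _ hL]
      have ho := hE₂.isOrJob_iff (j := succOf rL) (by rwa [hj])
      rw [hj] at ho
      have hb : (Test.and (.eq (.reg rCarry) (.lit 1))
          (.and (isOrJob (succOf rL)) (.not (.eq (.reg rL) (.reg rL'))))).Holds s₂ ↔
          s₂.reg rCarry = 1 ∧ X.isOr (X.su L) ∧ L ≠ L' := by
        simp only [Test.Holds, ho]
        simp +decide [Exp.eval, hrL, hr₂]
      have hbc : (Test.and (.eq (.reg rCarry) (.lit 1))
          (.and (isOrJob (succOf rL)) (.not (.eq (.reg rL) (.reg rL'))))).cost = 14 := rfl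
      have hup : ∀ (v : ℕ), ∀ l < X.k, ∀ l' < X.k, l ≠ L ∨ l' ≠ L' →
          Function.update (s₂.arr aSel) (L * X.n + L') v (l * X.n + l') =
            s₂.arr aSel (l * X.n + l') := by
        intro v l hl l' hl' hne
        rw [Function.update_of_ne]
        intro e
        have := index_inj (by omega) (by omega) e
        omega
      rw [wp_when, hb, hbc]
      simp only [wp_ite, wp_block_cons, wp_block_nil, wp_set, wp_store,
        Test.Holds, Test.cost, Exp.eval, Exp.cost, hrL, hr₂, hE₂.off L (by omega)]
      have hdg := g1.1 L hL L' hL'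
      refine ⟨fun hc => ?_, fun hc => ⟨by omega, key _ ?_ ?_ ?_ ?_ ?_⟩⟩
      · have hrad : selRadix X L L' = 2 := if_pos hc.2
        have hdig : selDigit X s₂ L L' = s₂.arr aSel (L * X.n + L') := if_neg hc.2.2
        rw [hrad, hdig] at hdg
        refine ⟨fun h0 => ⟨by omega, key _ ?_ ?_ ?_ ?_ ?_⟩,
          fun h0 => ⟨by omega, key _ ?_ ?_ ?_ ?_ ?_⟩⟩
        · simp +decide only [State.arr_setReg, State.arr_setArr_self]
          exact hup 1
        · exact fun h => absurd h hc.2.2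
        · simp +decide
        · rw [hrad, selDigit, if_neg hc.2.2]
          simp +decide
        · rw [hrad, hdig, selDigit, if_neg hc.2.2]
          simp +decide [hc.1, h0]
        · simp +decide only [State.arr_setReg, State.arr_setArr_self]
          exact hup 0
        · exact fun h => absurd h hc.2.2
        · simp +decide [hc.1]
        · rw [hrad, selDigit, if_neg hc.2.2]
          simp +decide
        · rw [hrad, hdig, selDigit, if_neg hc.2.2]
          simp +decide [hc.1]
          omega
      · exact fun _ _ _ _ _ => rfl
      · exact fun _ => rfl
      · simpa +decide using g2
      · exact hdg
      · rw [State.reg_setReg_of_ne _ _ (by decide)]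
        have hdd : selDigit X (s₂.setReg rL' (L' + 1)) L L' = selDigit X s₂ L L' := rfl
        rw [hdd]
        -- The entry is left alone either at a position of radix 1, which passes the carry on, or
        -- when there is no carry.
        by_cases hc1 : s₂.reg rCarry = 1
        · have hrad : selRadix X L L' = 1 := if_neg fun h => hc ⟨hc1, h⟩
          rw [hrad, Nat.mul_one]
        · have : s₂.reg rCarry = 0 := by omega
          rw [this, Nat.zero_mul]
    · rintro t s₂ ht hF₂ _ ⟨g1, g2, g3, g4⟩
      simp only [Exp.cost] at ht
      have hdd : ∀ l l', selDigit X (s₂.setReg rL (L + 1)) l l' = selDigit X s₂ l l' :=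
        fun _ _ => rfl
      refine ⟨by omega, g1, by simpa +decide using g2, fun l hl hl2 l' hl' => ?_, ?_⟩
      · rw [State.arr_setReg, g3 l hl l' hl' (by omega)]
        exact h3 l hl (by omega) l' hl'
      · rw [State.reg_setReg_of_ne _ _ (by decide)]
        have e1 : selVal X (selDigit X (s₂.setReg rL (L + 1))) (L + 1) =
            selVal X (selDigit X s₁) L + R s₂ X.k * weight (rowRadix X) L := by
          refine (radixVal_succ _ _ _).trans ?_
          congr 1
          refine radixVal_congr fun l hl => radixVal_congr fun l' hl' => ?_
          rw [hdd]
          exact selDigit_congr (g3 l (by omega) l' hl' (by omega))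
        have e2 : selVal X (selDigit X s) (L + 1) =
            selVal X (selDigit X s) L + R s₁ X.k * weight (rowRadix X) L := by
          refine (radixVal_succ _ _ _).trans ?_
          congr 2
          exact radixVal_congr fun l' hl' => (selDigit_congr (h3 L hL le_rfl l' hl')).symm
        have e3 : weight (rowRadix X) (L + 1) = weight (rowRadix X) L * W X.k := weight_succ _ _
        have e4 : (R s₂ X.k + s₂.reg rCarry * W X.k) * weight (rowRadix X) L =
            (R s₁ X.k + s₁.reg rCarry) * weight (rowRadix X) L := by rw [g4]
        have e5 : s₂.reg rCarry * (weight (rowRadix X) L * W X.k) =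
          s₂.reg rCarry * W X.k * weight (rowRadix X) L := by ring
        rw [e1, e2, e3, e5]
        rw [Nat.add_mul, Nat.add_mul] at e4
        omega
  · rintro t s₁ ht hF _ ⟨h1, h2, h3, h4⟩
    simp +decide only [wp_block_cons, wp_block_nil, wp_set, Exp.eval, Exp.cost,
      State.reg_setReg_self] at ht ⊢
    exact ⟨by nlinarith, h1, h2, h4⟩

end
end AndOrSched

namespace AndOrSched

open Finset
section

/-! ### Exhausting families, shifts and tuples -/

variable {X : Ctx} {s : State}

open scoped Classical in
/-- The digits of the family of sets of the target. -/
noncomputable def targetDigit (X : Ctx) (τ f : ℕ → ℕ) (l l' : ℕ) : ℕ :=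
  if l = l' then 0 else if targetSel X τ f l l' then 1 else 0

/-- The target is a legal counter reading: for and-jobs its set contains only the job itself, and
the counter never produces anything else. -/
theorem targetDigit_lt (τ f : ℕ → ℕ) (l l' : ℕ) :
    targetDigit X τ f l l' < selRadix X l l' := by
  unfold targetDigit selRadix targetSel
  by_cases h : l = l'
  · simp [h]
  · by_cases ho : X.isOr (X.su l)
    · simp only [h, ho, if_false, ne_eq, not_false_eq_true, and_self, if_true]
      split_ifs <;> omega
    · simp [h, ho]

theorem atTarget_of_digits {E f : ℕ → ℕ} {sh : ℕ} (hS : SelOK X s) (hsh : s.reg rShift = sh)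
    (hτ : ∀ l < X.k, s.arr aTau l + sh = E (X.su l))
    (h : ∀ l < X.k, ∀ l' < X.k, selDigit X s l l' = targetDigit X (s.arr aTau) f l l') :
    AtTarget X E f sh s := by
  refine ⟨hsh, hτ, fun l hl l' hl' => ?_⟩
  by_cases he : l = l'
  · subst he
    exact iff_of_true (hS.2 l hl) (Or.inl rfl)
  · have h1 := h l hl l' hl'
    rw [selDigit, if_neg he, targetDigit, if_neg he] at h1
    rw [h1]
    split_ifs with ht <;> simp [ht]

theorem BestOK.congr {γ : Objective} {s' : State} (h : BestOK X γ s)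
    (h1 : s'.reg rFound = s.reg rFound) (h2 : s'.reg rBest = s.reg rBest)
    (h3 : s'.arr aOut = s.arr aOut) : BestOK X γ s' := by
  rwa [BestOK, h1, h2, h3]

theorem Reached.congr {v : ℕ} {s' : State} (h : Reached v s)
    (h1 : s'.reg rFound = s.reg rFound) (h2 : s'.reg rBest = s.reg rBest) : Reached v s' := by
  rwa [Reached, h1, h2]

/-- A bound for the time to treat one choice. -/
noncomputable def choiceBound (X : Ctx) : ℕ := (X.k + 1) * (X.n + 1) * (X.n + 1)

theorem le_choiceBound (X : Ctx) :
    1 ≤ choiceBound X ∧ X.k ≤ choiceBound X ∧ X.k * X.k ≤ choiceBound X := by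
  have hk := X.k_le
  have : X.k * X.k ≤ X.k * X.n := Nat.mul_le_mul_left _ hk
  unfold choiceBound
  refine ⟨?_, ?_, ?_⟩ <;> nlinarith [Nat.zero_le (X.k * X.n), Nat.zero_le (X.k * (X.n * X.n)),
          Nat.zero_le (X.n * X.n)]

/-- The counter starts at 0 and grows by one, so it cannot pass the number of the target family
without that family being tried, whereupon the value of `E` is reached and stays reached. -/
theorem families_spec (γ : Objective) (hE : Env X s) (hm : 1 ≤ X.m) (hτ : TauOK X s)
    (hsh : s.reg rShift + X.k ≤ X.n) (hB : BestOK X γ s) {E f : ℕ → ℕ} {sh : ℕ}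
    (hT : Target X E f sh) :
    wp (.block [firstSel, .loop (.eq (.reg rDoneSel) (.lit 0)) (.block [tryChoice γ, nextSel])]) s
      fun t s' => t ≤ 6000 * (2 ^ ((X.k - 1) * X.k) * choiceBound X) ∧ BestOK X γ s' ∧
        (Reached (X.val γ E) s → Reached (X.val γ E) s') ∧
        (s.reg rShift = sh → (∀ l < X.k, s.arr aTau l + sh = E (X.su l)) →
          Reached (X.val γ E) s') := by
  set v := X.val γ E
  set W := weight (rowRadix X) X.k with hW
  set V : State → ℕ := fun s' => selVal X (selDigit X s') X.k with hV
  set V₀ := selVal X (targetDigit X (s.arr aTau) f) X.k with hV₀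
  rw [wp_block_cons]
  refine (firstSel_spec hE).conseq ?_
  rintro t₁ s₁ hF₁ ⟨ht₁, hS₁, hv₁, hd₁⟩
  have hE₁ : Env X s₁ := hE.frame hF₁ rfl
  rw [wp_block_cons]
  -- The variant is set to 0 on overflow, where the counter value itself would jump back.
  refine wp_loop (fun s' => if s'.reg rDoneSel = 0 then W - V s' else 0)
    (5400 * choiceBound X) (fun s' => SelOK X s' ∧ BestOK X γ s' ∧
      (Reached v s → Reached v s') ∧
      (s.reg rShift = sh → (∀ l < X.k, s.arr aTau l + sh = E (X.su l)) →
        Reached v s' ∨ s'.reg rDoneSel = 0 ∧ V s' ≤ V₀)) ?_ ?_ ?_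
  · refine ⟨hS₁, hB.congr (hF₁.reg _ rfl) (hF₁.reg _ rfl) (hF₁.arr _ rfl),
      fun h => h.congr (hF₁.reg _ rfl) (hF₁.reg _ rfl), fun _ _ => Or.inr ⟨hd₁, ?_⟩⟩
    exact (le_of_eq hv₁).trans (Nat.zero_le _)
  · rintro s₂ hF₂ ⟨hS₂, hB₂, hR₂, hG₂⟩ hd₂
    have hd₂' : s₂.reg rDoneSel = 0 := by simpa [Test.Holds, Exp.eval] using hd₂
    have hE₂ : Env X s₂ := hE₁.frame hF₂ (by cases γ <;> rfl)
    have htau : s₂.arr aTau = s.arr aTau := by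
      rw [hF₂.arr aTau (by cases γ <;> rfl), hF₁.arr aTau rfl]
    have hshift : s₂.reg rShift = s.reg rShift := by
      rw [hF₂.reg rShift (by cases γ <;> rfl), hF₁.reg rShift rfl]
    have hVW : V s₂ < W := selVal_lt hS₂.1
    have hV₀W : V₀ < W := selVal_lt fun l _ l' _ => targetDigit_lt _ _ l l'
    rw [wp_block_cons]
    refine (tryChoice_spec γ hE₂ hm (by rw [htau]; exact hτ) (by rw [hshift]; exact hsh)
      hS₂.2 hB₂ hT).conseq ?_
    rintro t₃ s₃ hF₃ ⟨ht₃, hB₃, hR₃, hG₃⟩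
    have hE₃ : Env X s₃ := hE₂.frame hF₃ (by cases γ <;> rfl)
    have hsel : s₃.arr aSel = s₂.arr aSel := hF₃.arr aSel (by cases γ <;> rfl)
    have hdig : selDigit X s₃ = selDigit X s₂ := by
      funext l l'; exact selDigit_congr (by rw [hsel])
    have hS₃ : SelOK X s₃ := by
      rw [SelOK, hdig, hsel]; exact hS₂
    have hV₃ : V s₃ = V s₂ := by simp only [hV, hdig]
    rw [wp_block_cons]
    refine (nextSel_spec hE₃ hS₃).conseq ?_
    rintro t₄ s₄ hF₄ ⟨ht₄, hS₄, hd₄, hv₄⟩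
    have hv₄' : V s₄ + s₄.reg rDoneSel * W = V s₂ + 1 := by rw [← hV₃]; exact hv₄
    have hV₄W : V s₄ < W := selVal_lt hS₄.1
    rw [wp_block_nil]
    have hR₄ : Reached v s₃ → Reached v s₄ := fun h => h.congr (hF₄.reg _ rfl) (hF₄.reg _ rfl)
    obtain ⟨hb1, hb2, hb3⟩ := le_choiceBound X
    refine ⟨?_, ⟨hS₄, hB₃.congr (hF₄.reg _ rfl) (hF₄.reg _ rfl) (hF₄.arr _ rfl),
      fun h => hR₄ (hR₃ (hR₂ h)), fun hs ht => ?_⟩, ?_⟩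
    · rw [← choiceBound] at ht₃
      omega
    · rcases hG₂ hs ht with h | ⟨-, h⟩
      · exact Or.inl (hR₄ (hR₃ h))
      · rcases eq_or_lt_of_le h with he | hlt
        · left
          refine hR₄ (hG₃ (atTarget_of_digits hS₂ (hshift.trans hs) (by rw [htau]; exact ht) ?_))
          rw [htau]
          exact selVal_inj hS₂.1 (fun l _ l' _ => targetDigit_lt _ _ l l') he
        · right
          -- Overflow is impossible here: the counter is strictly below the target number, which is
          -- itself below the total weight.
          have hz : s₄.reg rDoneSel = 0 := by
            by_contra hne
            have h1 : s₄.reg rDoneSel = 1 := by omega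
            rw [h1] at hv₄'
            omega
          rw [hz] at hv₄'
          exact ⟨hz, by omega⟩
    · rw [if_pos hd₂']
      split_ifs with hz
      · rw [hz] at hv₄'
        omega
      · omega
  · rintro t₂ s₂ ht₂ hF₂ ⟨hS₂, hB₂, hR₂, hG₂⟩ hd₂
    have hd₂' : ¬ s₂.reg rDoneSel = 0 := by simpa [Test.Holds, Exp.eval] using hd₂
    rw [wp_block_nil]
    obtain ⟨hb1, hb2, hb3⟩ := le_choiceBound X
    refine ⟨?_, hB₂, hR₂, fun hs ht => ?_⟩
    · have h1 : (if s₁.reg rDoneSel = 0 then W - V s₁ else 0) ≤ 2 ^ ((X.k - 1) * X.k) := by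
        rw [if_pos hd₁]
        exact (Nat.sub_le _ _).trans weight_rowRadix_le
      have h2 : 1 ≤ 2 ^ ((X.k - 1) * X.k) := Nat.one_le_two_pow
      set Z := 2 ^ ((X.k - 1) * X.k)
      simp only [Test.cost, Exp.cost] at ht₂
      have h3 := Nat.mul_le_mul_right (5400 * choiceBound X + (1 + 1 + 1) + 1) h1
      have h4 := Nat.mul_le_mul_right (choiceBound X) h2
      have h5 : Z * (5400 * choiceBound X + (1 + 1 + 1) + 1) =
        5400 * (Z * choiceBound X) + 4 * Z := by ring
      have h6 := Nat.mul_le_mul_left Z hb1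
      omega
    · rcases hG₂ hs ht with h | ⟨h, -⟩
      · exact h
      · exact absurd h hd₂'

theorem shifts_spec (γ : Objective) (hE : Env X s) (hm : 1 ≤ X.m) (hτ : TauOK X s)
    (hB : BestOK X γ s) {E f : ℕ → ℕ} {sh : ℕ} (hT : Target X E f sh) :
    wp (.forLt rShift (.sub (.add (.reg rN) (.lit 1)) (.reg rK)) (.block [
      firstSel, .loop (.eq (.reg rDoneSel) (.lit 0)) (.block [tryChoice γ, nextSel])])) s
      fun t s' => t ≤ 7000 * (2 ^ ((X.k - 1) * X.k) * choiceBound X * (X.n + 1)) ∧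
        BestOK X γ s' ∧ (Reached (X.val γ E) s → Reached (X.val γ E) s') ∧
        ((∀ l < X.k, s.arr aTau l + sh = E (X.su l)) → Reached (X.val γ E) s') := by
  have hk := X.k_le
  refine wp_forLt (X.n + 1 - X.k) (6000 * (2 ^ ((X.k - 1) * X.k) * choiceBound X))
    (fun i s' => BestOK X γ s' ∧ (Reached (X.val γ E) s → Reached (X.val γ E) s') ∧
        ((∀ l < X.k, s.arr aTau l + sh = E (X.su l)) → sh < i → Reached (X.val γ E) s'))
    (by cases γ <;> rfl) ?_ ?_ ?_ ?_
  · intro s' hF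
    simp [Exp.eval, hF.reg rN (by cases γ <;> rfl), hF.reg rK (by cases γ <;> rfl), hE.n, hE.k]
  · exact ⟨hB.congr (by simp +decide) (by simp +decide) rfl,
      fun h => h.congr (by simp +decide) (by simp +decide), fun _ h => absurd h (Nat.not_lt_zero _)⟩
  · rintro i s₁ hi hF hr ⟨h1, h2, h3⟩
    have hE₁ : Env X s₁ := hE.frame hF (by cases γ <;> rfl)
    have htau : s₁.arr aTau = s.arr aTau := hF.arr aTau (by cases γ <;> rfl)
    refine (families_spec γ hE₁ hm (by rw [TauOK, htau]; exact hτ) (by omega) h1 hT).conseq ?_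
    rintro t s₂ - ⟨ht, hB₂, hR₂, hG₂⟩
    have hc : ∀ {w}, Reached w s₂ → Reached w (s₂.setReg rShift (i + 1)) := fun h =>
      h.congr (by simp +decide) (by simp +decide)
    refine ⟨ht, hB₂.congr (by simp +decide) (by simp +decide) rfl, fun h => hc (hR₂ (h2 h)),
      fun h hlt => hc ?_⟩
    by_cases he : i = sh
    · exact hG₂ (hr.trans he) (by rw [htau]; exact h)
    · exact hR₂ (h3 h (by omega))
  · rintro t s₁ ht hF _ ⟨h1, h2, h3⟩
    have hle := hT.le
    -- The loop covers the shifts below `n + 1 - k`, among them the target shift, as it is at most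
    -- `n - k`.
    refine ⟨?_, h1, h2, fun h => h3 h (by omega)⟩
    simp only [Exp.cost] at ht
    obtain ⟨hb1, -, -⟩ := le_choiceBound X
    have h2 : 1 ≤ 2 ^ ((X.k - 1) * X.k) := Nat.one_le_two_pow
    set Z := 2 ^ ((X.k - 1) * X.k)
    have h4 : 1 ≤ Z * choiceBound X := Nat.mul_pos h2 hb1
    set Y := Z * choiceBound X
    have h5 : (X.n + 1 - X.k) * (6000 * Y + (1 + 1 + 1 + 1 + 1) + 7) ≤
        (X.n + 1) * (6012 * Y) := Nat.mul_le_mul (Nat.sub_le _ _) (by omega)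
    have h6 : (X.n + 1) * (6012 * Y) = 6012 * (Y * (X.n + 1)) := by ring
    have h7 : 1 ≤ Y * (X.n + 1) := Nat.mul_pos h4 (Nat.succ_pos _)
    omega

/-- The argument of the family counter one level up: when the tuple counter reads the successor
times of `E` minus the shift, the inner loops reach the value of `E`. Hence on termination it has
been reached unconditionally. -/
theorem tuples_spec (γ : Objective) (hE : Env X s) (hm : 1 ≤ X.m) {E f : ℕ → ℕ} {sh : ℕ}
    (hT : Target X E f sh) :
    wp (.block [.set rFound (.lit 0), firstTau,
      .loop (.eq (.reg rDoneTau) (.lit 0)) (.block [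
        .forLt rShift (.sub (.add (.reg rN) (.lit 1)) (.reg rK)) (.block [
          firstSel, .loop (.eq (.reg rDoneSel) (.lit 0)) (.block [tryChoice γ, nextSel])]),
        nextTau])]) s
      fun t s' =>
        t ≤ 8000 * (X.k ^ X.k * (2 ^ ((X.k - 1) * X.k) * choiceBound X * (X.n + 1))) ∧
        BestOK X γ s' ∧ Reached (X.val γ E) s' := by
  set v := X.val γ E
  set V₀ := radixVal (fun _ => X.k) (fun l => E (X.su l) - sh - 1) X.k with hV₀
  have hWk : weight (fun _ => X.k) X.k = X.k ^ X.k := by simp [weight]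
  set B := 2 ^ ((X.k - 1) * X.k) * choiceBound X * (X.n + 1) with hBdef
  obtain ⟨hb1, hb2, -⟩ := le_choiceBound X
  have hZ : 1 ≤ 2 ^ ((X.k - 1) * X.k) := Nat.one_le_two_pow
  have hcb : choiceBound X ≤ B := by
    rw [hBdef, Nat.mul_assoc, Nat.mul_comm, Nat.mul_assoc]
    exact Nat.le_mul_of_pos_right _ (Nat.mul_pos (Nat.succ_pos _) hZ)
  rw [wp_block_cons, wp_set, wp_block_cons]
  refine (firstTau_spec (s := s.setReg rFound 0) (by simpa +decide using hE)).conseq ?_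
  rintro t₁ s₁ hF₁ ⟨ht₁, hτ₁, hv₁, hd₁⟩
  have hE₁ : Env X s₁ := Env.frame (s := s.setReg rFound 0) (by simpa +decide using hE) hF₁ rfl
  have hdigit : ∀ s', TauOK X s' → ∀ l < X.k, s'.arr aTau l - 1 < X.k := fun s' h l hl => by
    have := h l hl
    omega
  have hdigit₀ : ∀ l < X.k, E (X.su l) - sh - 1 < X.k := fun l hl => by
    have := hT.window l hl
    omega
  rw [wp_block_cons]
  refine wp_loop (fun s' => if s'.reg rDoneTau = 0 then X.k ^ X.k - tauVal X s' else 0)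
    (7200 * B) (fun s' => TauOK X s' ∧ BestOK X γ s' ∧
        (Reached v s' ∨ s'.reg rDoneTau = 0 ∧ tauVal X s' ≤ V₀)) ?_ ?_ ?_
  · refine ⟨hτ₁, Or.inl ?_, Or.inr ⟨hd₁, hv₁ ▸ Nat.zero_le _⟩⟩
    rw [hF₁.reg rFound rfl, State.reg_setReg_self]
  · rintro s₂ hF₂ ⟨hτ₂, hB₂, hG₂⟩ hd₂
    have hd₂' : s₂.reg rDoneTau = 0 := by simpa [Test.Holds, Exp.eval] using hd₂
    have hE₂ : Env X s₂ := hE₁.frame hF₂ (by cases γ <;> rfl)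
    have hVW : tauVal X s₂ < X.k ^ X.k := by
      rw [← hWk]; exact radixVal_lt (hdigit s₂ hτ₂)
    have hV₀W : V₀ < X.k ^ X.k := by
      rw [← hWk]; exact radixVal_lt hdigit₀
    rw [wp_block_cons]
    refine (shifts_spec γ hE₂ hm hτ₂ hB₂ hT).conseq ?_
    rintro t₃ s₃ hF₃ ⟨ht₃, hB₃, hR₃, hG₃⟩
    have hE₃ : Env X s₃ := hE₂.frame hF₃ (by cases γ <;> rfl)
    have htau : s₃.arr aTau = s₂.arr aTau := hF₃.arr aTau (by cases γ <;> rfl)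
    have hτ₃ : TauOK X s₃ := by rw [TauOK, htau]; exact hτ₂
    have hV₃ : tauVal X s₃ = tauVal X s₂ := by simp only [tauVal, htau]
    rw [wp_block_cons]
    refine (nextTau_spec hE₃ hτ₃).conseq ?_
    rintro t₄ s₄ hF₄ ⟨ht₄, hτ₄, hd₄, hv₄⟩
    rw [hV₃] at hv₄
    have hV₄W : tauVal X s₄ < X.k ^ X.k := by
      rw [← hWk]; exact radixVal_lt (hdigit s₄ hτ₄)
    rw [wp_block_nil]
    have hR₄ : Reached v s₃ → Reached v s₄ := fun h => h.congr (hF₄.reg _ rfl) (hF₄.reg _ rfl)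
    refine ⟨by omega, ⟨hτ₄, hB₃.congr (hF₄.reg _ rfl) (hF₄.reg _ rfl) (hF₄.arr _ rfl), ?_⟩, ?_⟩
    · rcases hG₂ with h | ⟨-, h⟩
      · exact Or.inl (hR₄ (hR₃ h))
      · rcases eq_or_lt_of_le h with he | hlt
        · left
          refine hR₄ (hG₃ fun l hl => ?_)
          have h1 : s₂.arr aTau l - 1 = E (X.su l) - sh - 1 :=
            radixVal_inj (hdigit s₂ hτ₂) hdigit₀ he l hl
          have h2 := hτ₂ l hl
          have h3 := hT.window l hl
          omega
        · right
          have hz : s₄.reg rDoneTau = 0 := by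
            by_contra hne
            have h1 : s₄.reg rDoneTau = 1 := by omega
            rw [h1] at hv₄
            omega
          rw [hz] at hv₄
          exact ⟨hz, by omega⟩
    · rw [if_pos hd₂']
      split_ifs with hz
      · rw [hz] at hv₄
        omega
      · omega
  · rintro t₂ s₂ ht₂ hF₂ ⟨hτ₂, hB₂, hG₂⟩ hd₂
    have hd₂' : ¬ s₂.reg rDoneTau = 0 := by simpa [Test.Holds, Exp.eval] using hd₂
    rw [wp_block_nil]
    refine ⟨?_, hB₂, hG₂.resolve_right fun h => hd₂' h.1⟩
    have h1 : (if s₁.reg rDoneTau = 0 then X.k ^ X.k - tauVal X s₁ else 0) ≤ X.k ^ X.k := by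
      rw [if_pos hd₁]
      exact Nat.sub_le _ _
    -- This includes `0 ^ 0 = 1`: without successors there is still one, empty, tuple to try.
    have h2 : 1 ≤ X.k ^ X.k := Nat.one_le_iff_ne_zero.2 (by simp)
    simp only [Test.cost, Exp.cost] at ht₂ ⊢
    have h3 := Nat.mul_le_mul_right (7200 * B + (1 + 1 + 1) + 1) h1
    have h4 := Nat.mul_le_mul_right B h2
    have h5 : X.k ^ X.k * (7200 * B + (1 + 1 + 1) + 1) =
      7200 * (X.k ^ X.k * B) + 4 * X.k ^ X.k := by ring
    have h6 := Nat.mul_le_mul_left (X.k ^ X.k) (hb1.trans hcb)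
    omega

end
end AndOrSched

namespace AndOrSched

open Finset
section

/-! ### Preprocessing the input -/

variable {X : Ctx} {s : State}

/-- The number of successors among the jobs below `j`. -/
noncomputable def Ctx.countS (X : Ctx) (j : ℕ) : ℕ := by
  classical exact Nat.count X.isS j

theorem Ctx.countS_succ_of (j : ℕ) (h : X.isS j) : X.countS (j + 1) = X.countS j + 1 := by
  classical
  unfold Ctx.countS
  rw [Nat.count_succ, if_pos h]

theorem Ctx.countS_succ_of_not (j : ℕ) (h : ¬ X.isS j) : X.countS (j + 1) = X.countS j := by
  classical
  unfold Ctx.countS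
  rw [Nat.count_succ, if_neg h, Nat.add_zero]

theorem Ctx.su_countS (j : ℕ) (h : X.isS j) : X.su (X.countS j) = j := by
  classical
  exact Nat.nth_count h

/-- Row offsets arise as a running sum because the machine cannot multiply. The bound on `aKind`
matters because the successor flag starts as a copy of it and is later tested both against 0 and
against 1. -/
theorem preprocess_spec (hn : s.reg rN = X.n) (hm : s.reg rM = X.m)
    (hpred : ∀ i < X.n, ∀ j < X.n, s.arr aPred (j * X.n + i) = 1 ↔ X.pred i j)
    (hkind : ∀ j < X.n, (s.arr aKind j = 1 ↔ X.isOr j) ∧ s.arr aKind j ≤ 1) :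
    wp preprocess s fun t s' => t ≤ 100 * (X.n * X.n) + 200 * X.n + 100 ∧ Env X s' := by
  rw [preprocess, wp_block_cons, wp_set, wp_block_cons]
  refine wp_forLt X.n 20 (fun J s' => s'.reg rAux = J * X.n ∧ ∀ j < J, s'.arr aOff j = j * X.n)
    rfl ?_ ?_ ?_ ?_
  · intro s' hF
    simp +decide [Exp.eval, hF.reg rN rfl, hn]
  · exact ⟨by simp +decide [Exp.eval], by simp⟩
  · rintro J s₁ hJ hF hr ⟨h1, h2⟩
    have hn₁ : s₁.reg rN = X.n := by
      rw [hF.reg rN rfl, State.reg_setReg_of_ne _ _ (by decide), hn]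
    simp +decide only [wp_block_cons, wp_block_nil, wp_set, wp_store, Exp.eval, Exp.cost, hr, h1,
      State.arr_setReg, State.arr_setArr_self, State.reg_setArr, hn₁, State.reg_setReg_of_ne,
      State.reg_setReg_self]
    refine ⟨trivial, by ring, fun j hj => ?_⟩
    by_cases h : j = J
    · rw [h, Function.update_self]
    · rw [Function.update_of_ne h]; exact h2 j (by omega)
  rintro t₁ s₁ ht₁ hF₁ _ ⟨-, hoff⟩
  have hn₁ : s₁.reg rN = X.n := by
    rw [hF₁.reg rN rfl, State.reg_setReg_of_ne _ _ (by decide), hn]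
  have hm₁ : s₁.reg rM = X.m := by
    rw [hF₁.reg rM rfl, State.reg_setReg_of_ne _ _ (by decide), hm]
  have hP₁ : s₁.arr aPred = s.arr aPred := hF₁.arr aPred rfl
  have hK₁ : s₁.arr aKind = s.arr aKind := hF₁.arr aKind rfl
  simp only [wp_block_cons, wp_set, Exp.eval, Exp.cost]
  refine wp_forLt X.n (40 * X.n + 60) (fun J s' => s'.reg rK = X.countS J ∧
    (∀ l < X.countS J, s'.arr aSucc l = X.su l) ∧
    ∀ j < J, (s'.arr aIsSucc j = 1 ↔ X.isS j) ∧ (s'.arr aIsSucc j = 0 ↔ ¬ X.isS j))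
    rfl ?_ ?_ ?_ ?_
  · intro s' hF
    simp +decide [Exp.eval, hF.reg rN rfl, hn₁]
  · have h0 : X.countS 0 = 0 := by simp [Ctx.countS]
    rw [h0]
    exact ⟨by simp +decide, by simp, by simp⟩
  · rintro J s₂ hJ hF hr ⟨h1, h2, h3⟩
    have hP₂ : s₂.arr aPred = s.arr aPred := by rw [hF.arr aPred rfl, State.arr_setReg, hP₁]
    have hK₂ : s₂.arr aKind = s.arr aKind := by rw [hF.arr aKind rfl, State.arr_setReg, hK₁]
    have hO₂ : s₂.arr aOff = s₁.arr aOff := by rw [hF.arr aOff rfl, State.arr_setReg]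
    have hn₂ : s₂.reg rN = X.n := by
      rw [hF.reg rN rfl, State.reg_setReg_of_ne _ _ (by decide), hn₁]
    rw [wp_block_cons, wp_store, wp_block_cons]
    simp only [Exp.eval, Exp.cost, hr, hK₂]
    refine wp_forLt X.n 30 (fun i s' => (∀ j, j ≠ J → s'.arr aIsSucc j = s₂.arr aIsSucc j) ∧
      (s'.arr aIsSucc J = 1 ↔ X.isOr J ∨ ∃ i' < i, X.pred i' J) ∧ s'.arr aIsSucc J ≤ 1)
      rfl ?_ ?_ ?_ ?_
    · intro s' hF
      simp +decide [Exp.eval, hF.reg rN rfl, hn₂]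
    · simp +contextual [(hkind J hJ).1, (hkind J hJ).2]
    · rintro i s₃ hi hF₃ hr₃ ⟨g1, g2, g3⟩
      have hP₃ : s₃.arr aPred = s.arr aPred := by rw [hF₃.arr aPred rfl, ← hP₂]; rfl
      have hO₃ : s₃.arr aOff = s₁.arr aOff := by rw [hF₃.arr aOff rfl, ← hO₂]; rfl
      have hJ₃ : s₃.reg rJ = J := by rw [hF₃.reg rJ rfl, State.reg_setArr, hr]
      have hb : (isPred (.reg rI) (.reg rJ)).Holds s₃ ↔ X.pred i J := by
        rw [← hpred i hi J hJ, ← hoff J hJ, ← hP₃, ← hO₃]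
        simp [isPred, Test.Holds, Exp.eval, hJ₃, hr₃]
      have hc : (isPred (.reg rI) (.reg rJ)).cost = 7 := rfl
      rw [wp_when, hb, hc]
      simp only [wp_store, Exp.eval, Exp.cost, hJ₃, State.arr_setReg, State.arr_setArr_self]
      refine ⟨fun h => ⟨by omega, fun j hj => ?_, ?_, ?_⟩, fun h => ⟨by omega, g1, ?_, g3⟩⟩
      · rw [Function.update_of_ne hj, g1 j hj]
      · rw [Function.update_self]
        exact iff_of_true rfl (Or.inr ⟨i, by omega, h⟩)
      · rw [Function.update_self]
      · rw [g2]
        refine or_congr_right ⟨fun ⟨i', hi', hp⟩ => ⟨i', by omega, hp⟩, fun ⟨i', hi', hp⟩ => ?_⟩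
        have : i' ≠ i := by rintro rfl; exact h hp
        exact ⟨i', by omega, hp⟩
    · rintro t s₃ ht hF₃ _ ⟨g1, g2, g3⟩
      have hJ₃ : s₃.reg rJ = J := by rw [hF₃.reg rJ rfl, State.reg_setArr, hr]
      have hk₃ : s₃.reg rK = X.countS J := by rw [hF₃.reg rK rfl, State.reg_setArr, h1]
      have hS₃ : s₃.arr aSucc = s₂.arr aSucc := by rw [hF₃.arr aSucc rfl]; rfl
      have hiff : s₃.arr aIsSucc J = 1 ↔ X.isS J := by
        rw [g2]; exact ⟨fun h => ⟨hJ, h⟩, fun h => h.2⟩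
      have hall : ∀ j < J + 1, (s₃.arr aIsSucc j = 1 ↔ X.isS j) ∧
          (s₃.arr aIsSucc j = 0 ↔ ¬ X.isS j) := by
        intro j hj
        by_cases h : j = J
        · rw [h]
          refine ⟨hiff, ?_⟩
          rw [← hiff]
          omega
        · rw [g1 j h]; exact h3 j (by omega)
      simp +decide only [wp_block_cons, wp_block_nil, wp_when, wp_set, wp_store, Test.Holds,
        Test.cost, Exp.eval, Exp.cost, hJ₃, hk₃, hiff, State.arr_setReg, State.arr_setArr_self,
        State.arr_setArr_of_ne, State.reg_setArr, State.reg_setReg_of_ne, State.reg_setReg_self,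
        hS₃] at ht ⊢
      refine ⟨fun h => ⟨by omega, ?_, fun l hl => ?_, hall⟩, fun h => ⟨by omega, ?_, fun l hl => ?_, hall⟩⟩
      · rw [Ctx.countS_succ_of J h]
      · rw [Ctx.countS_succ_of J h] at hl
        by_cases he : l = X.countS J
        · rw [he, Function.update_self, Ctx.su_countS J h]
        · rw [Function.update_of_ne he]; exact h2 l (by omega)
      · rw [Ctx.countS_succ_of_not J h]
      · rw [Ctx.countS_succ_of_not J h] at hl
        exact h2 l hl
  · rintro t₂ s₂ ht₂ hF₂ _ ⟨h1, h2, h3⟩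
    rw [wp_block_nil]
    have hP₂ : s₂.arr aPred = s.arr aPred := by rw [hF₂.arr aPred rfl, State.arr_setReg, hP₁]
    have hK₂ : s₂.arr aKind = s.arr aKind := by rw [hF₂.arr aKind rfl, State.arr_setReg, hK₁]
    have hO₂ : ∀ j < X.n, s₂.arr aOff j = j * X.n := by
      rw [hF₂.arr aOff rfl, State.arr_setReg]; exact hoff
    refine ⟨?_, ?_, ?_, h1, hO₂, fun i hi j hj => ?_, fun j hj => ?_, fun j hj => (h3 j hj).1,
      fun j hj => (h3 j hj).2, h2⟩
    · simp only [Exp.cost] at ht₁ ht₂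
      nlinarith
    · rw [hF₂.reg rN rfl, State.reg_setReg_of_ne _ _ (by decide), hn₁]
    · rw [hF₂.reg rM rfl, State.reg_setReg_of_ne _ _ (by decide), hm₁]
    · rw [hP₂, hO₂ j hj]; exact hpred i hi j hj
    · rw [hK₂]; exact (hkind j hj).1

/-! ### From instances to jobs that are natural numbers -/

namespace Instance

variable (I : Instance)

/-- The instance with natural numbers as jobs. -/
def ctx : Ctx where
  n := I.n
  m := I.m
  pred i j := ∃ (hi : i < I.n) (hj : j < I.n), (⟨i, hi⟩ : Fin I.n) ∈ (I.ψ ⟨j, hj⟩).preds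
  isOr j := ∃ hj : j < I.n, (I.ψ ⟨j, hj⟩).isDisj = true

variable {I}

theorem pred_ctx (i j : Fin I.n) : I.ctx.pred i j ↔ i ∈ (I.ψ j).preds :=
  ⟨fun ⟨_, _, h⟩ => h, fun h => ⟨i.2, j.2, h⟩⟩

theorem isOr_ctx (j : Fin I.n) : I.ctx.isOr j ↔ (I.ψ j).isDisj = true :=
  ⟨fun ⟨_, h⟩ => h, fun h => ⟨j.2, h⟩⟩

/-- A disjunction is non-trivial even if empty, whereas a conjunction is so only if it has a
predecessor; this explains the asymmetry in `Ctx.isS`. -/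
theorem isS_ctx (j : Fin I.n) : I.ctx.isS j ↔ I.ψ j ≠ Constraint.conj ∅ := by
  have h1 : I.ctx.isS j ↔ (I.ψ j).isDisj = true ∨ ∃ i, i ∈ (I.ψ j).preds := by
    refine ⟨fun ⟨_, h⟩ => h.imp (isOr_ctx j).1 fun ⟨i, hi, hp⟩ => ⟨⟨i, hi⟩, (pred_ctx ⟨i, hi⟩ j).1 hp⟩,
      fun h => ⟨j.2, h.imp (isOr_ctx j).2 fun ⟨i, hp⟩ => ⟨i, i.2, (pred_ctx i j).2 hp⟩⟩⟩
  rw [h1]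
  cases h : I.ψ j with
  | conj P =>
    simp only [Constraint.isDisj, Constraint.preds, Bool.false_eq_true, false_or, ne_eq,
      Constraint.conj.injEq]
    exact ⟨fun ⟨i, hi⟩ he => by simp [he] at hi, fun h => nonempty_iff_ne_empty.2 h⟩
  | disj P => simp [Constraint.isDisj]

theorem ks_eq : I.ks = I.ctx.k := by
  classical
  rw [Ctx.k_eq_card, ks, successors, card_filter, card_filter]
  refine Eq.trans ?_ (Finset.sum_range fun j => if I.ctx.isS j then 1 else 0).symm
  refine sum_congr rfl fun j _ => ?_
  simp only [isS_ctx]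

theorem load_ctx (C : ℕ → ℕ) (t : ℕ) :
    (univ.filter fun j : Fin I.n => C j = t).card = I.ctx.load C t := by
  rw [Ctx.load, card_filter, card_filter]
  exact (Finset.sum_range fun j => if C j = t then 1 else 0).symm

theorem feasibleSchedule_iff (C : ℕ → ℕ) :
    I.FeasibleSchedule (fun j => C j) ↔ I.ctx.Feas C := by
  have hand : ∀ j, (I.ψ j).isDisj = false →
      ((I.ψ j).Holds (fun i => C i < C j) ↔ ∀ i ∈ (I.ψ j).preds, C i < C j) := by
    intro j h
    cases hj : I.ψ j with
    | conj P => rfl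
    | disj P => rw [hj] at h; cases h
  have hor : ∀ j, (I.ψ j).isDisj = true →
      ((I.ψ j).Holds (fun i => C i < C j) ↔ ∃ i ∈ (I.ψ j).preds, C i < C j) := by
    intro j h
    cases hj : I.ψ j with
    | conj P => rw [hj] at h; cases h
    | disj P => rfl
  constructor
  · rintro ⟨h1, h2, h3⟩
    refine ⟨fun i hi => h1 ⟨i, hi⟩, fun t => ?_, fun j hj ho i hi hp => ?_, fun j hj ho => ?_⟩
    · rw [← load_ctx]; exact h2 t
    · have ho' := fun h => ho ((isOr_ctx ⟨j, hj⟩).2 h)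
      exact (hand ⟨j, hj⟩ (by simpa using ho')).1 (h3 ⟨j, hj⟩) ⟨i, hi⟩ ((pred_ctx ⟨i, hi⟩ ⟨j, hj⟩).1 hp)
    · obtain ⟨i, hp, hlt⟩ := (hor ⟨j, hj⟩ ((isOr_ctx ⟨j, hj⟩).1 ho)).1 (h3 ⟨j, hj⟩)
      exact ⟨i, i.2, (pred_ctx i ⟨j, hj⟩).2 hp, hlt⟩
  · rintro ⟨h1, h2, h3, h4⟩
    refine ⟨fun j => h1 j j.2, fun t => ?_, fun j => ?_⟩
    · rw [load_ctx]; exact h2 t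
    · by_cases ho : (I.ψ j).isDisj = true
      · rw [hor j ho]
        obtain ⟨i, hi, hp, hlt⟩ := h4 j j.2 ((isOr_ctx j).2 ho)
        exact ⟨⟨i, hi⟩, (pred_ctx ⟨i, hi⟩ j).1 hp, hlt⟩
      · rw [hand j (by simpa using ho)]
        exact fun i hi => h3 j j.2 (fun h => ho ((isOr_ctx j).1 h)) i i.2 ((pred_ctx i j).2 hi)

theorem value_eq (γ : Objective) (C : ℕ → ℕ) :
    γ.value (fun j : Fin I.n => C j) = I.ctx.val γ C := by
  cases γ
  · refine le_antisymm (Finset.sup_le fun j _ => ?_) (Finset.sup_le fun i hi => ?_)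
    · exact Finset.le_sup (f := C) (mem_range.2 j.2)
    · exact Finset.le_sup (f := fun j : Fin I.n => C j) (mem_univ (⟨i, mem_range.1 hi⟩ : Fin I.n))
  · exact (Finset.sum_range C).symm

theorem exists_extension (C : Fin I.n → ℕ) : ∃ C' : ℕ → ℕ, (fun j : Fin I.n => C' j) = C :=
  ⟨fun i => if h : i < I.n then C ⟨i, h⟩ else 0, by funext j; simp⟩

theorem exists_feas (h : I.Feasible) : ∃ C, I.ctx.Feas C := by
  obtain ⟨C, hC⟩ := h
  obtain ⟨C', rfl⟩ := exists_extension C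
  exact ⟨C', (feasibleSchedule_iff C').1 hC⟩

theorem preprocess_input :
    wp preprocess I.input fun t s' => t ≤ 100 * (I.n * I.n) + 200 * I.n + 100 ∧ Env I.ctx s' := by
  refine preprocess_spec (X := I.ctx) rfl rfl (fun i hi j hj => ?_) fun j hj => ?_
  · have h : (∃ i' j' : Fin I.n, j * I.n + i = j'.val * I.n + i'.val ∧ i' ∈ (I.ψ j').preds) ↔
        I.ctx.pred i j := by
      constructor
      · rintro ⟨i', j', he, hp⟩
        obtain ⟨rfl, rfl⟩ := index_inj (X := I.ctx) (l := j) (l₁ := j') hi i'.2 he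
        exact (pred_ctx i' j').2 hp
      · exact fun hp => ⟨⟨i, hi⟩, ⟨j, hj⟩, rfl, (pred_ctx ⟨i, hi⟩ ⟨j, hj⟩).1 hp⟩
    rw [← h]
    change (if aPred = aPred then if ∃ i' j' : Fin I.n, j * I.n + i = j'.val * I.n + i'.val ∧
      i' ∈ (I.ψ j').preds then 1 else 0 else if aPred = aKind then
      if ∃ j' : Fin I.n, j * I.n + i = j'.val ∧ (I.ψ j').isDisj = true then 1 else 0 else 0) = 1 ↔ _
    rw [if_pos rfl]
    split_ifs with h' <;> simp [h']
  · have h : (∃ j' : Fin I.n, j = j'.val ∧ (I.ψ j').isDisj = true) ↔ I.ctx.isOr j := by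
      constructor
      · rintro ⟨j', rfl, hp⟩
        exact (isOr_ctx j').2 hp
      · exact fun hp => ⟨⟨j, hj⟩, rfl, (isOr_ctx ⟨j, hj⟩).1 hp⟩
    rw [← h]
    change ((if aKind = aPred then if ∃ i' j' : Fin I.n, j = j'.val * I.n + i'.val ∧
      i' ∈ (I.ψ j').preds then 1 else 0 else if aKind = aKind then
      if ∃ j' : Fin I.n, j = j'.val ∧ (I.ψ j').isDisj = true then 1 else 0 else 0) = 1 ↔ _) ∧
      (if aKind = aPred then if ∃ i' j' : Fin I.n, j = j'.val * I.n + i'.val ∧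
      i' ∈ (I.ψ j').preds then 1 else 0 else if aKind = aKind then
      if ∃ j' : Fin I.n, j = j'.val ∧ (I.ψ j').isDisj = true then 1 else 0 else 0) ≤ 1
    rw [if_neg (by decide), if_pos rfl]
    split_ifs with h' <;> simp [h']

end Instance

/-- The algorithm finds an optimal schedule, in time independent of the number of machines. -/
theorem andOrAlgSucc_spec (γ : Objective) (I : Instance) (hn : 0 < I.n) (hI : I.Feasible) :
    ∃ (t : ℕ) (s : State), Exec (andOrAlgSucc γ) I.input t s ∧
      I.OptimalSchedule γ (I.output s) ∧
      t ≤ 100000 * (I.ks ^ I.ks * 2 ^ (I.ks ^ 2) * I.n ^ 3) := by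
  obtain ⟨E, hE, hopt, sh, hle, hwin⟩ := Ctx.exists_optimal_window γ (Instance.exists_feas hI)
  -- Some job occupies some slot of a feasible schedule.
  have hm : 1 ≤ I.ctx.m := by
    have h1 : 0 < I.ctx.load E (E 0) := card_pos.2 ⟨0, mem_filter.2 ⟨mem_range.2 hn, rfl⟩⟩
    exact h1.trans_le (hE.load_le (E 0))
  obtain ⟨f, hf⟩ : ∃ f : ℕ → ℕ, Target I.ctx E f sh := by
    -- The default 0 is used where no free predecessor precedes the job in `E`; nothing is required
    -- of `f` there.
    have : ∀ l, ∃ w, (∃ w < I.ctx.n, ¬ I.ctx.isS w ∧ I.ctx.pred w (I.ctx.su l) ∧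
        E w < E (I.ctx.su l)) →
        w < I.ctx.n ∧ ¬ I.ctx.isS w ∧ I.ctx.pred w (I.ctx.su l) ∧ E w < E (I.ctx.su l) := by
      intro l
      by_cases h : ∃ w < I.ctx.n, ¬ I.ctx.isS w ∧ I.ctx.pred w (I.ctx.su l) ∧ E w < E (I.ctx.su l)
      · obtain ⟨w, hw⟩ := h
        exact ⟨w, fun _ => hw⟩
      · exact ⟨0, fun h' => absurd h' h⟩
    choose f hf using this
    exact ⟨f, hE, hle, hwin, fun l _ => hf l⟩
  have hwp : wp (andOrAlgSucc γ) I.input fun t s =>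
      t ≤ 100000 * (I.ks ^ I.ks * 2 ^ (I.ks ^ 2) * I.n ^ 3) ∧ BestOK I.ctx γ s ∧
        Reached (I.ctx.val γ E) s := by
    rw [andOrAlgSucc, wp_block_cons]
    refine Instance.preprocess_input.conseq ?_
    rintro t₁ s₁ - ⟨ht₁, hE₁⟩
    refine (tuples_spec γ hE₁ hm hf).conseq ?_
    rintro t₂ s₂ - ⟨ht₂, h⟩
    refine ⟨?_, h⟩
    rw [Instance.ks_eq]
    have hkn : I.ctx.n = I.n := rfl
    set k := I.ctx.k with hk
    rw [choiceBound, ← hk, hkn] at ht₂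
    have e1 : k + 1 ≤ 2 ^ k := Nat.lt_two_pow_self
    -- The spare `2 ^ k` comes from the uncounted diagonal and pays for `k + 1`. Truncated
    -- subtraction is harmless at `k = 0`.
    have e2 : 2 ^ ((k - 1) * k) * 2 ^ k = 2 ^ (k ^ 2) := by
      rw [← pow_add]
      congr 1
      cases k with
      | zero => rfl
      | succ k => simp only [Nat.add_sub_cancel]; ring
    have e3 : (I.n + 1) * (I.n + 1) * (I.n + 1) ≤ 8 * I.n ^ 3 := by
      have : I.n + 1 ≤ 2 * I.n := by omega
      calc (I.n + 1) * (I.n + 1) * (I.n + 1) ≤ 2 * I.n * (2 * I.n) * (2 * I.n) := by gcongr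
        _ = 8 * I.n ^ 3 := by ring
    have e4 : k ^ k * (2 ^ ((k - 1) * k) * ((k + 1) * (I.n + 1) * (I.n + 1)) * (I.n + 1)) ≤
        k ^ k * 2 ^ (k ^ 2) * (8 * I.n ^ 3) := by
      calc k ^ k * (2 ^ ((k - 1) * k) * ((k + 1) * (I.n + 1) * (I.n + 1)) * (I.n + 1)) =
          k ^ k * (2 ^ ((k - 1) * k) * (k + 1)) * ((I.n + 1) * (I.n + 1) * (I.n + 1)) := by ring
        _ ≤ k ^ k * (2 ^ ((k - 1) * k) * 2 ^ k) * (8 * I.n ^ 3) := by gcongr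
        _ = _ := by rw [e2]
    have e5 : 1 ≤ k ^ k * 2 ^ (k ^ 2) :=
      Nat.mul_pos (Nat.one_le_iff_ne_zero.2 (by simp)) Nat.one_le_two_pow
    have e6 : I.n ≤ I.n ^ 3 := Nat.le_self_pow (by norm_num) _
    have e7 : I.n * I.n ≤ I.n ^ 3 := by
      rw [← pow_two]; exact Nat.pow_le_pow_right hn (by norm_num)
    have e8 := Nat.mul_le_mul_right (I.n ^ 3) e5
    have e9 : k ^ k * 2 ^ (k ^ 2) * (8 * I.n ^ 3) = 8 * (k ^ k * 2 ^ (k ^ 2) * I.n ^ 3) := by ring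
    omega
  obtain ⟨t, s, hexec, ht, hB, hR⟩ := hwp
  refine ⟨t, s, hexec, ?_, ht⟩
  obtain ⟨h1, h2⟩ := hR
  rcases hB with hB | ⟨-, hfeas, hbest⟩
  · rw [hB] at h1; cases h1
  refine ⟨(Instance.feasibleSchedule_iff _).2 hfeas, fun C' hC' => ?_⟩
  obtain ⟨C, rfl⟩ := Instance.exists_extension C'
  rw [Instance.value_eq]
  refine le_trans (le_of_eq (Instance.value_eq γ (s.arr aOut))) ?_
  rw [← hbest]
  exact h2.trans (hopt C ((Instance.feasibleSchedule_iff C).1 hC'))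

/-- The bound is primitive recursive, being built from powers and products. -/
theorem computable_bound (c : ℕ) : Computable fun k : ℕ => c * (k ^ k * 2 ^ (k ^ 2)) := by
  have hpow : Primrec₂ ((· ^ ·) : ℕ → ℕ → ℕ) := Primrec₂.unpaired'.1 Nat.Primrec.pow
  exact (Primrec.nat_mul.comp (Primrec.const c) (Primrec.nat_mul.comp
    (hpow.comp Primrec.id Primrec.id)
    (hpow.comp (Primrec.const 2) (hpow.comp Primrec.id (Primrec.const 2))))).to_comp

end
end AndOrSched

/-- Both parts follow from the bound without `m`: the first by weakening, the second with `f k =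
100000 * (k ^ k * 2 ^ (k ^ 2))` and exponent 3. Independence of `m` matters for the second part,
since `m` enters the input length only through its binary size. -/
theorem mainTheorem2 (γ : AndOrSched.Objective) :
    (∃ c : ℕ, ∀ I : AndOrSched.Instance, 0 < I.n → I.Feasible →
      ∃ (t : ℕ) (s : AndOrSched.State),
        AndOrSched.Exec (AndOrSched.andOrAlgSucc γ) I.input t s ∧
        I.OptimalSchedule γ (I.output s) ∧
        t ≤ c * (I.ks ^ I.ks * 2 ^ (I.ks ^ 2) * I.m * I.n ^ 3)) ∧
    (AndOrSched.schedulingBySuccessors γ).FPT := by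
  refine ⟨⟨100000, fun I hn hI => ?_⟩, AndOrSched.andOrAlgSucc γ, _, 3,
    AndOrSched.computable_bound 100000, fun ⟨I, hn, hI⟩ => ?_⟩
  · obtain ⟨t, s, hexec, hopt, ht⟩ := AndOrSched.andOrAlgSucc_spec γ I hn hI
    refine ⟨t, s, hexec, hopt, ht.trans (Nat.mul_le_mul_left _ ?_)⟩
    obtain ⟨C, -, hload, -⟩ := hI
    have h1 : 0 < (Finset.univ.filter fun j => C j = C ⟨0, hn⟩).card :=
      Finset.card_pos.2 ⟨⟨0, hn⟩, Finset.mem_filter.2 ⟨Finset.mem_univ _, rfl⟩⟩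
    -- Only this makes the factor `m` an enlargement of the bound.
    have hm : 1 ≤ I.m := h1.trans_le (hload (C ⟨0, hn⟩))
    exact Nat.mul_le_mul_right _ (Nat.le_mul_of_pos_right _ hm)
  · obtain ⟨t, s, hexec, hopt, ht⟩ := AndOrSched.andOrAlgSucc_spec γ I hn hI
    refine ⟨t, s, hexec, hopt, ht.trans ?_⟩
    -- The kinds of the constraints alone take `n` bits.
    have h1 : I.n ≤ I.inputLength := Nat.le_add_left _ _
    calc 100000 * (I.ks ^ I.ks * 2 ^ (I.ks ^ 2) * I.n ^ 3) =
        100000 * (I.ks ^ I.ks * 2 ^ (I.ks ^ 2)) * I.n ^ 3 := by ring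
      _ ≤ 100000 * (I.ks ^ I.ks * 2 ^ (I.ks ^ 2)) * I.inputLength ^ 3 := by gcongr
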